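/- Let $r>2$ be a real number, and let $P(n)=b_dn^d+\dots+b_1n+b_0$ be a polynomial with integer coefficients $b_j\in\mathbb Z$ and leading coefficient $b_d>0$. For $f:\mathbb Z\to\mathbb C$ and an integer $N\ge 1$ put $$K_N*f(x):=\frac1N\sum_{n=1}^N f(x+P(n)),\qquad x\in\mathbb Z,$$ and let $$\mathcal V^r(K_N*f)(x):=\sup_{i_0<i_1<i_2<\cdots}\Big(\sum_{k\ge 0}\big|K_{i_k}*f(x)-K_{i_{k+1}}*f(x)\big|^r\Big)^{1/r}\in[0,\infty],$$ where the supremum runs over all increasing sequences of positive integers. Then there is a finite constant $C_{r,P}$, depending only on $r$ and $P$, such that for every $f\in\ell^2(\mathbb Z)$, $$\|\mathcal V^r(K_N*f)\|_{\ell^2(\mathbb Z)}\le C_{r,P}\,\|f\|_{\ell^2(\mathbb Z)}.$$ -/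

import Mathlib

open scoped ENNReal NNReal

noncomputable section

/-- The `r`-variation `sup_{i_0 < i_1 < ...} (∑_k |a_{i_k} - a_{i_{k+1}}|^r)^{1/r}` of a complex
sequence `(a_N)_{N ≥ 1}`, with values in `[0, ∞]`. Every finite increasing sequence of indices
extends to an infinite one, so finite sequences are covered by the supremum as well. -/
def rVariation (r : ℝ) (a : ℕ+ → ℂ) : ℝ≥0∞ :=
  ⨆ (i : ℕ → ℕ+) (_ : StrictMono i), (∑' k : ℕ, ‖a (i k) - a (i (k + 1))‖ₑ ^ r) ^ (1 / r)

/-- The average `K_N * f (x) = (1 / N) ∑_{n = 1}^N f (x + P(n))` along the polynomial `P`. -/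
def polyAverage (P : Polynomial ℤ) (N : ℕ+) (f : ℤ → ℂ) (x : ℤ) : ℂ :=
  (1 / (N : ℂ)) * ∑ n ∈ Finset.Icc 1 (N : ℕ), f (x + P.eval (n : ℤ))

/-- The `ℓ²(ℤ)` norm of a nonnegative, possibly infinite function. -/
def l2Norm (g : ℤ → ℝ≥0∞) : ℝ≥0∞ :=
  (∑' x : ℤ, g x ^ (2 : ℝ)) ^ (1 / 2 : ℝ)

end

/-! ### Minkowski's inequality for sums in `[0, ∞]` and the `ℓ²` norm -/

/-! Write `f` as the Fourier coefficients of some `F` in `L²` of the circle; averaging along `P`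
becomes multiplication of `F` by the exponential sum `polyMult P N`. Two tools turn information on
multipliers into variational bounds. For `r ≥ 2` the variation is at most twice the `ℓ²` norm of the
sequence, so by Plancherel any family with `∑ |m_n|²` bounded uniformly on the circle is harmless
(`l2Norm_seqVar_multOp_le`). For families without such decay the input is Lépingle's inequality for
dyadic averages, which needs `r > 2`. It is proved by charging each increment of a path to a jump
between stopping times whose thresholds are relative to the running maximum
(`exists_scale_anchor_jump`). Averaging over translates of the dyadic grid carries it to Fejér
averages along progressions, uniformly in the step (`exists_l2Norm_seqVar_fejerAvg_le`).

The circle method describes the multipliers. By Weyl's inequality `polyMult P N α` is small unless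
`α` is near a torsion point of small order, and the complete sums `gaussMult P θ` decay like a power
of the order of `θ`. At scale `N ≈ 2^n` and degree `d`, the multiplier is close to `gaussMult P θ`
within `2^(-n * d)` of `θ`, summed over generations `s` (orders in `[2^s, 2^(s+1))`). Even the
square roots of the errors are summable over `n`, uniformly in `α`
(`exists_sqrt_norm_polyMult_sub_le`, `exists_sum_errWeight_le`).

For one generation, each frequency sees at most one arc, so the main terms are a constant times a
cut-off decreasing in `n`. Below scale `2^(2s+3)` a Rademacher–Menshov argument loses a factor
linear in `s`. Above it, all arcs are so narrow that one Fejér kernel with step `(2^(s+1))!`, which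
annihilates every centre, models all the cut-offs at once. The losses, of order `s + 1`, are beaten
by the geometric decay of the Gauss sums, which settles `N = 2^n`.

General `N` is reached by adding binary digits after the leading one. At stage `j` a dyadic block
contains `O(2^j)` numbers, and an increment `u` is both `O(2^(-j))` and bounded by the square of a
weight summable over the blocks. Writing `u² = (√u)³ √u` gains `2^(-3j/2)`, which outweighs the
`2^j` terms; this is why square roots of errors are needed. -/

theorem ENNReal.tsum_Lp_add_le {ι : Type*} (f g : ι → ℝ≥0∞) {p : ℝ} (hp : 1 ≤ p) :
    (∑' i, (f i + g i) ^ p) ^ (1 / p) ≤ (∑' i, f i ^ p) ^ (1 / p) + (∑' i, g i ^ p) ^ (1 / p) := by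
  let _ : MeasurableSpace ι := ⊤
  have h := ENNReal.lintegral_Lp_add_le (μ := MeasureTheory.Measure.count) (f := f) (g := g)
    (measurable_from_top.aemeasurable) (measurable_from_top.aemeasurable) hp
  simpa [MeasureTheory.lintegral_count] using h

/-- If `A` is the `ℓ²` norm, every `x i` is at most `A`, hence `x i ^ r ≤ A ^ (r - 2) * x i ^ 2`. -/
theorem ENNReal.tsum_Lp_le_of_le {ι : Type*} (x : ι → ℝ≥0∞) {r : ℝ} (hr : 2 ≤ r) :
    (∑' i, x i ^ r) ^ (1 / r) ≤ (∑' i, x i ^ (2 : ℝ)) ^ (1 / 2 : ℝ) := by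
  set A := (∑' i, x i ^ (2 : ℝ)) ^ (1 / 2 : ℝ) with hA
  have hr0 : 0 < r := by linarith
  have hxA : ∀ i, x i ≤ A := fun i => by
    have h : x i ^ (2 : ℝ) ≤ ∑' i, x i ^ (2 : ℝ) := ENNReal.le_tsum i
    calc x i = (x i ^ (2 : ℝ)) ^ (1 / 2 : ℝ) := by rw [← ENNReal.rpow_mul]; norm_num
      _ ≤ A := ENNReal.rpow_le_rpow h (by norm_num)
  have hA2 : A ^ (2 : ℝ) = ∑' i, x i ^ (2 : ℝ) := by
    rw [hA, ← ENNReal.rpow_mul]; norm_num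
  have key : ∑' i, x i ^ r ≤ A ^ r := by
    calc ∑' i, x i ^ r ≤ ∑' i, A ^ (r - 2) * x i ^ (2 : ℝ) := by
          refine ENNReal.tsum_le_tsum fun i => ?_
          have : x i ^ r = x i ^ (r - 2) * x i ^ (2 : ℝ) := by
            rw [← ENNReal.rpow_add_of_nonneg _ _ (by linarith) (by norm_num)]; congr 1; ring
          rw [this]
          exact mul_le_mul_left (ENNReal.rpow_le_rpow (hxA i) (by linarith)) _
      _ = A ^ r := by
          rw [ENNReal.tsum_mul_left, ← hA2,
            ← ENNReal.rpow_add_of_nonneg _ _ (by linarith) (by norm_num)]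
          congr 1; ring
  calc (∑' i, x i ^ r) ^ (1 / r) ≤ (A ^ r) ^ (1 / r) := ENNReal.rpow_le_rpow key (by positivity)
    _ = A := by rw [← ENNReal.rpow_mul, mul_one_div_cancel hr0.ne', ENNReal.rpow_one]

theorem l2Norm_mono {g h : ℤ → ℝ≥0∞} (H : ∀ x, g x ≤ h x) : l2Norm g ≤ l2Norm h := by
  unfold l2Norm
  refine ENNReal.rpow_le_rpow (ENNReal.tsum_le_tsum fun x => ?_) (by norm_num)
  exact ENNReal.rpow_le_rpow (H x) (by norm_num)

theorem l2Norm_add_le (g h : ℤ → ℝ≥0∞) : l2Norm (fun x => g x + h x) ≤ l2Norm g + l2Norm h := by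
  unfold l2Norm
  exact ENNReal.tsum_Lp_add_le g h (by norm_num)

theorem l2Norm_zero : l2Norm (fun _ => 0) = 0 := by
  simp [l2Norm]

theorem l2Norm_sum_le {ι : Type*} (s : Finset ι) (g : ι → ℤ → ℝ≥0∞) :
    l2Norm (fun x => ∑ i ∈ s, g i x) ≤ ∑ i ∈ s, l2Norm (g i) := by
  classical
  induction s using Finset.induction_on with
  | empty => simp [l2Norm_zero]
  | insert a s ha ih =>
    simp only [Finset.sum_insert ha]
    exact (l2Norm_add_le _ _).trans (by gcongr)

theorem l2Norm_sq (g : ℤ → ℝ≥0∞) : l2Norm g ^ (2 : ℝ) = ∑' x, g x ^ (2 : ℝ) := by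
  unfold l2Norm
  rw [← ENNReal.rpow_mul]; norm_num

theorem l2Norm_le_of_tsum_le {g : ℤ → ℝ≥0∞} {c : ℝ≥0∞} (h : ∑' x, g x ^ (2 : ℝ) ≤ c ^ (2 : ℝ)) :
    l2Norm g ≤ c := by
  rw [← l2Norm_sq] at h
  exact (ENNReal.rpow_le_rpow_iff (by norm_num)).1 h

/-- Monotone convergence: finite sums commute with monotone suprema. It removes the truncation `N ≤
2 ^ S` at the very end. -/
theorem l2Norm_iSup_of_monotone {g : ℕ → ℤ → ℝ≥0∞} (hg : Monotone g) :
    l2Norm (fun x => ⨆ n, g n x) ≤ ⨆ n, l2Norm (g n) := by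
  refine l2Norm_le_of_tsum_le ?_
  have h1 : ∀ x, (⨆ n, g n x) ^ (2 : ℝ) = ⨆ n, g n x ^ (2 : ℝ) := fun x =>
    (ENNReal.orderIsoRpow 2 (by norm_num)).map_iSup _
  simp_rw [h1]
  rw [ENNReal.tsum_eq_iSup_sum]
  refine iSup_le fun s => ?_
  rw [ENNReal.finsetSum_iSup_of_monotone
    (fun x a b hab => ENNReal.rpow_le_rpow (hg hab x) (by norm_num))]
  refine iSup_le fun n => ?_
  calc ∑ x ∈ s, g n x ^ (2 : ℝ) ≤ ∑' x, g n x ^ (2 : ℝ) := ENNReal.sum_le_tsum s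
    _ = l2Norm (g n) ^ (2 : ℝ) := (l2Norm_sq _).symm
    _ ≤ _ := ENNReal.rpow_le_rpow (le_iSup (fun n => l2Norm (g n)) n) (by norm_num)

/-! ### The `r`-variation along monotone index sequences -/

/-- The `r`-variation of a sequence indexed by `ℕ`, the supremum running over all monotone (not
necessarily strictly monotone) sequences of indices. -/
noncomputable def seqVar (r : ℝ) (a : ℕ → ℂ) : ℝ≥0∞ :=
  ⨆ (i : ℕ → ℕ) (_ : Monotone i), (∑' k : ℕ, ‖a (i k) - a (i (k + 1))‖ₑ ^ r) ^ (1 / r)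

theorem seqVar_add_le {r : ℝ} (hr : 1 ≤ r) (a b : ℕ → ℂ) :
    seqVar r (fun n => a n + b n) ≤ seqVar r a + seqVar r b := by
  refine iSup₂_le fun i hi => ?_
  calc (∑' k : ℕ, ‖a (i k) + b (i k) - (a (i (k + 1)) + b (i (k + 1)))‖ₑ ^ r) ^ (1 / r)
      ≤ (∑' k : ℕ, (‖a (i k) - a (i (k + 1))‖ₑ + ‖b (i k) - b (i (k + 1))‖ₑ) ^ r) ^ (1 / r) := by
        refine ENNReal.rpow_le_rpow (ENNReal.tsum_le_tsum fun k => ?_) (by positivity)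
        refine ENNReal.rpow_le_rpow ?_ (by positivity)
        rw [add_sub_add_comm]
        exact enorm_add_le _ _
    _ ≤ _ := ENNReal.tsum_Lp_add_le _ _ hr
    _ ≤ _ := add_le_add
        (le_iSup₂ (f := fun (i : ℕ → ℕ) (_ : Monotone i) =>
          (∑' k : ℕ, ‖a (i k) - a (i (k + 1))‖ₑ ^ r) ^ (1 / r)) i hi)
        (le_iSup₂ (f := fun (i : ℕ → ℕ) (_ : Monotone i) =>
          (∑' k : ℕ, ‖b (i k) - b (i (k + 1))‖ₑ ^ r) ^ (1 / r)) i hi)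

theorem seqVar_const {r : ℝ} (hr : 0 < r) (c : ℂ) : seqVar r (fun _ => c) = 0 := by
  simp [seqVar, hr]

theorem seqVar_sum_le {r : ℝ} (hr : 1 ≤ r) {ι : Type*} (s : Finset ι) (a : ι → ℕ → ℂ) :
    seqVar r (fun n => ∑ j ∈ s, a j n) ≤ ∑ j ∈ s, seqVar r (a j) := by
  classical
  induction s using Finset.induction_on with
  | empty => simp [seqVar_const (by linarith : 0 < r)]
  | insert j s hj ih =>
    simp only [Finset.sum_insert hj]
    exact (seqVar_add_le hr _ _).trans (by gcongr)

/-- The reason for admitting repeated indices in `seqVar`: rounding, truncation and logarithms are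
monotone but not strictly so, and reparametrising by them must not increase the variation. -/
theorem seqVar_comp_le (r : ℝ) (a : ℕ → ℂ) {φ : ℕ → ℕ} (hφ : Monotone φ) :
    seqVar r (fun n => a (φ n)) ≤ seqVar r a :=
  iSup₂_le fun i hi => le_iSup₂ (f := fun (i : ℕ → ℕ) (_ : Monotone i) =>
    (∑' k : ℕ, ‖a (i k) - a (i (k + 1))‖ₑ ^ r) ^ (1 / r)) (φ ∘ i) (hφ.comp hi)

theorem tsum_comp_of_lt_succ_le {i j : ℕ → ℕ} (hj : Set.InjOn j {k | i k < i (k + 1)})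
    (x : ℕ → ℝ≥0∞) :
    ∑' k, (if i k < i (k + 1) then x (j k) else 0) ^ (2 : ℝ) ≤ ∑' n, x n ^ (2 : ℝ) := by
  have h1 : ∀ k, (if i k < i (k + 1) then x (j k) else 0) ^ (2 : ℝ)
      = Set.indicator {k | i k < i (k + 1)} (fun k => x (j k) ^ (2 : ℝ)) k := fun k => by
    by_cases h : i k < i (k + 1) <;> simp [Set.indicator, h]
  simp_rw [h1]
  rw [← tsum_subtype]
  exact ENNReal.tsum_comp_le_tsum_of_injective
    (f := fun k : {k | i k < i (k + 1)} => j k) (fun a b hab => Subtype.ext (hj a.2 b.2 hab))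
    (fun n => x n ^ (2 : ℝ))

/-- After passing from `ℓ^r` to `ℓ²`, split each increment into its two endpoint values. Among the
steps at which a monotone `i` really moves, each index occurs at most once as a left and at most
once as a right endpoint. -/
theorem seqVar_le_two_mul {r : ℝ} (hr : 2 ≤ r) (a : ℕ → ℂ) :
    seqVar r a ≤ 2 * (∑' n, ‖a n‖ₑ ^ (2 : ℝ)) ^ (1 / 2 : ℝ) := by
  refine iSup₂_le fun i hi => ?_
  refine (ENNReal.tsum_Lp_le_of_le _ hr).trans ?_
  have hlt : ∀ {k l : ℕ}, k < l → i k < i (k + 1) → i k < i l := fun {k l} hkl hk =>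
    hk.trans_le (hi hkl)
  have hlt' : ∀ {k l : ℕ}, k < l → i l < i (l + 1) → i (k + 1) < i (l + 1) := fun {k l} hkl hk =>
    (hi hkl).trans_lt hk
  have inj1 : Set.InjOn i {k | i k < i (k + 1)} := by
    intro k hk l hl hkl
    rcases lt_trichotomy k l with h | h | h
    · exact absurd hkl (hlt h hk).ne
    · exact h
    · exact absurd hkl (hlt h hl).ne'
  have inj2 : Set.InjOn (fun k => i (k + 1)) {k | i k < i (k + 1)} := by
    intro k hk l hl hkl
    rcases lt_trichotomy k l with h | h | h
    · exact absurd hkl (hlt' h hl).ne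
    · exact h
    · exact absurd hkl (hlt' h hk).ne'
  calc (∑' k : ℕ, ‖a (i k) - a (i (k + 1))‖ₑ ^ (2 : ℝ)) ^ (1 / 2 : ℝ)
      ≤ (∑' k : ℕ, ((if i k < i (k + 1) then ‖a (i k)‖ₑ else 0) +
          (if i k < i (k + 1) then ‖a (i (k + 1))‖ₑ else 0)) ^ (2 : ℝ)) ^ (1 / 2 : ℝ) := by
        refine ENNReal.rpow_le_rpow (ENNReal.tsum_le_tsum fun k => ?_) (by positivity)
        refine ENNReal.rpow_le_rpow ?_ (by positivity)
        split_ifs with h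
        · exact enorm_sub_le
        · rw [le_antisymm (hi (Nat.le_succ k)) (not_lt.1 h)]; simp
    _ ≤ (∑' k : ℕ, (if i k < i (k + 1) then ‖a (i k)‖ₑ else 0) ^ (2 : ℝ)) ^ (1 / 2 : ℝ) +
        (∑' k : ℕ, (if i k < i (k + 1) then ‖a (i (k + 1))‖ₑ else 0) ^ (2 : ℝ)) ^ (1 / 2 : ℝ) :=
        ENNReal.tsum_Lp_add_le _ _ (by norm_num)
    _ ≤ _ := by
        rw [two_mul]
        refine add_le_add (ENNReal.rpow_le_rpow ?_ (by norm_num))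
          (ENNReal.rpow_le_rpow ?_ (by norm_num))
        · exact tsum_comp_of_lt_succ_le inj1 (fun n => ‖a n‖ₑ)
        · exact tsum_comp_of_lt_succ_le inj2 (fun n => ‖a n‖ₑ)

theorem seqVar_comp_le_two_mul {r : ℝ} (hr : 2 ≤ r) (u : ℕ → ℂ) {φ : ℕ → ℕ} (hφ : Monotone φ)
    {A : Finset ℕ} (hA : ∀ n, φ n ∈ A) :
    seqVar r (fun n => u (φ n)) ≤ 2 * (∑ n ∈ A, ‖u n‖ₑ ^ (2 : ℝ)) ^ (1 / 2 : ℝ) := by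
  classical
  have h1 : (fun n => u (φ n)) = fun n => (fun k => if k ∈ A then u k else 0) (φ n) := by
    funext n; simp [hA n]
  rw [h1]
  refine (seqVar_comp_le r (fun k => if k ∈ A then u k else 0) hφ).trans ((seqVar_le_two_mul hr _).trans ?_)
  rw [tsum_eq_sum (s := A) (fun k hk => by simp [hk])]
  gcongr with n hn
  simp [hn]

theorem l2Norm_seqVar_comp_le {r : ℝ} (hr : 2 ≤ r) (u : ℤ → ℕ → ℂ) {φ : ℕ → ℕ} (hφ : Monotone φ)
    {A : Finset ℕ} (hA : ∀ n, φ n ∈ A) {c : ℝ≥0∞}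
    (hc : ∑' x, ∑ n ∈ A, ‖u x n‖ₑ ^ (2 : ℝ) ≤ c ^ (2 : ℝ)) :
    l2Norm (fun x => seqVar r (fun n => u x (φ n))) ≤ 2 * c := by
  refine l2Norm_le_of_tsum_le ?_
  calc ∑' x, (seqVar r (fun n => u x (φ n))) ^ (2 : ℝ)
      ≤ ∑' x, (2 : ℝ≥0∞) ^ (2 : ℝ) * ∑ n ∈ A, ‖u x n‖ₑ ^ (2 : ℝ) := by
        refine ENNReal.tsum_le_tsum fun x => ?_
        refine (ENNReal.rpow_le_rpow (seqVar_comp_le_two_mul hr (u x) hφ hA) (by norm_num)).trans ?_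
        rw [ENNReal.mul_rpow_of_nonneg _ _ (by norm_num), ← ENNReal.rpow_mul]
        norm_num
    _ ≤ (2 * c) ^ (2 : ℝ) := by
        rw [ENNReal.tsum_mul_left, ENNReal.mul_rpow_of_nonneg _ _ (by norm_num)]
        gcongr

/-! ### Dyadic averages and a Bellman principle on the dyadic tree -/

/-- The average of `f` over the dyadic block `[2 ^ k * z, 2 ^ k * (z + 1))`. -/
noncomputable def blockAvg (k : ℕ) (f : ℤ → ℂ) (z : ℤ) : ℂ :=
  (∑ l ∈ Finset.range (2 ^ k), f (2 ^ k * z + l)) / 2 ^ k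

/-- The average of `f` over the dyadic block of length `2 ^ k` containing `x`. -/
noncomputable def dyadicAvg (k : ℕ) (f : ℤ → ℂ) (x : ℤ) : ℂ := blockAvg k f (x / 2 ^ k)

theorem blockAvg_zero (f : ℤ → ℂ) (z : ℤ) : blockAvg 0 f z = f z := by
  simp [blockAvg]

theorem blockAvg_succ (k : ℕ) (f : ℤ → ℂ) (z : ℤ) :
    blockAvg (k + 1) f z = (blockAvg k f (2 * z) + blockAvg k f (2 * z + 1)) / 2 := by
  unfold blockAvg
  have hr : Finset.range (2 ^ (k + 1)) = Finset.range (2 ^ k + 2 ^ k) := by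
    rw [pow_succ, mul_two]
  rw [hr, Finset.sum_range_add]
  have h1 : ∀ x : ℕ, f (2 ^ (k + 1) * z + (x : ℤ)) = f (2 ^ k * (2 * z) + x) := fun x => by
    congr 1; ring
  have h2 : ∀ x : ℕ, f (2 ^ (k + 1) * z + ((2 ^ k + x : ℕ) : ℤ)) = f (2 ^ k * (2 * z + 1) + x) :=
    fun x => by congr 1; push_cast; ring
  simp_rw [h2, h1, pow_succ]
  field_simp

theorem dyadicAvg_block (k : ℕ) (f : ℤ → ℂ) (z : ℤ) {y : ℕ} (hy : y < 2 ^ k) :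
    dyadicAvg k f (2 ^ k * z + y) = blockAvg k f z := by
  unfold dyadicAvg
  congr 1
  have h : (0 : ℤ) < 2 ^ k := by positivity
  rw [add_comm, Int.add_mul_ediv_left _ _ h.ne', Int.ediv_eq_zero_of_lt (by positivity)]
  · simp
  · exact_mod_cast hy

/-- The state reached after reading `p 1, …, p n`, starting from `s`. -/
def stateRun {σ : Type*} (step : σ → ℂ → σ) (s : σ) (p : ℕ → ℂ) : ℕ → σ
  | 0 => s
  | n + 1 => step (stateRun step s p n) (p (n + 1))

/-- The induction on the dyadic tree descends from the root, so the first value read has to be split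
off, whereas `stateRun` splits off the last. -/
theorem stateRun_succ' {σ : Type*} (step : σ → ℂ → σ) (s : σ) (p : ℕ → ℂ) (n : ℕ) :
    stateRun step s p (n + 1) = stateRun step (step s (p 1)) (fun t => p (t + 1)) n := by
  induction n with
  | zero => rfl
  | succ n ih => rw [stateRun, ih, stateRun]

/-- A function of state and value that decreases on average along one step of the tree has
decreasing sums over the leaves. -/
theorem sum_stateRun_le {σ : Type*} (step : σ → ℂ → σ) (H : σ → ℂ → ℝ)
    (hH : ∀ s u w, (H (step s u) u + H (step s w) w) / 2 ≤ H s ((u + w) / 2)) (f : ℤ → ℂ)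
    (K : ℕ) (s : σ) (z : ℤ) :
    ∑ y ∈ Finset.range (2 ^ K),
      H (stateRun step s (fun t => dyadicAvg (K - t) f (2 ^ K * z + y)) K) (f (2 ^ K * z + y))
      ≤ 2 ^ K * H s (blockAvg K f z) := by
  induction K generalizing s z with
  | zero => simp [stateRun, blockAvg_zero]
  | succ K ih =>
    -- Throughout the left half the first value read is the average over that half, and the later
    -- ones are the averages inside the subtree below it.
    have e1 : ∀ y ∈ Finset.range (2 ^ K),
        H (stateRun step s (fun t => dyadicAvg (K + 1 - t) f (2 ^ (K + 1) * z + (y : ℤ))) (K + 1))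
          (f (2 ^ (K + 1) * z + (y : ℤ))) =
        H (stateRun step (step s (blockAvg K f (2 * z)))
          (fun t => dyadicAvg (K - t) f (2 ^ K * (2 * z) + y)) K) (f (2 ^ K * (2 * z) + y)) := by
      intro y hy
      have hx : (2 : ℤ) ^ (K + 1) * z + (y : ℤ) = 2 ^ K * (2 * z) + y := by ring
      rw [hx, stateRun_succ', Nat.add_sub_cancel, dyadicAvg_block _ _ _ (Finset.mem_range.1 hy)]
      simp only [Nat.add_sub_add_right]
    have e2 : ∀ y ∈ Finset.range (2 ^ K),
        H (stateRun step s (fun t => dyadicAvg (K + 1 - t) f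
            (2 ^ (K + 1) * z + ((2 ^ K + y : ℕ) : ℤ))) (K + 1))
          (f (2 ^ (K + 1) * z + ((2 ^ K + y : ℕ) : ℤ))) =
        H (stateRun step (step s (blockAvg K f (2 * z + 1)))
          (fun t => dyadicAvg (K - t) f (2 ^ K * (2 * z + 1) + y)) K)
          (f (2 ^ K * (2 * z + 1) + y)) := by
      intro y hy
      have hx : (2 : ℤ) ^ (K + 1) * z + ((2 ^ K + y : ℕ) : ℤ) = 2 ^ K * (2 * z + 1) + y := by
        push_cast; ring
      rw [hx, stateRun_succ', Nat.add_sub_cancel, dyadicAvg_block _ _ _ (Finset.mem_range.1 hy)]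
      simp only [Nat.add_sub_add_right]
    have hr : Finset.range (2 ^ (K + 1)) = Finset.range (2 ^ K + 2 ^ K) := by
      rw [pow_succ, mul_two]
    rw [hr, Finset.sum_range_add, Finset.sum_congr rfl e1, Finset.sum_congr rfl e2]
    have i1 := ih (step s (blockAvg K f (2 * z))) (2 * z)
    have i2 := ih (step s (blockAvg K f (2 * z + 1))) (2 * z + 1)
    have i3 := hH s (blockAvg K f (2 * z)) (blockAvg K f (2 * z + 1))
    rw [← blockAvg_succ] at i3
    have hpos : (0 : ℝ) < 2 ^ K := by positivity
    have i4 := mul_le_mul_of_nonneg_left i3 hpos.le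
    rw [pow_succ]
    linarith

/-! ### Maximal function and anchors of a path -/

/-- The running maximum of `‖p‖`. -/
noncomputable def pathMax (p : ℕ → ℂ) : ℕ → ℝ
  | 0 => ‖p 0‖
  | t + 1 => max (pathMax p t) ‖p (t + 1)‖

/-- The value of `p` at the last stopping time: the anchor is moved to the current value as soon
as that value is at distance at least `c` times the running maximum from it. -/
noncomputable def anchor (c : ℝ) (p : ℕ → ℂ) : ℕ → ℂ
  | 0 => p 0
  | t + 1 => if c * pathMax p (t + 1) ≤ ‖p (t + 1) - anchor c p t‖ then p (t + 1) else anchor c p t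

theorem pathMax_mono (p : ℕ → ℂ) : Monotone (pathMax p) :=
  monotone_nat_of_le_succ fun _ => le_max_left _ _

theorem norm_le_pathMax (p : ℕ → ℂ) (t : ℕ) : ‖p t‖ ≤ pathMax p t := by
  cases t with
  | zero => exact le_rfl
  | succ t => exact le_max_right _ _

theorem pathMax_nonneg (p : ℕ → ℂ) (t : ℕ) : 0 ≤ pathMax p t :=
  (norm_nonneg _).trans (norm_le_pathMax p t)

theorem norm_sub_anchor_le {c : ℝ} (hc : 0 ≤ c) (p : ℕ → ℂ) (t : ℕ) :
    ‖p t - anchor c p t‖ ≤ c * pathMax p t := by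
  have h0 : ∀ t, 0 ≤ c * pathMax p t := fun t => mul_nonneg hc (pathMax_nonneg p t)
  cases t with
  | zero => simpa [anchor] using h0 0
  | succ t =>
    rw [anchor]
    split_ifs with h
    · simpa using h0 (t + 1)
    · exact (not_le.1 h).le

theorem anchor_eq_of_no_trigger {c : ℝ} {p : ℕ → ℂ} {s t : ℕ} (hst : s ≤ t)
    (h : ∀ u, s < u → u ≤ t → ‖p u - anchor c p (u - 1)‖ < c * pathMax p u) :
    anchor c p t = anchor c p s := by
  induction t, hst using Nat.le_induction with
  | base => rfl
  | succ t hst ih =>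
    have h1 := h (t + 1) (Nat.lt_succ_of_le hst) le_rfl
    rw [Nat.add_sub_cancel] at h1
    rw [anchor, if_neg (not_le.2 h1)]
    exact ih fun u hu hut => h u hu (hut.trans (Nat.le_succ t))

/-- While the anchor stays at `p s`, a new maximum `M` is within `c * M ≤ M / 2` of `p s`, so `M ≤ M
/ 2 + ‖p s‖`. -/
theorem pathMax_le_of_no_trigger {c : ℝ} (hc : c ≤ 1 / 2) {p : ℕ → ℂ} {s t : ℕ} (hst : s ≤ t)
    (hs : anchor c p s = p s)
    (h : ∀ u, s < u → u ≤ t → ‖p u - anchor c p (u - 1)‖ < c * pathMax p u) :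
    pathMax p t ≤ 2 * pathMax p s := by
  induction t, hst using Nat.le_induction with
  | base => linarith [pathMax_nonneg p s]
  | succ t hst ih =>
    have ih' := ih fun u hu hut => h u hu (hut.trans (Nat.le_succ t))
    have h1 := h (t + 1) (Nat.lt_succ_of_le hst) le_rfl
    rw [Nat.add_sub_cancel, anchor_eq_of_no_trigger hst
      (fun u hu hut => h u hu (hut.trans (Nat.le_succ t))), hs] at h1
    have h2 : ‖p (t + 1)‖ ≤ ‖p (t + 1) - p s‖ + ‖p s‖ := by
      simpa using norm_add_le (p (t + 1) - p s) (p s)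
    have h3 := norm_le_pathMax p s
    have h4 : c * pathMax p (t + 1) ≤ 1 / 2 * pathMax p (t + 1) :=
      mul_le_mul_of_nonneg_right hc (pathMax_nonneg p _)
    have h5 : pathMax p (t + 1) = max (pathMax p t) ‖p (t + 1)‖ := rfl
    rcases max_cases (pathMax p t) ‖p (t + 1)‖ with ⟨h6, _⟩ | ⟨h6, _⟩
    · rw [h5, h6]; exact ih'
    · rw [h6] at h5
      linarith

/-- Let `u` be the last time in `(s, t]` at which the anchor is reset. Its jump is at least `c`
times the running maximum at `u`, and that maximum at most doubles before `t`. Without any reset, `p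
s` and `p t` would both lie within `c * pathMax p t` of the same anchor, contradicting the size of
the increment. -/
theorem exists_anchor_jump {c : ℝ} (hc0 : 0 < c) (hc : c ≤ 1 / 2) (p : ℕ → ℂ) {s t : ℕ}
    (hst : s ≤ t) (h : 2 * c * pathMax p t < ‖p t - p s‖) :
    ∃ u, s < u ∧ u ≤ t ∧ c * pathMax p t ≤ 2 * ‖anchor c p u - anchor c p (u - 1)‖ := by
  classical
  let trig : ℕ → Prop := fun u => s < u ∧ c * pathMax p u ≤ ‖p u - anchor c p (u - 1)‖
  by_cases hex : ∃ u ≤ t, trig u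
  · obtain ⟨v, hvt, hv⟩ := hex
    have hu := Nat.findGreatest_spec (P := trig) hvt hv
    set u := Nat.findGreatest trig t with hudef
    have hut : u ≤ t := Nat.findGreatest_le t
    have hno : ∀ w, u < w → w ≤ t → ‖p w - anchor c p (w - 1)‖ < c * pathMax p w := by
      intro w huw hwt
      by_contra hcon
      exact Nat.findGreatest_is_greatest huw hwt ⟨hu.1.trans huw, not_lt.1 hcon⟩
    obtain ⟨u', hu'⟩ : ∃ u', u = u' + 1 := ⟨u - 1, by have := hu.1; omega⟩
    have hau : anchor c p u = p u := by
      have := hu.2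
      rw [hu', Nat.add_sub_cancel] at this
      rw [hu']
      rw [anchor, if_pos this]
    refine ⟨u, hu.1, hut, ?_⟩
    have h1 := pathMax_le_of_no_trigger hc hut hau hno
    rw [hau]
    have h2 := hu.2
    have h3 := mul_le_mul_of_nonneg_left h1 hc0.le
    linarith
  · exfalso
    have hno : ∀ w, s < w → w ≤ t → ‖p w - anchor c p (w - 1)‖ < c * pathMax p w := by
      intro w hsw hwt
      by_contra hcon
      exact hex ⟨w, hwt, hsw, not_lt.1 hcon⟩
    have h1 := anchor_eq_of_no_trigger hst hno
    have h2 := norm_sub_anchor_le hc0.le p t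
    have h3 := norm_sub_anchor_le hc0.le p s
    have h4 := mul_le_mul_of_nonneg_left (pathMax_mono p hst) hc0.le
    have h5 : ‖p t - p s‖ ≤ ‖p t - anchor c p t‖ + ‖p s - anchor c p s‖ := by
      rw [h1, show p t - p s = (p t - anchor c p s) - (p s - anchor c p s) by ring]
      exact norm_sub_le _ _
    linarith

theorem exists_scale_anchor_jump {r : ℝ} (hr : 2 ≤ r) (p : ℕ → ℂ) {s t K : ℕ} (hst : s ≤ t)
    (htK : t ≤ K) (hne : p t ≠ p s) :
    ∃ m u : ℕ, s < u ∧ u ≤ t ∧ ‖p t - p s‖ ^ r ≤ 64 * (4 * (1 / 2) ^ (m + 1) * pathMax p K) ^ (r - 2)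
      * ‖anchor ((1 / 2) ^ (m + 1)) p u - anchor ((1 / 2) ^ (m + 1)) p (u - 1)‖ ^ 2 := by
  set D := ‖p t - p s‖ with hD
  have hD0 : 0 < D := norm_pos_iff.2 (sub_ne_zero.2 hne)
  have hDM : D ≤ 2 * pathMax p t := by
    have h1 := norm_sub_le (p t) (p s)
    have h2 := norm_le_pathMax p t
    have h3 := (norm_le_pathMax p s).trans (pathMax_mono p hst)
    linarith
  have hM : 0 < pathMax p t := by linarith
  -- With `c = 2^(-(m+1))` and `M = pathMax p t` this says `2cM < D ≤ 4cM`: the threshold is fine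
  -- enough for `exists_anchor_jump`, yet comparable to the increment.
  obtain ⟨m, hm1, hm2⟩ := exists_nat_pow_near_of_lt_one (x := D / (2 * pathMax p t))
    (y := (1 / 2 : ℝ)) (by positivity) ((div_le_one (by positivity)).2 hDM) (by norm_num)
    (by norm_num)
  rw [lt_div_iff₀ (by positivity)] at hm1
  rw [div_le_iff₀ (by positivity)] at hm2
  have hc : ((1 / 2 : ℝ)) ^ (m + 1) ≤ 1 / 2 := by
    rw [pow_succ]
    have : ((1 / 2 : ℝ)) ^ m ≤ 1 := pow_le_one₀ (by norm_num) (by norm_num)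
    linarith
  obtain ⟨u, hsu, hut, hu⟩ := exists_anchor_jump (c := (1 / 2) ^ (m + 1)) (by positivity) hc p hst
    (by rw [← hD]; linarith)
  refine ⟨m, u, hsu, hut, ?_⟩
  set c : ℝ := (1 / 2) ^ (m + 1) with hcdef
  have hc0 : 0 < c := by positivity
  have hDc : D ≤ 4 * c * pathMax p t := by
    have : (1 / 2 : ℝ) ^ m = 2 * c := by rw [hcdef, pow_succ]; ring
    rw [this] at hm2
    linarith
  have hsplit : D ^ r = D ^ (r - 2) * D ^ 2 := by
    rw [← Real.rpow_natCast D 2, ← Real.rpow_add hD0]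
    congr 1; push_cast; ring
  have hK : 4 * c * pathMax p t ≤ 4 * c * pathMax p K :=
    mul_le_mul_of_nonneg_left (pathMax_mono p htK) (by positivity)
  rw [hsplit]
  have e1 : D ^ (r - 2) ≤ (4 * c * pathMax p K) ^ (r - 2) :=
    Real.rpow_le_rpow hD0.le (hDc.trans hK) (by linarith)
  have e2 : D ^ 2 ≤ 64 * ‖anchor c p u - anchor c p (u - 1)‖ ^ 2 := by
    have : D ≤ 8 * ‖anchor c p u - anchor c p (u - 1)‖ := by linarith
    calc D ^ 2 ≤ (8 * ‖anchor c p u - anchor c p (u - 1)‖) ^ 2 := by gcongr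
      _ = _ := by ring
  calc D ^ (r - 2) * D ^ 2 ≤ (4 * c * pathMax p K) ^ (r - 2) *
        (64 * ‖anchor c p u - anchor c p (u - 1)‖ ^ 2) := by
        apply mul_le_mul e1 e2 (by positivity)
        exact Real.rpow_nonneg (mul_nonneg (by positivity) (pathMax_nonneg p K)) _
    _ = _ := by ring

theorem stateRun_max (p : ℕ → ℂ) (t : ℕ) :
    stateRun (fun (m : ℝ) u => max m ‖u‖) ‖p 0‖ p t = pathMax p t := by
  induction t with
  | zero => rfl
  | succ t ih => rw [stateRun, ih, pathMax]

/-- Doob's maximal inequality in `ℓ²` on one dyadic block. -/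
theorem sum_pathMax_sq_le (f : ℤ → ℂ) (K : ℕ) (z : ℤ) :
    ∑ y ∈ Finset.range (2 ^ K),
      pathMax (fun t => dyadicAvg (K - t) f (2 ^ K * z + y)) K ^ 2
      ≤ 4 * ∑ y ∈ Finset.range (2 ^ K), ‖f (2 ^ K * z + y)‖ ^ 2 := by
  -- The Bellman function `2M² - 4M‖v‖` is concave in `v` and does not increase when `M` is replaced
  -- by `max M ‖v‖`. It is at most `0` at the root, where `M = ‖v‖`, and at the leaves it dominates
  -- `M² - 4‖v‖²` because `(M - 2‖v‖)² ≥ 0`. Writing `max m 0` makes the inequality hold for all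
  -- real states.
  have key := sum_stateRun_le (fun (m : ℝ) u => max m ‖u‖)
    (fun m v => 2 * (max m 0) ^ 2 - 4 * max m 0 * ‖v‖) (fun m u w => by
      have hstep : ∀ u : ℂ, 2 * (max (max m ‖u‖) 0) ^ 2 - 4 * max (max m ‖u‖) 0 * ‖u‖
          ≤ 2 * (max m 0) ^ 2 - 4 * max m 0 * ‖u‖ := by
        intro u
        have h0 := norm_nonneg u
        have h1 : max (max m ‖u‖) 0 = max (max m 0) ‖u‖ := by
          rw [max_right_comm]
        rw [h1]
        rcases max_cases (max m 0) ‖u‖ with ⟨h, _⟩ | ⟨h, _⟩ <;> rw [h]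
        nlinarith [sq_nonneg (max m 0 - ‖u‖)]
      have h1 := hstep u
      have h2 := hstep w
      have h3 : ‖(u + w) / 2‖ ≤ (‖u‖ + ‖w‖) / 2 := by
        rw [norm_div, Complex.norm_ofNat]
        have := norm_add_le u w
        linarith
      have h4 : 0 ≤ max m 0 := le_max_right _ _
      nlinarith [mul_le_mul_of_nonneg_left h3 h4]) f K ‖blockAvg K f z‖ z
  have hrun : ∀ y ∈ Finset.range (2 ^ K),
      stateRun (fun (m : ℝ) u => max m ‖u‖) ‖blockAvg K f z‖
        (fun t => dyadicAvg (K - t) f (2 ^ K * z + y)) K =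
      pathMax (fun t => dyadicAvg (K - t) f (2 ^ K * z + y)) K := by
    intro y hy
    rw [← stateRun_max]
    simp only [Nat.sub_zero]
    rw [dyadicAvg_block _ _ _ (Finset.mem_range.1 hy)]
  have hend : 2 ^ K * (2 * max ‖blockAvg K f z‖ 0 ^ 2 -
      4 * max ‖blockAvg K f z‖ 0 * ‖blockAvg K f z‖) ≤ 0 := by
    rw [max_eq_left (norm_nonneg _)]
    have : (0 : ℝ) ≤ 2 ^ K * ‖blockAvg K f z‖ ^ 2 := by positivity
    nlinarith
  have h1 := key.trans hend
  rw [Finset.mul_sum, ← sub_nonpos, ← Finset.sum_sub_distrib]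
  refine le_trans (Finset.sum_le_sum fun y hy => ?_) h1
  rw [hrun y hy, max_eq_left (pathMax_nonneg _ _)]
  nlinarith [sq_nonneg (pathMax (fun t => dyadicAvg (K - t) f (2 ^ K * z + y)) K
    - 2 * ‖f (2 ^ K * z + y)‖)]

/-- One step of the evolution of (running maximum, anchor, quadratic variation of the anchor). -/
noncomputable def anchorStep (c : ℝ) (s : ℝ × ℂ × ℝ) (u : ℂ) : ℝ × ℂ × ℝ :=
  if c * max s.1 ‖u‖ ≤ ‖u - s.2.1‖ then (max s.1 ‖u‖, u, s.2.2 + ‖u - s.2.1‖ ^ 2)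
  else (max s.1 ‖u‖, s.2.1, s.2.2)

theorem stateRun_anchorStep (c : ℝ) (p : ℕ → ℂ) (t : ℕ) :
    stateRun (anchorStep c) (‖p 0‖, p 0, 0) p t =
      (pathMax p t, anchor c p t,
        ∑ u ∈ Finset.Ioc 0 t, ‖anchor c p u - anchor c p (u - 1)‖ ^ 2) := by
  induction t with
  | zero => simp [stateRun, pathMax, anchor]
  | succ t ih =>
    rw [stateRun, ih, Finset.sum_Ioc_succ_top (Nat.zero_le t), Nat.add_sub_cancel]
    have hM : pathMax p (t + 1) = max (pathMax p t) ‖p (t + 1)‖ := rfl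
    by_cases h : c * pathMax p (t + 1) ≤ ‖p (t + 1) - anchor c p t‖
    · have ha : anchor c p (t + 1) = p (t + 1) := by rw [anchor, if_pos h]
      rw [hM] at h
      rw [anchorStep, if_pos h, ha, hM]
    · have ha : anchor c p (t + 1) = anchor c p t := by rw [anchor, if_neg h]
      rw [hM] at h
      rw [anchorStep, if_neg h, ha, hM]
      simp

theorem Complex.norm_sub_sq_sub_norm_sq (v a : ℂ) :
    ‖v - a‖ ^ 2 - ‖v‖ ^ 2 = a.re ^ 2 + a.im ^ 2 - 2 * (v.re * a.re + v.im * a.im) := by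
  rw [Complex.sq_norm, Complex.sq_norm, Complex.normSq_apply, Complex.normSq_apply,
    Complex.sub_re, Complex.sub_im]
  ring

/-- The quadratic variation along stopping times is bounded in `ℓ²` on one dyadic block. -/
theorem sum_anchor_sq_le (c : ℝ) (f : ℤ → ℂ) (K : ℕ) (z : ℤ) :
    ∑ y ∈ Finset.range (2 ^ K), ∑ u ∈ Finset.Ioc 0 K,
      ‖anchor c (fun t => dyadicAvg (K - t) f (2 ^ K * z + y)) u -
        anchor c (fun t => dyadicAvg (K - t) f (2 ^ K * z + y)) (u - 1)‖ ^ 2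
      ≤ ∑ y ∈ Finset.range (2 ^ K), ‖f (2 ^ K * z + y)‖ ^ 2 := by
  -- With accumulated sum of squares `S` and anchor `a`, the quantity `S + ‖v - a‖² - ‖v‖²` is
  -- affine in `v` and unchanged when the anchor moves to `v`. It is therefore an exact martingale,
  -- whatever the stopping rule, which explains the bound uniform in `c`.
  have key := sum_stateRun_le (anchorStep c)
    (fun s v => s.2.2 + (‖v - s.2.1‖ ^ 2 - ‖v‖ ^ 2)) (fun s u w => by
      have hstep : ∀ u : ℂ, (anchorStep c s u).2.2 +
          (‖u - (anchorStep c s u).2.1‖ ^ 2 - ‖u‖ ^ 2) =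
          s.2.2 + (‖u - s.2.1‖ ^ 2 - ‖u‖ ^ 2) := by
        intro u
        unfold anchorStep
        split_ifs
        · simp; ring
        · simp
      have hre : ((u + w) / 2).re = (u.re + w.re) / 2 := by simp
      have him : ((u + w) / 2).im = (u.im + w.im) / 2 := by simp
      rw [hstep, hstep, Complex.norm_sub_sq_sub_norm_sq, Complex.norm_sub_sq_sub_norm_sq,
        Complex.norm_sub_sq_sub_norm_sq, hre, him]
      apply le_of_eq
      ring) f K (‖blockAvg K f z‖, blockAvg K f z, 0) z
  have hrun : ∀ y ∈ Finset.range (2 ^ K),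
      stateRun (anchorStep c) (‖blockAvg K f z‖, blockAvg K f z, 0)
        (fun t => dyadicAvg (K - t) f (2 ^ K * z + y)) K =
      (pathMax (fun t => dyadicAvg (K - t) f (2 ^ K * z + y)) K,
        anchor c (fun t => dyadicAvg (K - t) f (2 ^ K * z + y)) K,
        ∑ u ∈ Finset.Ioc 0 K, ‖anchor c (fun t => dyadicAvg (K - t) f (2 ^ K * z + y)) u -
          anchor c (fun t => dyadicAvg (K - t) f (2 ^ K * z + y)) (u - 1)‖ ^ 2) := by
    intro y hy
    have h := stateRun_anchorStep c (fun t => dyadicAvg (K - t) f (2 ^ K * z + y)) K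
    simp only [Nat.sub_zero] at h
    rw [dyadicAvg_block _ _ _ (Finset.mem_range.1 hy)] at h
    exact h
  have hend : (2 : ℝ) ^ K * (0 + (‖blockAvg K f z - blockAvg K f z‖ ^ 2 - ‖blockAvg K f z‖ ^ 2))
      ≤ 0 := by
    have : (0 : ℝ) ≤ 2 ^ K * ‖blockAvg K f z‖ ^ 2 := by positivity
    rw [sub_self, norm_zero]
    nlinarith
  have h1 := key.trans hend
  rw [← sub_nonpos, ← Finset.sum_sub_distrib]
  refine le_trans (Finset.sum_le_sum fun y hy => ?_) h1
  rw [hrun y hy]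
  dsimp only
  have : 0 ≤ ‖f (2 ^ K * z + y) - anchor c
    (fun t => dyadicAvg (K - t) f (2 ^ K * z + y)) K‖ ^ 2 := by positivity
  linarith

/-! ### From anchor jumps to Lépingle's inequality -/

theorem ENNReal.sum_Ioc_antitone_le (w : ℕ → ℝ≥0∞) {t : ℕ → ℕ} (ht : Antitone t) (n : ℕ) :
    ∑ k ∈ Finset.range n, ∑ u ∈ Finset.Ioc (t (k + 1)) (t k), w u =
      ∑ u ∈ Finset.Ioc (t n) (t 0), w u := by
  induction n with
  | zero => simp
  | succ n ih =>
    rw [Finset.sum_range_succ, ih, add_comm,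
      Finset.sum_Ioc_consecutive _ (ht (Nat.le_succ n)) (ht (Nat.zero_le n))]

theorem enorm_rpow_eq_ofReal (z : ℂ) {r : ℝ} (hr : 0 ≤ r) :
    ‖z‖ₑ ^ r = ENNReal.ofReal (‖z‖ ^ r) := by
  rw [← ofReal_norm, ENNReal.ofReal_rpow_of_nonneg (norm_nonneg _) hr]

/-- Each nonzero increment is charged to one anchor jump, at one threshold, inside its own time
interval. These intervals are disjoint, so every jump is charged at most once per threshold. Time is
reversed because the path runs from coarse to fine averages. -/
theorem seqVar_path_le {r : ℝ} (hr : 2 ≤ r) (p : ℕ → ℂ) (K : ℕ) :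
    seqVar r (fun k => p (K - k)) ≤
      (∑' m : ℕ, ENNReal.ofReal (64 * (4 * (1 / 2) ^ (m + 1) * pathMax p K) ^ (r - 2)) *
        ENNReal.ofReal (∑ u ∈ Finset.Ioc 0 K, ‖anchor ((1 / 2) ^ (m + 1)) p u -
          anchor ((1 / 2) ^ (m + 1)) p (u - 1)‖ ^ 2)) ^ (1 / r) := by
  refine iSup₂_le fun i hi => ENNReal.rpow_le_rpow ?_ (by positivity)
  let c : ℕ → ℝ≥0∞ := fun m =>
    ENNReal.ofReal (64 * (4 * (1 / 2) ^ (m + 1) * pathMax p K) ^ (r - 2))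
  let d : ℕ → ℕ → ℝ≥0∞ := fun m u => ENNReal.ofReal (‖anchor ((1 / 2) ^ (m + 1)) p u -
          anchor ((1 / 2) ^ (m + 1)) p (u - 1)‖ ^ 2)
  let w : ℕ → ℝ≥0∞ := fun u => ∑' m, c m * d m u
  have ht : Antitone fun k => K - i k := fun a b hab => Nat.sub_le_sub_left (hi hab) K
  have h1 : ∀ k, ‖p (K - i k) - p (K - i (k + 1))‖ₑ ^ r ≤
      ∑ u ∈ Finset.Ioc (K - i (k + 1)) (K - i k), w u := by
    intro k
    by_cases hne : p (K - i k) = p (K - i (k + 1))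
    · rw [hne, sub_self, enorm_zero, ENNReal.zero_rpow_of_pos (by linarith)]
      exact zero_le
    obtain ⟨m, u, hsu, hut, hu⟩ := exists_scale_anchor_jump hr p (ht (Nat.le_succ k))
      (Nat.sub_le K (i k)) hne
    rw [enorm_rpow_eq_ofReal _ (by linarith)]
    calc ENNReal.ofReal (‖p (K - i k) - p (K - i (k + 1))‖ ^ r) ≤ c m * d m u := by
          rw [← ENNReal.ofReal_mul]
          · exact ENNReal.ofReal_le_ofReal hu
          · exact mul_nonneg (by norm_num) (Real.rpow_nonneg
              (mul_nonneg (by positivity) (pathMax_nonneg p K)) _)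
      _ ≤ w u := ENNReal.le_tsum m
      _ ≤ _ := Finset.single_le_sum (f := w) (fun _ _ => zero_le) (Finset.mem_Ioc.2 ⟨hsu, hut⟩)
  refine (ENNReal.tsum_le_tsum h1).trans ?_
  rw [ENNReal.tsum_eq_iSup_nat]
  refine iSup_le fun n => ?_
  rw [ENNReal.sum_Ioc_antitone_le w ht]
  calc ∑ u ∈ Finset.Ioc (K - i n) (K - i 0), w u ≤ ∑ u ∈ Finset.Ioc 0 K, w u :=
        Finset.sum_le_sum_of_subset (Finset.Ioc_subset_Ioc (Nat.zero_le _) (Nat.sub_le _ _))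
    _ = ∑' m, ∑ u ∈ Finset.Ioc 0 K, c m * d m u :=
        (Summable.tsum_finsetSum fun _ _ => ENNReal.summable).symm
    _ = _ := by
        refine tsum_congr fun m => ?_
        rw [← Finset.mul_sum, ENNReal.ofReal_sum_of_nonneg fun _ _ => by positivity]

theorem ENNReal.rpow_mul_rpow_le_add (X Y : ℝ≥0∞) {θ : ℝ} (h0 : 0 ≤ θ) (h1 : θ ≤ 1) :
    X ^ θ * Y ^ (1 - θ) ≤ X + Y := by
  calc X ^ θ * Y ^ (1 - θ) ≤ (X + Y) ^ θ * (X + Y) ^ (1 - θ) := by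
        exact mul_le_mul' (ENNReal.rpow_le_rpow le_self_add h0)
          (ENNReal.rpow_le_rpow le_add_self (by linarith))
    _ = X + Y := by
        rw [← ENNReal.rpow_add_of_nonneg _ _ h0 (by linarith)]; simp

/-- The square of the previous bound has the form `X^θ * Y^(1-θ)` with `X` the squared maximum and
`θ = (r - 2) / r`. Bounding it by `X + Y` leaves quantities that can be summed over a block
separately. -/
theorem seqVar_path_sq_le {r : ℝ} (hr : 2 < r) (p : ℕ → ℂ) (K : ℕ) :
    seqVar r (fun k => p (K - k)) ^ (2 : ℝ) ≤
      ENNReal.ofReal (pathMax p K ^ 2) +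
      ∑' m : ℕ, ENNReal.ofReal (64 * (4 * (1 / 2) ^ (m + 1)) ^ (r - 2)) *
        ENNReal.ofReal (∑ u ∈ Finset.Ioc 0 K, ‖anchor ((1 / 2) ^ (m + 1)) p u -
          anchor ((1 / 2) ^ (m + 1)) p (u - 1)‖ ^ 2) := by
  have hM := pathMax_nonneg p K
  have h1 := ENNReal.rpow_le_rpow (seqVar_path_le hr.le p K) (by norm_num : (0 : ℝ) ≤ 2)
  refine h1.trans ?_
  have e1 : ∀ m : ℕ, ENNReal.ofReal (64 * (4 * (1 / 2) ^ (m + 1) * pathMax p K) ^ (r - 2)) =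
      ENNReal.ofReal (pathMax p K) ^ (r - 2) *
        ENNReal.ofReal (64 * (4 * (1 / 2) ^ (m + 1)) ^ (r - 2)) := by
    intro m
    rw [ENNReal.ofReal_rpow_of_nonneg hM (by linarith), ← ENNReal.ofReal_mul (by positivity),
      Real.mul_rpow (by positivity) hM]
    congr 1; ring
  simp_rw [e1, mul_assoc]
  rw [ENNReal.tsum_mul_left, ENNReal.mul_rpow_of_nonneg _ _ (by positivity),
    ENNReal.mul_rpow_of_nonneg _ _ (by norm_num), ← ENNReal.rpow_mul, ← ENNReal.rpow_mul,
    ← ENNReal.rpow_mul]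
  have e2 : ENNReal.ofReal (pathMax p K) ^ ((r - 2) * (1 / r * 2)) =
      (ENNReal.ofReal (pathMax p K ^ 2)) ^ ((r - 2) / r) := by
    rw [ENNReal.ofReal_pow hM, ← ENNReal.rpow_natCast, ← ENNReal.rpow_mul]
    congr 1; push_cast; ring
  have e3 : 1 / r * 2 = 1 - (r - 2) / r := by field_simp; ring
  rw [e2, e3]
  exact ENNReal.rpow_mul_rpow_le_add _ _ (div_nonneg (by linarith) (by linarith))
    ((div_le_one (by linarith)).2 (by linarith))

/-- The thresholds contribute a geometric series of ratio `2^(-(r-2))`; this is where `r > 2` is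
essential. -/
theorem tsum_ofReal_scale_lt_top {r : ℝ} (hr : 2 < r) :
    ∑' m : ℕ, ENNReal.ofReal (64 * (4 * (1 / 2) ^ (m + 1)) ^ (r - 2)) ≠ ∞ := by
  have e : ∀ m : ℕ, 64 * (4 * (1 / 2 : ℝ) ^ (m + 1)) ^ (r - 2) =
      (64 * 2 ^ (r - 2)) * ((1 / 2 : ℝ) ^ (r - 2)) ^ m := by
    intro m
    rw [← Real.rpow_natCast ((1 / 2 : ℝ) ^ (r - 2)) m, ← Real.rpow_mul (by norm_num),
      mul_comm (r - 2), Real.rpow_mul (by norm_num), Real.rpow_natCast, mul_assoc,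
      ← Real.mul_rpow (by norm_num) (by positivity)]
    congr 2; rw [pow_succ]; ring
  simp_rw [e]
  have hs : Summable fun m : ℕ => (64 * 2 ^ (r - 2)) * ((1 / 2 : ℝ) ^ (r - 2)) ^ m :=
    (summable_geometric_of_lt_one (by positivity)
      (Real.rpow_lt_one (by norm_num) (by norm_num) (by linarith))).mul_left _
  exact hs.tsum_ofReal_ne_top

/-- Lépingle's inequality in `ℓ²` on one dyadic block. -/
theorem exists_sum_seqVar_dyadicAvg_le {r : ℝ} (hr : 2 < r) :
    ∃ C : ℝ≥0, ∀ (f : ℤ → ℂ) (K : ℕ) (z : ℤ),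
      ∑ y ∈ Finset.range (2 ^ K),
        seqVar r (fun k => dyadicAvg (K - (K - k)) f (2 ^ K * z + y)) ^ (2 : ℝ) ≤
      C * ∑ y ∈ Finset.range (2 ^ K), ‖f (2 ^ K * z + y)‖ₑ ^ (2 : ℝ) := by
  have hfin := tsum_ofReal_scale_lt_top hr
  set B := ∑' m : ℕ, ENNReal.ofReal (64 * (4 * (1 / 2) ^ (m + 1)) ^ (r - 2)) with hB
  refine ⟨4 + B.toNNReal, fun f K z => ?_⟩
  have hf : ∑ y ∈ Finset.range (2 ^ K), ‖f (2 ^ K * z + y)‖ₑ ^ (2 : ℝ) =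
      ENNReal.ofReal (∑ y ∈ Finset.range (2 ^ K), ‖f (2 ^ K * z + y)‖ ^ 2) := by
    rw [ENNReal.ofReal_sum_of_nonneg fun _ _ => by positivity]
    refine Finset.sum_congr rfl fun y _ => ?_
    rw [enorm_rpow_eq_ofReal _ (by norm_num), Real.rpow_two]
  have h1 := Finset.sum_le_sum fun y (_ : y ∈ Finset.range (2 ^ K)) =>
    seqVar_path_sq_le hr (fun t => dyadicAvg (K - t) f (2 ^ K * z + y)) K
  refine h1.trans ?_
  rw [Finset.sum_add_distrib, hf]
  push_cast
  rw [ENNReal.coe_toNNReal hfin, add_mul]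
  refine add_le_add ?_ ?_
  · rw [← ENNReal.ofReal_sum_of_nonneg fun _ _ => by positivity]
    refine (ENNReal.ofReal_le_ofReal (sum_pathMax_sq_le f K z)).trans ?_
    rw [ENNReal.ofReal_mul (by norm_num)]
    norm_num
  · rw [← Summable.tsum_finsetSum fun _ _ => ENNReal.summable, hB, ← ENNReal.tsum_mul_right]
    refine ENNReal.tsum_le_tsum fun m => ?_
    rw [← Finset.mul_sum, ← ENNReal.ofReal_sum_of_nonneg fun _ _ => by positivity]
    exact mul_le_mul_right (ENNReal.ofReal_le_ofReal (sum_anchor_sq_le _ f K z)) _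

/-! ### The variational inequality for Fejér averages along progressions -/

theorem tsum_int_eq_tsum_sum_range {n : ℕ} (hn : 0 < n) (g : ℤ → ℝ≥0∞) :
    ∑' x, g x = ∑' z : ℤ, ∑ y ∈ Finset.range n, g (n * z + y) := by
  have : NeZero n := ⟨hn.ne'⟩
  rw [← (Int.divModEquiv n).symm.tsum_eq, ENNReal.tsum_prod']
  refine tsum_congr fun z => ?_
  rw [tsum_fintype, Finset.sum_range]
  refine Finset.sum_congr rfl fun y _ => ?_
  rw [Int.divModEquiv_symm_apply, mul_comm]

/-- The blocks of length `2 ^ K` partition `ℤ`, so the local estimates add up. The index `K - (K -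
k)` is `min k K`, in the form produced by reversing time twice. -/
theorem exists_l2Norm_seqVar_dyadicAvg_le {r : ℝ} (hr : 2 < r) :
    ∃ C : ℝ≥0, ∀ (f : ℤ → ℂ) (K : ℕ),
      l2Norm (fun x => seqVar r (fun k => dyadicAvg (K - (K - k)) f x)) ≤
        C * l2Norm (fun x => ‖f x‖ₑ) := by
  obtain ⟨C, hC⟩ := exists_sum_seqVar_dyadicAvg_le hr
  refine ⟨NNReal.sqrt C, fun f K => l2Norm_le_of_tsum_le ?_⟩
  have hs : ((NNReal.sqrt C : ℝ≥0) : ℝ≥0∞) ^ (2 : ℝ) = C := by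
    rw [ENNReal.rpow_two, ← ENNReal.coe_pow, NNReal.sq_sqrt]
  rw [ENNReal.mul_rpow_of_nonneg _ _ (by norm_num), l2Norm_sq, hs,
    tsum_int_eq_tsum_sum_range (n := 2 ^ K) (by positivity),
    tsum_int_eq_tsum_sum_range (n := 2 ^ K) (by positivity) (fun x => ‖f x‖ₑ ^ (2 : ℝ)),
    ← ENNReal.tsum_mul_left]
  refine ENNReal.tsum_le_tsum fun z => ?_
  push_cast
  exact hC f K z

/-- The Fejér average of order `2 ^ k` along the progression with difference `Q`. -/
noncomputable def fejerAvg (Q k : ℕ) (f : ℤ → ℂ) (x : ℤ) : ℂ :=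
  (∑ l ∈ Finset.range (2 ^ k), ∑ m ∈ Finset.range (2 ^ k), f (x + Q * ((m : ℤ) - l))) /
    (2 ^ k * 2 ^ k)

theorem sum_range_periodic_shift {M : Type*} [AddCommGroup M] (F : ℤ → M) (n : ℕ)
    (hF : ∀ x, F (x + n) = F x) (x : ℤ) :
    ∑ u ∈ Finset.range n, F (x + u) = ∑ u ∈ Finset.range n, F u := by
  have hstep : ∀ x : ℤ, ∑ u ∈ Finset.range n, F (x + 1 + u) = ∑ u ∈ Finset.range n, F (x + u) := by
    intro x
    have h1 : ∑ u ∈ Finset.range (n + 1), F (x + u) = ∑ u ∈ Finset.range n, F (x + u) + F x := by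
      rw [Finset.sum_range_succ, hF]
    have h2 : ∑ u ∈ Finset.range (n + 1), F (x + u) =
        ∑ u ∈ Finset.range n, F (x + 1 + u) + F x := by
      rw [Finset.sum_range_succ']
      simp only [Nat.cast_zero, add_zero]
      congr 1
      refine Finset.sum_congr rfl fun u _ => ?_
      congr 1; push_cast; ring
    exact add_right_cancel (h2.symm.trans h1)
  induction x using Int.induction_on with
  | zero => simp
  | succ k ih => rw [hstep, ih]
  | pred k ih =>
    rw [← hstep, sub_add_cancel, ih]

theorem sum_range_mul_periodic {M : Type*} [AddCommGroup M] (F : ℤ → M) (n c : ℕ)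
    (hF : ∀ x, F (x + n) = F x) (x : ℤ) :
    ∑ u ∈ Finset.range (n * c), F (x + u) = c • ∑ u ∈ Finset.range n, F u := by
  induction c with
  | zero => simp
  | succ c ih =>
    rw [mul_add_one, Finset.sum_range_add, ih, succ_nsmul]
    congr 1
    rw [← sum_range_periodic_shift F n hF (x + (n * c : ℕ))]
    refine Finset.sum_congr rfl fun u _ => ?_
    congr 1; push_cast; ring

/-- A Fejér average is the mean of the dyadic averages over all translates of the dyadic grid. -/
theorem fejerAvg_one_eq {k K : ℕ} (hk : k ≤ K) (f : ℤ → ℂ) (x : ℤ) :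
    fejerAvg 1 k f x = ∑ u ∈ Finset.range (2 ^ K),
      (1 / 2 ^ K : ℂ) * dyadicAvg k (fun y => f (y - u)) (x + u) := by
  obtain ⟨c, rfl⟩ := Nat.exists_eq_add_of_le hk
  -- After translation by `u`, the block average at `x + u` depends only on the residue of `x + u`
  -- modulo `2 ^ k`, so the sum over all translates consists of `2 ^ c` full periods.
  let G : ℤ → ℂ := fun y => ∑ m ∈ Finset.range (2 ^ k), f (x + ((m : ℤ) - y % 2 ^ k))
  have hG : ∀ y, G (y + ((2 ^ k : ℕ) : ℤ)) = G y := fun y => by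
    simp only [G]
    push_cast
    simp
  have h1 : ∀ u : ℕ, dyadicAvg k (fun y => f (y - u)) (x + u) = G (x + u) / 2 ^ k := by
    intro u
    unfold dyadicAvg blockAvg
    congr 1
    refine Finset.sum_congr rfl fun m _ => ?_
    have := Int.mul_ediv_add_emod (x + u) (2 ^ k)
    exact congrArg f (by linarith)
  simp_rw [h1]
  have hc : Finset.range (2 ^ (k + c)) = Finset.range (2 ^ k * 2 ^ c) := by rw [pow_add]
  rw [← Finset.mul_sum, ← Finset.sum_div, hc, sum_range_mul_periodic G (2 ^ k) (2 ^ c) hG]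
  have h2 : ∑ u ∈ Finset.range (2 ^ k), G u = ∑ l ∈ Finset.range (2 ^ k),
      ∑ m ∈ Finset.range (2 ^ k), f (x + (1 : ℕ) * ((m : ℤ) - l)) := by
    refine Finset.sum_congr rfl fun l hl => Finset.sum_congr rfl fun m _ => ?_
    have : (l : ℤ) % 2 ^ k = l := Int.emod_eq_of_lt (by positivity)
      (by exact_mod_cast Finset.mem_range.1 hl)
    rw [this]
    simp
  rw [h2, fejerAvg, nsmul_eq_mul, pow_add]
  push_cast
  field_simp

theorem seqVar_const_mul {r : ℝ} (hr : 0 < r) (c : ℂ) (a : ℕ → ℂ) :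
    seqVar r (fun n => c * a n) ≤ ‖c‖ₑ * seqVar r a := by
  refine iSup₂_le fun i hi => ?_
  have h : ∀ k, ‖c * a (i k) - c * a (i (k + 1))‖ₑ ^ r =
      ‖c‖ₑ ^ r * ‖a (i k) - a (i (k + 1))‖ₑ ^ r := fun k => by
    rw [← mul_sub, enorm_mul, ENNReal.mul_rpow_of_nonneg _ _ hr.le]
  simp_rw [h]
  rw [ENNReal.tsum_mul_left, ENNReal.mul_rpow_of_nonneg _ _ (by positivity), ← ENNReal.rpow_mul,
    mul_one_div_cancel hr.ne', ENNReal.rpow_one]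
  gcongr
  exact le_iSup₂ (f := fun (i : ℕ → ℕ) (_ : Monotone i) =>
          (∑' k : ℕ, ‖a (i k) - a (i (k + 1))‖ₑ ^ r) ^ (1 / r)) i hi

theorem l2Norm_const_mul (c : ℝ≥0∞) (g : ℤ → ℝ≥0∞) :
    l2Norm (fun x => c * g x) = c * l2Norm g := by
  unfold l2Norm
  simp_rw [ENNReal.mul_rpow_of_nonneg _ _ (by norm_num : (0 : ℝ) ≤ 2)]
  rw [ENNReal.tsum_mul_left, ENNReal.mul_rpow_of_nonneg _ _ (by norm_num), ← ENNReal.rpow_mul]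
  norm_num

theorem l2Norm_comp_equiv (g : ℤ → ℝ≥0∞) (e : ℤ ≃ ℤ) : l2Norm (fun x => g (e x)) = l2Norm g := by
  unfold l2Norm
  rw [e.tsum_eq (fun x => g x ^ (2 : ℝ))]

/-- Minkowski's inequality over the `2 ^ K` translates, each of weight `2^(-K)` and each satisfying
the dyadic estimate with the same constant. -/
theorem exists_l2Norm_seqVar_fejerAvg_one_le {r : ℝ} (hr : 2 < r) :
    ∃ C : ℝ≥0, ∀ (f : ℤ → ℂ) (K : ℕ),
      l2Norm (fun x => seqVar r (fun k => fejerAvg 1 (K - (K - k)) f x)) ≤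
        C * l2Norm (fun x => ‖f x‖ₑ) := by
  obtain ⟨C, hC⟩ := exists_l2Norm_seqVar_dyadicAvg_le hr
  refine ⟨C, fun f K => ?_⟩
  have h1 : ∀ x, seqVar r (fun k => fejerAvg 1 (K - (K - k)) f x) ≤
      ∑ u ∈ Finset.range (2 ^ K), ‖(1 / 2 ^ K : ℂ)‖ₑ *
        seqVar r (fun k => dyadicAvg (K - (K - k)) (fun y => f (y - u)) (x + u)) := by
    intro x
    simp_rw [fejerAvg_one_eq (Nat.sub_le K _)]
    refine (seqVar_sum_le (by linarith) _ _).trans (Finset.sum_le_sum fun u _ => ?_)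
    exact seqVar_const_mul (by linarith) _ _
  refine (l2Norm_mono h1).trans ((l2Norm_sum_le _ _).trans ?_)
  have h2 : ∀ u ∈ Finset.range (2 ^ K), l2Norm (fun x => ‖(1 / 2 ^ K : ℂ)‖ₑ *
        seqVar r (fun k => dyadicAvg (K - (K - k)) (fun y => f (y - u)) (x + u))) ≤
        ‖(1 / 2 ^ K : ℂ)‖ₑ * (C * l2Norm (fun x => ‖f x‖ₑ)) := by
    intro u _
    rw [l2Norm_const_mul]
    gcongr
    have e1 := l2Norm_comp_equiv (fun x => seqVar r (fun k => dyadicAvg (K - (K - k))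
      (fun y => f (y - u)) x)) (Equiv.addRight (u : ℤ))
    have e2 := l2Norm_comp_equiv (fun x => ‖f x‖ₑ) (Equiv.subRight (u : ℤ))
    simp only [Equiv.coe_addRight, Equiv.subRight_apply] at e1 e2
    rw [e1, ← e2]
    exact hC _ K
  refine (Finset.sum_le_sum h2).trans ?_
  rw [Finset.sum_const, Finset.card_range, nsmul_eq_mul, ← mul_assoc]
  have h3 : ((2 ^ K : ℕ) : ℝ≥0∞) * ‖(1 / 2 ^ K : ℂ)‖ₑ = 1 := by
    rw [← ofReal_norm, norm_div, norm_pow, norm_one, Complex.norm_ofNat,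
      ← ENNReal.ofReal_natCast, ← ENNReal.ofReal_mul (by positivity)]
    push_cast
    rw [mul_one_div_cancel (by positivity), ENNReal.ofReal_one]
  rw [h3, one_mul]

theorem fejerAvg_progression (Q k y : ℕ) (f : ℤ → ℂ) (z : ℤ) :
    fejerAvg Q k f (Q * z + y) = fejerAvg 1 k (fun w => f (Q * w + y)) z := by
  unfold fejerAvg
  congr 1
  refine Finset.sum_congr rfl fun l _ => Finset.sum_congr rfl fun m _ => ?_
  congr 1; push_cast; ring

/-- The operator acts separately on the residue classes modulo `Q`, and on each of them it is the
Fejér average with difference `1`. The constant is therefore independent of `Q`, which is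
indispensable since `Q` will be a factorial. -/
theorem exists_l2Norm_seqVar_fejerAvg_le {r : ℝ} (hr : 2 < r) :
    ∃ C : ℝ≥0, ∀ (Q : ℕ) (_ : 0 < Q) (f : ℤ → ℂ) (K : ℕ),
      l2Norm (fun x => seqVar r (fun k => fejerAvg Q (K - (K - k)) f x)) ≤
        C * l2Norm (fun x => ‖f x‖ₑ) := by
  obtain ⟨C, hC⟩ := exists_l2Norm_seqVar_fejerAvg_one_le hr
  refine ⟨C, fun Q hQ f K => l2Norm_le_of_tsum_le ?_⟩
  rw [ENNReal.mul_rpow_of_nonneg _ _ (by norm_num), l2Norm_sq,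
    tsum_int_eq_tsum_sum_range hQ, tsum_int_eq_tsum_sum_range hQ (fun x => ‖f x‖ₑ ^ (2 : ℝ)),
    Summable.tsum_finsetSum fun _ _ => ENNReal.summable,
    Summable.tsum_finsetSum fun _ _ => ENNReal.summable, Finset.mul_sum]
  refine Finset.sum_le_sum fun y _ => ?_
  simp_rw [fejerAvg_progression]
  rw [← l2Norm_sq, ← l2Norm_sq (fun z : ℤ => ‖f (Q * z + y)‖ₑ),
    ← ENNReal.mul_rpow_of_nonneg _ _ (by norm_num)]
  exact ENNReal.rpow_le_rpow (hC (fun w => f (Q * w + y)) K) (by norm_num)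

/-! ### The character of the circle -/

/-- The standard character `e(x) = exp(2πix)` of `ℝ / ℤ`. -/
noncomputable def circleChar (x : UnitAddCircle) : ℂ := (AddCircle.toCircle x : ℂ)

theorem circleChar_add (x y : UnitAddCircle) :
    circleChar (x + y) = circleChar x * circleChar y := by
  simp [circleChar, AddCircle.toCircle_add]

theorem circleChar_neg (x : UnitAddCircle) :
    circleChar (-x) = (starRingEnd ℂ) (circleChar x) := by
  simp only [circleChar, AddCircle.toCircle_neg, Circle.coe_inv_eq_conj]

theorem norm_circleChar (x : UnitAddCircle) : ‖circleChar x‖ = 1 :=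
  Circle.norm_coe _

theorem circleChar_nsmul (n : ℕ) (x : UnitAddCircle) :
    circleChar (n • x) = circleChar x ^ n := by
  simp [circleChar, AddCircle.toCircle_nsmul]

theorem UnitAddCircle.exists_coe_eq (x : UnitAddCircle) : ∃ t : ℝ, (t : UnitAddCircle) = x ∧
    |t| = ‖x‖ ∧ |t| ≤ 1 / 2 := by
  obtain ⟨s, rfl⟩ := QuotientAddGroup.mk_surjective x
  refine ⟨s - round s, ?_, ?_, ?_⟩
  · have h : ((s - round s : ℝ) : UnitAddCircle) = (s : UnitAddCircle) - ((round s : ℝ)) :=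
      AddCircle.coe_sub 1 s (round s)
    have h2 : ((round s : ℝ) : UnitAddCircle) = 0 := by
      rw [AddCircle.coe_eq_zero_iff]
      exact ⟨round s, by simp⟩
    rw [h, h2, sub_zero]
  · exact (UnitAddCircle.norm_eq (x := s)).symm
  · exact abs_sub_round s

theorem UnitAddCircle.norm_coe_of_abs_le {t : ℝ} (ht : |t| ≤ 1 / 2) :
    ‖(t : UnitAddCircle)‖ = |t| :=
  (AddCircle.norm_coe_eq_abs_iff (1 : ℝ) one_ne_zero).2 (by simpa using ht)

theorem UnitAddCircle.norm_nsmul_of_le {x : UnitAddCircle} {n : ℕ} (h : n * ‖x‖ ≤ 1 / 2) :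
    ‖n • x‖ = n * ‖x‖ := by
  obtain ⟨t, rfl, ht, -⟩ := UnitAddCircle.exists_coe_eq x
  rw [← ht] at h
  have h1 : n • (t : UnitAddCircle) = ((n * t : ℝ) : UnitAddCircle) := by
    rw [← AddCircle.coe_nsmul, nsmul_eq_mul]
  have h2 : |(n : ℝ) * t| = n * |t| := by rw [abs_mul, Nat.abs_cast]
  rw [h1, UnitAddCircle.norm_coe_of_abs_le (by rw [h2]; exact h), h2, ht]

theorem norm_circleChar_sub_one_coe (t : ℝ) :
    ‖circleChar (t : UnitAddCircle) - 1‖ = 2 * |Real.sin (Real.pi * t)| := by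
  have h : circleChar (t : UnitAddCircle) = Complex.exp (Complex.I * ((2 * Real.pi * t : ℝ) : ℂ)) := by
    rw [circleChar, AddCircle.toCircle_apply_mk, Circle.coe_exp]
    push_cast
    congr 1
    ring
  rw [h, Complex.norm_exp_I_mul_ofReal_sub_one, norm_mul, Real.norm_eq_abs, Real.norm_eq_abs,
    abs_two]
  congr 3
  ring

theorem norm_circleChar_sub_one_le (x : UnitAddCircle) :
    ‖circleChar x - 1‖ ≤ 2 * Real.pi * ‖x‖ := by
  obtain ⟨t, rfl, ht, -⟩ := UnitAddCircle.exists_coe_eq x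
  rw [norm_circleChar_sub_one_coe, ← ht]
  have h := Real.abs_sin_le_abs (x := Real.pi * t)
  rw [abs_mul, abs_of_pos Real.pi_pos] at h
  linarith

theorem four_mul_norm_le_norm_circleChar_sub_one (x : UnitAddCircle) :
    4 * ‖x‖ ≤ ‖circleChar x - 1‖ := by
  obtain ⟨t, rfl, ht, ht2⟩ := UnitAddCircle.exists_coe_eq x
  rw [norm_circleChar_sub_one_coe, ← ht]
  have hpi := Real.pi_pos
  have h1 : |Real.sin (Real.pi * t)| = |Real.sin (Real.pi * |t|)| := by
    rcases abs_cases t with ⟨h, _⟩ | ⟨h, _⟩ <;> rw [h]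
    rw [mul_neg, Real.sin_neg, abs_neg]
  have h2 := Real.mul_le_sin (x := Real.pi * |t|) (by positivity) (by nlinarith)
  have h3 : 2 / Real.pi * (Real.pi * |t|) = 2 * |t| := by field_simp
  rw [h3] at h2
  rw [h1]
  have := le_abs_self (Real.sin (Real.pi * |t|))
  linarith

theorem norm_circleChar_sub_le (x y : UnitAddCircle) :
    ‖circleChar x - circleChar y‖ ≤ 2 * Real.pi * ‖x - y‖ := by
  have h : circleChar x - circleChar y = circleChar y * (circleChar (x - y) - 1) := by
    rw [mul_sub, ← circleChar_add, mul_one, add_sub_cancel]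
  rw [h, norm_mul, norm_circleChar, one_mul]
  exact norm_circleChar_sub_one_le _

theorem norm_geom_sum_circleChar_mul_le (x : UnitAddCircle) (N : ℕ) :
    ‖∑ n ∈ Finset.range N, circleChar x ^ n‖ * (2 * ‖x‖) ≤ 1 := by
  have h4 := four_mul_norm_le_norm_circleChar_sub_one x
  have h1 : ‖∑ n ∈ Finset.range N, circleChar x ^ n‖ * ‖circleChar x - 1‖ ≤ 2 := by
    rw [← norm_mul, geom_sum_mul, ← circleChar_nsmul]
    have := norm_sub_le (circleChar (N • x)) 1
    rw [norm_circleChar, norm_one] at this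
    linarith
  have h2 := mul_le_mul_of_nonneg_left h4 (norm_nonneg (∑ n ∈ Finset.range N, circleChar x ^ n))
  linarith

/-! ### Van der Corput's inequality -/

/-- Expanding the square pairs each off-diagonal term with its conjugate. The diagonal is counted
twice on the right, which only helps. -/
theorem norm_sum_sq_le_two_mul_norm (z : ℕ → ℂ) (N : ℕ) :
    ‖∑ n ∈ Finset.range N, z n‖ ^ 2 ≤
      2 * (∑ m ∈ Finset.range N, ∑ n ∈ Finset.range (m + 1), z m * (starRingEnd ℂ) (z n)).re := by
  induction N with
  | zero => simp
  | succ N ih =>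
    rw [Finset.sum_range_succ, Finset.sum_range_succ _ N, ← Finset.mul_sum, ← map_sum,
      Finset.sum_range_succ]
    set S := ∑ n ∈ Finset.range N, z n
    rw [Complex.sq_norm, Complex.normSq_apply] at ih ⊢
    simp only [Complex.add_re, Complex.add_im, Complex.mul_re, map_add, Complex.conj_re,
      Complex.conj_im]
    nlinarith [sq_nonneg (z N).re, sq_nonneg (z N).im]

/-- Group the pairs `n ≤ m` of the expanded square by their difference `h = m - n`. -/
theorem vanDerCorput (z : ℕ → ℂ) (N : ℕ) :
    ‖∑ n ∈ Finset.range N, z n‖ ^ 2 ≤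
      2 * ∑ h ∈ Finset.range N, ‖∑ n ∈ Finset.range (N - h), z (n + h) * (starRingEnd ℂ) (z n)‖ := by
  refine (norm_sum_sq_le_two_mul_norm z N).trans ?_
  have h1 : ∑ m ∈ Finset.range N, ∑ n ∈ Finset.range (m + 1), z m * (starRingEnd ℂ) (z n) =
      ∑ h ∈ Finset.range N, ∑ n ∈ Finset.range (N - h), z (n + h) * (starRingEnd ℂ) (z n) := by
    rw [← Finset.sum_range_diag_flip N (fun h n => z (n + h) * (starRingEnd ℂ) (z n))]
    refine Finset.sum_congr rfl fun m _ => ?_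
    rw [← Finset.sum_range_reflect]
    refine Finset.sum_congr rfl fun n hn => ?_
    have hn' := Finset.mem_range.1 hn
    have e1 : m + 1 - 1 - n = m - n := by omega
    rw [e1, Nat.sub_add_cancel (by omega)]
  rw [h1]
  have h2 := (Complex.re_le_norm (∑ h ∈ Finset.range N, ∑ n ∈ Finset.range (N - h),
    z (n + h) * (starRingEnd ℂ) (z n))).trans (norm_sum_le _ _)
  linarith

/-! ### Vinogradov's lemma -/

/-- Two elements of a fibre differ by `k * i` with `i < w`, and for such `i` the multiples of `k •
γ` do not wrap around the circle. Hence `i * ‖k • γ‖ ≤ 2 * ε`, measuring `i` from the least element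
of the fibre. -/
theorem card_fiber_le {γ : UnitAddCircle} {ε : ℝ} {H : Finset ℕ} (hH : ∀ h ∈ H, ‖h • γ‖ ≤ ε)
    {k w c : ℕ} (hw : w * ‖k • γ‖ ≤ 1 / 2) (hk : 0 < k) (hw0 : 0 < w) (hpos : 0 < ‖k • γ‖)
    (hc : 2 * ε / ‖k • γ‖ < c) (b : ℕ × ℕ) :
    (H.filter fun h => (h / (k * w), h % k) = b).card ≤ c := by
  set F := H.filter fun h => (h / (k * w), h % k) = b with hF
  rcases F.eq_empty_or_nonempty with h0 | hne
  · rw [h0]; simp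
  have hm := Finset.min'_mem F hne
  set m := F.min' hne
  have hsub : F ⊆ (Finset.range c).image fun i => m + k * i := by
    intro h hh
    have hmh : m ≤ h := Finset.min'_le F h hh
    rw [hF, Finset.mem_filter] at hh hm
    have e1 : h / (k * w) = m / (k * w) := by
      have := hh.2.trans hm.2.symm; exact (Prod.ext_iff.1 this).1
    have e2 : h % k = m % k := by
      have := hh.2.trans hm.2.symm; exact (Prod.ext_iff.1 this).2
    obtain ⟨i, hi⟩ : k ∣ h - m := (Nat.modEq_iff_dvd' hmh).1 e2.symm
    have hlt : h - m < k * w := by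
      have hkw : 0 < k * w := Nat.mul_pos hk hw0
      have a1 := Nat.div_add_mod h (k * w)
      have a2 := Nat.div_add_mod m (k * w)
      have a3 := Nat.mod_lt h hkw
      rw [e1] at a1
      omega
    have hnorm : ‖(h - m) • γ‖ ≤ 2 * ε := by
      have : (h - m) • γ = h • γ - m • γ := by
        rw [eq_sub_iff_add_eq, ← add_nsmul, Nat.sub_add_cancel hmh]
      rw [this]
      have := norm_sub_le (h • γ) (m • γ)
      linarith [hH h hh.1, hH m hm.1]
    refine Finset.mem_image.2 ⟨i, ?_, by omega⟩
    rw [Finset.mem_range]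
    have hiw : (i : ℝ) * ‖k • γ‖ ≤ 1 / 2 := by
      rw [hi] at hlt
      have : i < w := Nat.lt_of_mul_lt_mul_left hlt
      have h2 : (i : ℝ) ≤ w := by exact_mod_cast this.le
      exact (mul_le_mul_of_nonneg_right h2 hpos.le).trans hw
    have h3 : ‖(h - m) • γ‖ = i * ‖k • γ‖ := by
      rw [hi, mul_comm, mul_nsmul', UnitAddCircle.norm_nsmul_of_le hiw]
    rw [h3] at hnorm
    have h4 : (i : ℝ) ≤ 2 * ε / ‖k • γ‖ := (le_div_iff₀ hpos).2 hnorm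
    exact_mod_cast h4.trans_lt hc
  exact (Finset.card_le_card hsub).trans (Finset.card_image_le.trans (by simp))


/-- Pigeonhole on intervals of length `⌈2 * W⌉`: there are fewer of them than elements of `H`. -/
theorem exists_close_pair {N : ℕ} {H : Finset ℕ} (hH : ∀ h ∈ H, h < N) {W : ℝ} (hW : 1 ≤ W)
    (hcard : N ≤ W * H.card) (hN : 2 * W < N) :
    ∃ h₁ ∈ H, ∃ h₂ ∈ H, h₁ < h₂ ∧ ((h₂ - h₁ : ℕ) : ℝ) ≤ 4 * W := by
  set L := ⌈2 * W⌉₊ with hL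
  have hL1 : 2 * W ≤ L := Nat.le_ceil _
  have hL2 : (L : ℝ) < 2 * W + 1 := Nat.ceil_lt_add_one (by linarith)
  have hL0 : 0 < L := by
    have : (0 : ℝ) < L := by linarith
    exact_mod_cast this
  have hmaps : Set.MapsTo (fun h => h / L) (H : Set ℕ) (Finset.range (N / L + 1) : Finset ℕ) := by
    intro h hh
    have := hH h hh
    simp only [Finset.coe_range, Set.mem_Iio]
    exact Nat.lt_succ_of_le (Nat.div_le_div_right this.le)
  have hlt : (Finset.range (N / L + 1)).card < H.card := by
    rw [Finset.card_range]
    have h1 : ((N / L : ℕ) : ℝ) ≤ N / L := Nat.cast_div_le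
    have h2 : (N : ℝ) / L ≤ N / (2 * W) := by gcongr
    have h3 : (N : ℝ) / (2 * W) + 1 < H.card := by
      rw [div_add_one (by positivity), div_lt_iff₀ (by positivity)]
      linarith
    have : ((N / L + 1 : ℕ) : ℝ) < H.card := by push_cast; linarith
    exact_mod_cast this
  obtain ⟨x, hx, y, hy, hxy, he⟩ := Finset.exists_ne_map_eq_of_card_lt_of_maps_to hlt hmaps
  have main : ∀ a ∈ H, ∀ b ∈ H, a < b → a / L = b / L →
      ∃ h₁ ∈ H, ∃ h₂ ∈ H, h₁ < h₂ ∧ ((h₂ - h₁ : ℕ) : ℝ) ≤ 4 * W := by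
    intro a ha b hb hab hd
    refine ⟨a, ha, b, hb, hab, ?_⟩
    have a1 := Nat.div_add_mod a L
    have a2 := Nat.div_add_mod b L
    have a3 := Nat.mod_lt b hL0
    rw [hd] at a1
    have a4 : b - a ≤ L := by omega
    have a5 : ((b - a : ℕ) : ℝ) ≤ L := by exact_mod_cast a4
    linarith
  rcases lt_or_gt_of_ne hxy with h | h
  · exact main x hx y hy h he
  · exact main y hy x hx h he.symm

/-- If many multiples `h • γ`, `h < N`, are close to `0`, then so is a multiple `k • γ` with small
`k`, with a gain of a factor `N`. -/
theorem vinogradov {γ : UnitAddCircle} {N : ℕ} {H : Finset ℕ} (hHN : ∀ h ∈ H, h < N) {W ε : ℝ}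
    (hW : 1 ≤ W) (hcard : N ≤ W * H.card) (hN : 2 * W < N) (hε : 32 * W * ε ≤ 1)
    (hH : ∀ h ∈ H, ‖h • γ‖ ≤ ε) :
    ∃ k : ℕ, 1 ≤ k ∧ (k : ℝ) ≤ 4 * W ∧ ‖k • γ‖ * N ≤ 8 * W * ε * k := by
  obtain ⟨h₁, hh₁, h₂, hh₂, hlt, hle⟩ := exists_close_pair hHN hW hcard hN
  have hε0 : 0 ≤ ε := (norm_nonneg _).trans (hH h₁ hh₁)
  set k := h₂ - h₁ with hk
  have hk0 : 0 < k := by omega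
  refine ⟨k, hk0, hle, ?_⟩
  have hη2 : ‖k • γ‖ ≤ 2 * ε := by
    have : k • γ = h₂ • γ - h₁ • γ := by
      rw [eq_sub_iff_add_eq, ← add_nsmul, Nat.sub_add_cancel hlt.le]
    rw [this]
    have := norm_sub_le (h₂ • γ) (h₁ • γ)
    linarith [hH h₁ hh₁, hH h₂ hh₂]
  rcases (norm_nonneg (k • γ)).eq_or_lt' with h0 | hpos
  · rw [h0, zero_mul]; positivity
  set η := ‖k • γ‖ with hη
  have hε32 : 32 * ε ≤ 1 := by nlinarith
  have hε1 : 0 < ε := by linarith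
  -- The largest range in which the multiples of `k • γ` have norm exactly `i * η`.
  set w := ⌊1 / (2 * η)⌋₊ with hw
  have hw1 : (w : ℝ) ≤ 1 / (2 * η) := Nat.floor_le (by positivity)
  have hw2 : 1 / (2 * η) < w + 1 := Nat.lt_floor_add_one _
  have hw3 : (8 : ℝ) ≤ 1 / (2 * η) := by
    rw [le_div_iff₀ (by positivity)]; linarith
  have hwpos : 0 < w := by
    have : (0 : ℝ) < w := by linarith
    exact_mod_cast this
  have hw4 : 1 / (4 * η) ≤ w := by
    have : 1 / (2 * η) = 2 * (1 / (4 * η)) := by field_simp; norm_num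
    linarith
  have hwη : w * η ≤ 1 / 2 := by
    have := mul_le_mul_of_nonneg_right hw1 hpos.le
    have e : 1 / (2 * η) * η = 1 / 2 := by field_simp
    linarith
  set c := ⌊2 * ε / η⌋₊ + 1 with hc
  have hc1 : 2 * ε / η < c := by
    rw [hc]; push_cast; exact Nat.lt_floor_add_one _
  have hc2 : (c : ℝ) ≤ 4 * ε / η := by
    have h1 : (⌊2 * ε / η⌋₊ : ℝ) ≤ 2 * ε / η := Nat.floor_le (by positivity)
    have h2 : 1 ≤ 2 * ε / η := (one_le_div hpos).2 hη2
    have h3 : 4 * ε / η = 2 * ε / η + 2 * ε / η := by ring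
    rw [hc]; push_cast; linarith
  have hcount := Finset.card_le_mul_card_image (f := fun h => (h / (k * w), h % k)) H c
    (fun b _ => card_fiber_le hH hwη hk0 hwpos hpos hc1 b)
  have himage : (H.image fun h => (h / (k * w), h % k)).card ≤ (N / (k * w) + 1) * k := by
    have : (H.image fun h => (h / (k * w), h % k)) ⊆
        Finset.range (N / (k * w) + 1) ×ˢ Finset.range k := by
      intro b hb
      obtain ⟨h, hh, rfl⟩ := Finset.mem_image.1 hb
      rw [Finset.mem_product, Finset.mem_range, Finset.mem_range]
      exact ⟨Nat.lt_succ_of_le (Nat.div_le_div_right (hHN h hh).le), Nat.mod_lt _ hk0⟩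
    simpa using Finset.card_le_card this
  have h1 : (H.card : ℝ) ≤ c * ((N / (k * w) + 1 : ℕ) * k) := by
    exact_mod_cast hcount.trans (Nat.mul_le_mul_left c himage)
  have hkR : (0 : ℝ) < k := by exact_mod_cast hk0
  have hwR : (0 : ℝ) < w := by exact_mod_cast hwpos
  have h2 : ((N / (k * w) + 1 : ℕ) : ℝ) * k ≤ 4 * η * N + k := by
    have a1 : ((N / (k * w) : ℕ) : ℝ) ≤ N / ((k * w : ℕ) : ℝ) := Nat.cast_div_le
    push_cast at a1 ⊢
    have a2 : (N : ℝ) / (k * w) * k = N * (1 / w) := by field_simp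
    have a3 : 1 / (w : ℝ) ≤ 4 * η := by
      rw [div_le_iff₀ (by positivity)]
      have := mul_le_mul_of_nonneg_left hw4 (by positivity : (0 : ℝ) ≤ 4 * η)
      have e : 4 * η * (1 / (4 * η)) = 1 := by field_simp
      linarith
    have a4 : (N : ℝ) * (1 / w) ≤ N * (4 * η) := mul_le_mul_of_nonneg_left a3 (by positivity)
    have a5 := mul_le_mul_of_nonneg_right a1 hkR.le
    linarith
  have h3 : (H.card : ℝ) ≤ 4 * ε / η * (4 * η * N + k) :=
    h1.trans (mul_le_mul hc2 h2 (by positivity) (by positivity))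
  have h4 : (H.card : ℝ) * η ≤ 16 * ε * η * N + 4 * ε * k := by
    have := mul_le_mul_of_nonneg_right h3 hpos.le
    have e : 4 * ε / η * (4 * η * N + k) * η = 16 * ε * η * N + 4 * ε * k := by
      field_simp; ring
    linarith
  have h5 : N * η ≤ W * (16 * ε * η * N + 4 * ε * k) := by
    have a1 := mul_le_mul_of_nonneg_right hcard hpos.le
    have a2 := mul_le_mul_of_nonneg_left h4 (by linarith : 0 ≤ W)
    linarith
  -- The term `16 * W * ε * η * N` of `h5` is at most half of the left side and is absorbed there.
  have h6 : 32 * W * ε * (η * N) ≤ 1 * (η * N) := mul_le_mul_of_nonneg_right hε (by positivity)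
  linarith

/-! ### Weyl's inequality -/

/-- `φ` is a polynomial phase of degree at most `d` with top coefficient `γ`. -/
def PolyPhase : ℕ → UnitAddCircle → (ℕ → UnitAddCircle) → Prop
  | 0, γ, φ => ∀ n, φ n = γ
  | d + 1, γ, φ => ∀ h : ℕ, PolyPhase d (((d + 1) * h) • γ) (fun n => φ (n + h) - φ n)

theorem polyPhase_eval (d : ℕ) (p : Polynomial ℤ) (hp : p.natDegree ≤ d) (α : UnitAddCircle) :
    PolyPhase d (p.coeff d • α) (fun n => p.eval (n : ℤ) • α) := by
  induction d generalizing p with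
  | zero =>
    intro n
    rw [Polynomial.eq_C_of_natDegree_le_zero hp]
    simp
  | succ d ih =>
    intro h
    set q := Polynomial.taylor (h : ℤ) p - p with hq
    have hc : ∀ m, q.coeff m = (Polynomial.hasseDeriv m p).eval (h : ℤ) - p.coeff m := fun m => by
      rw [hq, Polynomial.coeff_sub, Polynomial.taylor_coeff]
    have hder : ∀ m, p.natDegree ≤ m + 1 →
        Polynomial.hasseDeriv m p = Polynomial.C (p.coeff m) +
          Polynomial.C (((m + 1 : ℕ) : ℤ) * p.coeff (m + 1)) * Polynomial.X := by
      intro m hm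
      ext j
      rw [Polynomial.hasseDeriv_coeff, Polynomial.coeff_add, Polynomial.coeff_C_mul,
        Polynomial.coeff_C, Polynomial.coeff_X]
      rcases j with _ | _ | j
      · simp
      · simp [add_comm, Nat.choose_succ_self_right]
      · rw [Polynomial.coeff_eq_zero_of_natDegree_lt (by omega)]
        simp
    -- In degrees `m > d` the coefficients of `p (X + h)` and of `p` agree, so differencing lowers
    -- the degree.
    have hqd : q.natDegree ≤ d := by
      rw [Polynomial.natDegree_le_iff_coeff_eq_zero]
      intro m hm
      rw [hc, hder m (by omega), Polynomial.coeff_eq_zero_of_natDegree_lt (n := m + 1) (by omega)]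
      simp
    have hqc : q.coeff d = ((d + 1) * h : ℕ) * p.coeff (d + 1) := by
      rw [hc, hder d hp]
      simp
      ring
    have := ih q hqd
    rw [hqc] at this
    have e1 : (((d + 1) * h : ℕ) * p.coeff (d + 1)) • α = ((d + 1) * h) • p.coeff (d + 1) • α := by
      rw [mul_smul, natCast_zsmul]
    have e2 : (fun n : ℕ => q.eval (n : ℤ) • α) =
        fun n : ℕ => p.eval ((n + h : ℕ) : ℤ) • α - p.eval (n : ℤ) • α := by
      funext n
      rw [hq, Polynomial.eval_sub, Polynomial.taylor_eval, sub_smul]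
      push_cast
      rfl
    rw [e1, e2] at this
    exact this

theorem norm_sum_circleChar_le (φ : ℕ → UnitAddCircle) (N : ℕ) :
    ‖∑ n ∈ Finset.range N, circleChar (φ n)‖ ≤ N := by
  refine (norm_sum_le _ _).trans ?_
  simp [norm_circleChar]

theorem weyl_linear {N : ℕ} {γ : UnitAddCircle} {φ : ℕ → UnitAddCircle} (hφ : PolyPhase 1 γ φ)
    {X : ℝ} (hX : 1 ≤ X) (h : N ≤ X * ‖∑ n ∈ Finset.range N, circleChar (φ n)‖) :
    ‖γ‖ * N ≤ X := by
  have hlin : ∀ n, φ n = φ 0 + n • γ := fun n => by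
    have := hφ n 0
    simp only [zero_add, one_mul] at this
    rw [← this]
    abel
  have hsum : ‖∑ n ∈ Finset.range N, circleChar (φ n)‖ =
      ‖∑ n ∈ Finset.range N, circleChar γ ^ n‖ := by
    have : ∀ n, circleChar (φ n) = circleChar (φ 0) * circleChar γ ^ n := fun n => by
      rw [hlin n, circleChar_add, circleChar_nsmul]
    rw [Finset.sum_congr rfl fun n _ => this n, ← Finset.mul_sum, norm_mul, norm_circleChar, one_mul]
  rw [hsum] at h
  have h1 := norm_geom_sum_circleChar_mul_le γ N
  have h2 := mul_le_mul_of_nonneg_left h (norm_nonneg γ)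
  have h3 := mul_le_mul_of_nonneg_left h1 (by linarith : 0 ≤ X)
  linarith

/-- Many differenced sums are large if the original sum is large. -/
theorem card_large_differences {N : ℕ} (hN : 1 ≤ N) {φ : ℕ → UnitAddCircle} {X : ℝ} (hX : 1 ≤ X)
    (h : N ≤ X * ‖∑ n ∈ Finset.range N, circleChar (φ n)‖) :
    N ≤ 4 * X ^ 2 * ((Finset.range N).filter fun h : ℕ => N ≤ 4 * X ^ 2 *
      ‖∑ n ∈ Finset.range (N - h), circleChar (φ (n + h) - φ n)‖).card := by
  set s : ℕ → ℝ := fun h => ‖∑ n ∈ Finset.range (N - h), circleChar (φ (n + h) - φ n)‖ with hs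
  have hvdc := vanDerCorput (fun n => circleChar (φ n)) N
  have e : ∀ h n : ℕ, circleChar (φ (n + h)) * (starRingEnd ℂ) (circleChar (φ n)) =
      circleChar (φ (n + h) - φ n) := fun h n => by
    rw [← circleChar_neg, ← circleChar_add, sub_eq_add_neg]
  simp_rw [e] at hvdc
  change _ ≤ 2 * ∑ h ∈ Finset.range N, s h at hvdc
  have hNR : (1 : ℝ) ≤ N := by exact_mod_cast hN
  -- Differences below the threshold contribute in total at most half of the lower bound for the
  -- squared sum, so the large ones, each at most `N`, must account for the rest.
  have hbound : ∀ h ∈ Finset.range N, s h ≤ (if (N : ℝ) ≤ 4 * X ^ 2 * s h then (N : ℝ) else 0)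
      + N / (4 * X ^ 2) := by
    intro h _
    have hle : s h ≤ N := (norm_sum_circleChar_le _ _).trans (by exact_mod_cast Nat.sub_le N h)
    have hp : 0 ≤ N / (4 * X ^ 2) := by positivity
    split_ifs with hc
    · linarith
    · rw [zero_add, le_div_iff₀ (by positivity)]
      linarith
  have hsum := Finset.sum_le_sum hbound
  rw [Finset.sum_add_distrib, ← Finset.sum_filter, Finset.sum_const, Finset.sum_const,
    Finset.card_range, nsmul_eq_mul, nsmul_eq_mul] at hsum
  set c : ℝ := (((Finset.range N).filter fun h : ℕ => (N : ℝ) ≤ 4 * X ^ 2 * s h).card : ℝ)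
  have h1 : (N : ℝ) ^ 2 ≤ X ^ 2 * (2 * (c * N + N * (N / (4 * X ^ 2)))) := by
    calc (N : ℝ) ^ 2 ≤ (X * ‖∑ n ∈ Finset.range N, circleChar (φ n)‖) ^ 2 := by gcongr
      _ = X ^ 2 * ‖∑ n ∈ Finset.range N, circleChar (φ n)‖ ^ 2 := by ring
      _ ≤ _ := by gcongr; linarith
  have h2 : X ^ 2 * (2 * (c * N + N * (N / (4 * X ^ 2)))) = (2 * X ^ 2 * c + N / 2) * N := by
    field_simp; ring
  rw [h2, sq] at h1
  have h3 := le_of_mul_le_mul_right h1 (by linarith)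
  linarith

/-- Every loss in the induction for Weyl's inequality is polynomial in `X`. Bounds of the form `(D *
X) ^ D` are stable under such losses, which lets the induction close with a single parameter. -/
theorem weyl_constant_bound {d D : ℕ} (hD : 1 ≤ D) : ∃ D' : ℕ, 1 ≤ D' ∧ ∀ X : ℝ, 1 ≤ X →
    (64 * (d + 1) * ((4 * X ^ 2) ^ (d + 1) * (D * (4 * X ^ 2)) ^ D) ^ 2) ^ (d + 2) ≤
      (D' * X) ^ D' := by
  set c : ℕ := 64 * (d + 1) * D with hc
  set m := (1 + 4 * (d + 1 + D)) * (d + 2) with hm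
  refine ⟨c * m, Nat.mul_pos (by positivity) (by positivity), fun X hX => ?_⟩
  have hDR : (1 : ℝ) ≤ D := by exact_mod_cast hD
  have hdR : (0 : ℝ) ≤ d := by positivity
  have hcR : (c : ℝ) = 64 * (d + 1) * D := by rw [hc]; push_cast; ring
  have hc64 : (64 : ℝ) * (d + 1) ≤ c := by rw [hcR]; nlinarith
  have hc4 : (4 : ℝ) * D ≤ c := by rw [hcR]; nlinarith
  have hc1 : (1 : ℝ) ≤ c := by linarith
  have hcX : (1 : ℝ) ≤ c * X := by nlinarith
  have a1 : (D : ℝ) * (4 * X ^ 2) ≤ (c * X) ^ 2 := by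
    have : 4 * (D : ℝ) ≤ c ^ 2 := by nlinarith
    calc (D : ℝ) * (4 * X ^ 2) = 4 * D * X ^ 2 := by ring
      _ ≤ c ^ 2 * X ^ 2 := by gcongr
      _ = _ := by ring
  have a2 : 4 * X ^ 2 ≤ (c * X) ^ 2 := by
    refine le_trans ?_ a1
    nlinarith [sq_nonneg X]
  have a3 : 64 * ((d : ℝ) + 1) ≤ c * X := by nlinarith
  calc (64 * (d + 1) * ((4 * X ^ 2) ^ (d + 1) * (D * (4 * X ^ 2)) ^ D) ^ 2) ^ (d + 2)
      ≤ ((c * X) * (((c * X) ^ 2) ^ (d + 1) * ((c * X) ^ 2) ^ D) ^ 2) ^ (d + 2) := by gcongr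
    _ = (c * X) ^ m := by rw [hm]; ring
    _ ≤ ((c * m : ℕ) * X) ^ m := by
        have hm1 : (1 : ℝ) ≤ m := by
          have : 1 ≤ m := Nat.mul_pos (by positivity) (by positivity)
          exact_mod_cast this
        push_cast
        gcongr
        nlinarith
    _ ≤ ((c * m : ℕ) * X) ^ (c * m) := by
        apply pow_le_pow_right₀
        · have hm1 : (1 : ℝ) ≤ m := by
            have : 1 ≤ m := Nat.mul_pos (by positivity) (by positivity)
            exact_mod_cast this
          push_cast
          nlinarith
        · exact Nat.le_mul_of_pos_left m (by positivity)

/-- Weyl's inequality: if the exponential sum of a polynomial phase is at least `1 / X` times the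
trivial bound, then the top coefficient is close to a rational with small denominator. -/
theorem weyl (d : ℕ) : ∃ D : ℕ, 1 ≤ D ∧ ∀ (N : ℕ) (γ : UnitAddCircle) (φ : ℕ → UnitAddCircle)
    (X : ℝ), 1 ≤ N → PolyPhase (d + 1) γ φ → 1 ≤ X →
    N ≤ X * ‖∑ n ∈ Finset.range N, circleChar (φ n)‖ →
    ∃ q : ℕ, 1 ≤ q ∧ (q : ℝ) ≤ (D * X) ^ D ∧ ‖q • γ‖ * N ^ (d + 1) ≤ (D * X) ^ D := by
  induction d with
  | zero =>
    refine ⟨1, le_rfl, fun N γ φ X hN hφ hX h => ⟨1, le_rfl, by simpa using hX, ?_⟩⟩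
    simpa using weyl_linear hφ hX h
  | succ d ih =>
    obtain ⟨D, hD, ih⟩ := ih
    obtain ⟨D', hD', hbound⟩ := weyl_constant_bound (d := d + 1) hD
    refine ⟨D', hD', fun N γ φ X hN hφ hX h => ?_⟩
    have hB := hbound X hX
    set Y : ℝ := 4 * X ^ 2 with hY
    have hY1 : 1 ≤ Y := by rw [hY]; nlinarith
    set Z : ℝ := (D * Y) ^ D with hZ
    have hDR : (1 : ℝ) ≤ D := by exact_mod_cast hD
    have hZ1 : 1 ≤ Z := one_le_pow₀ (by nlinarith)
    set W : ℝ := Y ^ (d + 1 + 1) * Z with hW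
    have hYp : 1 ≤ Y ^ (d + 1 + 1) := one_le_pow₀ hY1
    have hW1 : 1 ≤ W := by rw [hW]; nlinarith
    have hZW : Z ≤ W := by rw [hW]; nlinarith
    have hNR : (1 : ℝ) ≤ N := by exact_mod_cast hN
    have hd0 : (0 : ℝ) ≤ d := by positivity
    set B : ℝ := 64 * ((d + 1 : ℕ) + 1) * W ^ 2 with hBdef
    have hB0 : 64 * W ^ 2 ≤ B := by
      rw [hBdef]; push_cast; nlinarith [sq_nonneg W]
    have hB1 : 1 ≤ B := by nlinarith
    have hle1 : B ≤ B ^ (d + 1 + 2) := le_self_pow₀ hB1 (by omega)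
    -- For small `N` the denominator `1` suffices by the size of the constants. For large `N` the
    -- hypotheses of Vinogradov's lemma hold with `ε = W / N ^ (d + 1)`.
    rcases le_or_gt (N : ℝ) (32 * W ^ 2) with hsmall | hlarge
    · refine ⟨1, le_rfl, ?_, ?_⟩
      · push_cast; exact hB1.trans (hle1.trans hB)
      · rw [one_smul]
        have hγ : ‖γ‖ ≤ 1 := by
          have := AddCircle.norm_le_half_period (1 : ℝ) (x := γ) one_ne_zero
          rw [abs_one] at this
          linarith
        calc ‖γ‖ * (N : ℝ) ^ (d + 1 + 1) ≤ 1 * B ^ (d + 1 + 1) := by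
              gcongr
              nlinarith [sq_nonneg W]
          _ ≤ B ^ (d + 1 + 2) := by
              rw [one_mul]; exact pow_le_pow_right₀ hB1 (by omega)
          _ ≤ _ := hB
    · have hcard := card_large_differences hN hX h
      rw [← hY] at hcard
      set H := (Finset.range N).filter fun h : ℕ => (N : ℝ) ≤ Y *
        ‖∑ n ∈ Finset.range (N - h), circleChar (φ (n + h) - φ n)‖ with hH
      -- A differenced sum of size `N / Y` has at least `N / Y` terms. Replacing its length `N - h`
      -- by `N` thus costs only a power of `Y`.
      have hq : ∀ h ∈ H, ∃ q : ℕ, 1 ≤ q ∧ (q : ℝ) ≤ Z ∧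
          ‖q • (((d + 1 + 1) * h) • γ)‖ * (N : ℝ) ^ (d + 1) ≤ W := by
        intro h hh
        rw [hH, Finset.mem_filter, Finset.mem_range] at hh
        have hlen : ((N - h : ℕ) : ℝ) ≤ N := by exact_mod_cast Nat.sub_le N h
        obtain ⟨q, hq1, hq2, hq3⟩ := ih (N - h) _ (fun n => φ (n + h) - φ n) Y (by omega) (hφ h) hY1
          (hlen.trans hh.2)
        refine ⟨q, hq1, hq2, ?_⟩
        have hs := norm_sum_circleChar_le (fun n => φ (n + h) - φ n) (N - h)
        have hNY : (N : ℝ) ≤ Y * (N - h : ℕ) := hh.2.trans (by gcongr)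
        calc ‖q • (((d + 1 + 1) * h) • γ)‖ * (N : ℝ) ^ (d + 1)
            ≤ ‖q • (((d + 1 + 1) * h) • γ)‖ * (Y * (N - h : ℕ)) ^ (d + 1) := by gcongr
          _ = Y ^ (d + 1) * (‖q • (((d + 1 + 1) * h) • γ)‖ * ((N - h : ℕ) : ℝ) ^ (d + 1)) := by
              rw [mul_pow]; ring
          _ ≤ Y ^ (d + 1) * Z := by gcongr
          _ ≤ W := by
              rw [hW]
              exact mul_le_mul_of_nonneg_right (pow_le_pow_right₀ hY1 (by omega)) (by linarith)
      choose! q hq1 hq2 hq3 using hq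
      have hmaps : ∀ h ∈ H, q h ∈ Finset.Icc 1 ⌊Z⌋₊ := fun h hh =>
        Finset.mem_Icc.2 ⟨hq1 h hh, Nat.le_floor (hq2 h hh)⟩
      have hfl : (⌊Z⌋₊ : ℝ) ≤ Z := Nat.floor_le (by linarith)
      -- At most `Z` denominators occur, so a single one serves at least `N / W` of the differences
      -- `h`.
      obtain ⟨q₀, hq₀, hfib⟩ := Finset.exists_le_card_fiber_of_nsmul_le_card_of_maps_to
        (b := (N / W : ℝ)) hmaps
        (Finset.nonempty_Icc.2 (Nat.le_floor (by exact_mod_cast hZ1))) (by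
          rw [Nat.card_Icc, Nat.add_sub_cancel, nsmul_eq_mul]
          have h1 : (N : ℝ) / Y ≤ H.card := by
            rw [div_le_iff₀ (by linarith)]; linarith
          refine le_trans ?_ h1
          calc (⌊Z⌋₊ : ℝ) * (N / W) ≤ Z * (N / W) := by gcongr
            _ = N / Y ^ (d + 1 + 1) := by rw [hW]; field_simp
            _ ≤ N / Y := by
                gcongr
                exact le_self_pow₀ hY1 (by omega))
      rw [Finset.mem_Icc] at hq₀
      have hq₀Z : (q₀ : ℝ) ≤ Z := le_trans (by exact_mod_cast hq₀.2) hfl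
      have hNpow : (0 : ℝ) < (N : ℝ) ^ (d + 1) := by positivity
      -- Removing the varying factor `h` gains the missing power of `N`.
      obtain ⟨k, hk1, hk2, hk3⟩ := vinogradov (γ := (q₀ * (d + 1 + 1)) • γ) (N := N)
        (H := H.filter fun h => q h = q₀) (W := W) (ε := W / (N : ℝ) ^ (d + 1))
        (fun h hh => by
          rw [Finset.mem_filter, hH, Finset.mem_filter, Finset.mem_range] at hh
          exact hh.1.1) hW1
        (by
          rw [div_le_iff₀ (by linarith)] at hfib
          linarith) (by nlinarith)
        (by
          rw [← mul_div_assoc, div_le_one hNpow]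
          have : (N : ℝ) ≤ (N : ℝ) ^ (d + 1) := le_self_pow₀ hNR (by omega)
          nlinarith)
        (fun h hh => by
          rw [Finset.mem_filter] at hh
          have h1 := hq3 h hh.1
          rw [hh.2] at h1
          rw [le_div_iff₀ hNpow]
          have e : h • (q₀ * (d + 1 + 1)) • γ = q₀ • ((d + 1 + 1) * h) • γ := by
            rw [← mul_smul, ← mul_smul]; congr 1; ring
          rw [e]; exact h1)
      refine ⟨k * (q₀ * (d + 1 + 1)), Nat.mul_pos hk1 (Nat.mul_pos hq₀.1 (by omega)), ?_, ?_⟩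
      · refine le_trans ?_ (hle1.trans hB)
        push_cast
        calc (k : ℝ) * (q₀ * (d + 1 + 1)) ≤ 4 * W * (W * (d + 1 + 1)) := by
              gcongr
              exact hq₀Z.trans hZW
          _ ≤ B := by rw [hBdef]; push_cast; nlinarith [sq_nonneg W, mul_nonneg hd0 (sq_nonneg W)]
      · rw [mul_smul]
        have hpos : (0 : ℝ) ≤ (N : ℝ) ^ (d + 1) := hNpow.le
        calc ‖k • (q₀ * (d + 1 + 1)) • γ‖ * (N : ℝ) ^ (d + 1 + 1)
            = ‖k • (q₀ * (d + 1 + 1)) • γ‖ * N * (N : ℝ) ^ (d + 1) := by ring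
          _ ≤ 8 * W * (W / (N : ℝ) ^ (d + 1)) * k * (N : ℝ) ^ (d + 1) := by gcongr
          _ = 8 * W * W * k := by field_simp
          _ ≤ 8 * W * W * (4 * W) := by gcongr
          _ ≤ (64 * W ^ 2) ^ 2 := by
              have : W ^ 3 ≤ W ^ 4 := pow_le_pow_right₀ hW1 (by norm_num)
              have h4 : 0 ≤ W ^ 4 := by positivity
              have e1 : 8 * W * W * (4 * W) = 32 * W ^ 3 := by ring
              have e2 : (64 * W ^ 2) ^ 2 = 4096 * W ^ 4 := by ring
              rw [e1, e2]
              linarith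
          _ ≤ B ^ 2 := by gcongr
          _ ≤ B ^ (d + 1 + 2) := pow_le_pow_right₀ hB1 (by omega)
          _ ≤ _ := hB

/-! ### The multipliers of the polynomial averages -/

/-- The Fourier multiplier of the average along the first `N` values of `P`. -/
noncomputable def polyMult (P : Polynomial ℤ) (N : ℕ) (α : UnitAddCircle) : ℂ :=
  (1 / (N : ℂ)) * ∑ n ∈ Finset.range N, circleChar (-(P.eval ((n : ℤ) + 1)) • α)

/-- The normalised complete exponential sum at a torsion point of the circle. -/
noncomputable def gaussMult (P : Polynomial ℤ) (θ : UnitAddCircle) : ℂ :=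
  polyMult P (addOrderOf θ) θ

theorem norm_polyMult (P : Polynomial ℤ) {N : ℕ} (hN : 1 ≤ N) (α : UnitAddCircle) :
    N * ‖polyMult P N α‖ =
      ‖∑ n ∈ Finset.range N, circleChar (-(P.eval ((n : ℤ) + 1)) • α)‖ := by
  have : (0 : ℝ) < N := by exact_mod_cast hN
  rw [polyMult, norm_mul, norm_div, norm_one, Complex.norm_natCast]
  field_simp

theorem norm_polyMult_le_one (P : Polynomial ℤ) (N : ℕ) (α : UnitAddCircle) :
    ‖polyMult P N α‖ ≤ 1 := by
  rcases Nat.eq_zero_or_pos N with h | h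
  · simp [polyMult, h]
  have h1 := norm_polyMult P h α
  have h2 := norm_sum_circleChar_le (fun n : ℕ => -(P.eval ((n : ℤ) + 1)) • α) N
  rw [← h1] at h2
  have : (0 : ℝ) < N := by exact_mod_cast h
  by_contra hcon
  nlinarith

/-- Weyl's inequality for the phase `-P(n + 1)`, whose top coefficient is `-b`. The factor `b` is
absorbed into the denominator. -/
theorem exists_weyl_polyMult (P : Polynomial ℤ) (hP : 0 < P.leadingCoeff) (hd : 1 ≤ P.natDegree) :
    ∃ D : ℕ, 1 ≤ D ∧ ∀ (N : ℕ) (α : UnitAddCircle) (X : ℝ), 1 ≤ N → 1 ≤ X →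
      1 ≤ X * ‖polyMult P N α‖ →
      ∃ q : ℕ, 1 ≤ q ∧ (q : ℝ) ≤ (D * X) ^ D ∧ ‖q • α‖ * N ^ P.natDegree ≤ (D * X) ^ D := by
  obtain ⟨d, hd'⟩ : ∃ d, P.natDegree = d + 1 := ⟨P.natDegree - 1, by omega⟩
  obtain ⟨D, hD, hw⟩ := weyl d
  obtain ⟨b, hb⟩ : ∃ b : ℕ, P.leadingCoeff = b := ⟨P.leadingCoeff.toNat, by omega⟩
  have hb1 : 1 ≤ b := by omega
  refine ⟨D * b, Nat.mul_pos hD hb1, fun N α X hN hX h => ?_⟩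
  have hph := polyPhase_eval (d + 1) (Polynomial.taylor 1 (-P))
    (by rw [Polynomial.natDegree_taylor, Polynomial.natDegree_neg, hd']) α
  have hcoeff : (Polynomial.taylor 1 (-P)).coeff (d + 1) = -(b : ℤ) := by
    have := Polynomial.coeff_taylor_natDegree (1 : ℤ) (-P)
    rw [Polynomial.natDegree_neg, hd', Polynomial.leadingCoeff_neg, hb] at this
    exact this
  have hev : (fun n : ℕ => (Polynomial.taylor 1 (-P)).eval (n : ℤ) • α) =
      fun n : ℕ => -(P.eval ((n : ℤ) + 1)) • α := by
    funext n
    rw [Polynomial.taylor_eval, Polynomial.eval_neg]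
  rw [hcoeff, hev] at hph
  obtain ⟨q, hq1, hq2, hq3⟩ := hw N _ _ X hN hph hX (by
    rw [← norm_polyMult P hN]
    have : (0 : ℝ) ≤ N := by positivity
    nlinarith)
  have hbR : (1 : ℝ) ≤ b := by exact_mod_cast hb1
  have hDR : (1 : ℝ) ≤ D := by exact_mod_cast hD
  have hDX : 1 ≤ (D : ℝ) * X := by nlinarith
  have hbig : (D * X) ^ D * b ≤ ((D * b : ℕ) * X) ^ (D * b) := by
    calc ((D : ℝ) * X) ^ D * b ≤ (D * X) ^ D * b ^ D := by
          gcongr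
          exact le_self_pow₀ hbR (by omega)
      _ = ((D * b : ℕ) * X) ^ D := by push_cast; rw [← mul_pow]; congr 1; ring
      _ ≤ _ := by
          apply pow_le_pow_right₀
          · push_cast; nlinarith
          · exact Nat.le_mul_of_pos_right D hb1
  refine ⟨q * b, Nat.mul_pos hq1 hb1, ?_, ?_⟩
  · push_cast at hbig ⊢
    exact le_trans (by gcongr) hbig
  · have e : ‖(q * b) • α‖ = ‖q • (-(b : ℤ)) • α‖ := by
      rw [neg_smul, smul_neg, norm_neg, natCast_zsmul, mul_smul]
    rw [e, hd']
    have : (0 : ℝ) ≤ (D * X) ^ D := by positivity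
    refine hq3.trans (le_trans ?_ hbig)
    nlinarith

/-! ### Torsion points and power decay of the multipliers -/

theorem UnitAddCircle.exists_torsion_near (α : UnitAddCircle) {q : ℕ} (hq : 1 ≤ q) :
    ∃ θ : UnitAddCircle, q • θ = 0 ∧ q * ‖α - θ‖ ≤ ‖q • α‖ := by
  obtain ⟨t, ht, -, -⟩ := UnitAddCircle.exists_coe_eq α
  subst ht
  have hq0 : (0 : ℝ) < q := by exact_mod_cast hq
  refine ⟨((round (q * t) / q : ℝ) : UnitAddCircle), ?_, ?_⟩
  · rw [← AddCircle.coe_nsmul, nsmul_eq_mul, mul_div_cancel₀ _ hq0.ne', AddCircle.coe_eq_zero_iff]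
    exact ⟨round (q * t), by simp⟩
  · rw [← AddCircle.coe_sub, ← AddCircle.coe_nsmul, nsmul_eq_mul, UnitAddCircle.norm_eq (x := q * t)]
    have h1 : ‖((t - round (q * t) / q : ℝ) : UnitAddCircle)‖ ≤ |t - round (q * t) / q| := by
      have := AddCircle.norm_eq (1 : ℝ) (x := t - round (q * t) / q)
      rw [UnitAddCircle.norm_eq]
      simpa using round_le (t - round (q * t) / q) 0
    have h2 : q * |t - round (q * t) / q| = |q * t - round (q * t)| := by
      rw [← abs_of_pos hq0, ← abs_mul, abs_of_pos hq0]
      congr 1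
      field_simp
    rw [← h2]
    gcongr

theorem UnitAddCircle.one_le_mul_norm {x : UnitAddCircle} {q : ℕ} (hq : 1 ≤ q) (hx : q • x = 0)
    (hx0 : x ≠ 0) : 1 ≤ q * ‖x‖ := by
  have hfin : IsOfFinAddOrder x := isOfFinAddOrder_iff_nsmul_eq_zero.2 ⟨q, hq, hx⟩
  have h1 := AddCircle.le_add_order_smul_norm_of_isOfFinAddOrder hfin hx0
  rw [nsmul_eq_mul] at h1
  have h2 : addOrderOf x ≤ q := Nat.le_of_dvd hq (addOrderOf_dvd_of_nsmul_eq_zero hx)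
  have h3 : (addOrderOf x : ℝ) ≤ q := by exact_mod_cast h2
  nlinarith [norm_nonneg x]

theorem UnitAddCircle.one_le_mul_norm_sub {x y : UnitAddCircle} (hx : 0 < addOrderOf x)
    (hy : 0 < addOrderOf y) (hxy : x ≠ y) :
    1 ≤ (addOrderOf x : ℝ) * addOrderOf y * ‖x - y‖ := by
  have h := UnitAddCircle.one_le_mul_norm (x := x - y) (q := addOrderOf x * addOrderOf y)
    (Nat.mul_pos hx hy) (by
      rw [smul_sub, mul_comm, mul_smul, addOrderOf_nsmul_eq_zero, smul_zero, mul_comm, mul_smul,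
        addOrderOf_nsmul_eq_zero, smul_zero, sub_zero]) (sub_ne_zero.2 hxy)
  push_cast at h
  exact h

theorem le_mul_rpow_neg_of_le_pow {D : ℕ} (hD : 1 ≤ D) {τ y : ℝ} (hτ : 0 < τ) (hy : 0 < y)
    (h : y ≤ (D * (1 / τ)) ^ D) : τ ≤ D * y ^ (-(1 / (D : ℝ))) := by
  have hD0 : (0 : ℝ) < D := by exact_mod_cast hD
  have h1 : y ^ (1 / (D : ℝ)) ≤ D * (1 / τ) := by
    calc y ^ (1 / (D : ℝ)) ≤ ((D * (1 / τ)) ^ D) ^ (1 / (D : ℝ)) :=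
          Real.rpow_le_rpow hy.le h (by positivity)
      _ = D * (1 / τ) := by
          rw [one_div (D : ℝ)]
          exact Real.pow_rpow_inv_natCast (by positivity) (by omega)
  rw [Real.rpow_neg hy.le]
  have h2 : 0 < y ^ (1 / (D : ℝ)) := Real.rpow_pos_of_pos hy _
  rw [← div_eq_mul_inv, le_div_iff₀ h2]
  calc τ * y ^ (1 / (D : ℝ)) ≤ τ * (D * (1 / τ)) := by gcongr
    _ = D := by field_simp

theorem polyMult_term_periodic (P : Polynomial ℤ) {θ : UnitAddCircle} {q : ℕ} (hθ : q • θ = 0)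
    (x : ℤ) : circleChar (-(P.eval (x + q + 1)) • θ) = circleChar (-(P.eval (x + 1)) • θ) := by
  congr 1
  have h1 : (x + q + 1) - (x + 1) ∣ P.eval (x + q + 1) - P.eval (x + 1) :=
    Polynomial.sub_dvd_eval_sub _ _ _
  obtain ⟨c, hc⟩ := h1
  have h2 : P.eval (x + q + 1) = P.eval (x + 1) + c * q := by
    have : (x + q + 1) - (x + 1) = (q : ℤ) := by ring
    rw [this] at hc
    linarith
  rw [h2, neg_smul, neg_smul, add_smul, mul_smul, natCast_zsmul, hθ, smul_zero, add_zero]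

theorem sum_polyMult_mul (P : Polynomial ℤ) {θ : UnitAddCircle} {q : ℕ} (hθ : q • θ = 0)
    (hq : 1 ≤ q) (c : ℕ) :
    ∑ n ∈ Finset.range (q * c), circleChar (-(P.eval ((n : ℤ) + 1)) • θ) =
      c * (q * polyMult P q θ) := by
  have h := sum_range_mul_periodic (fun x : ℤ => circleChar (-(P.eval (x + 1)) • θ)) q c
    (fun x => polyMult_term_periodic P hθ x) 0
  simp only [zero_add] at h
  rw [h, nsmul_eq_mul, polyMult]
  have : (q : ℂ) ≠ 0 := by exact_mod_cast (by omega : q ≠ 0)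
  field_simp

/-- At a torsion point the phase is periodic: complete periods give the complete sum exactly, and
fewer than `addOrderOf θ` terms remain. -/
theorem norm_polyMult_sub_gaussMult_le (P : Polynomial ℤ) {θ : UnitAddCircle}
    (hθ : 0 < addOrderOf θ) {N : ℕ} (hN : 1 ≤ N) :
    ‖polyMult P N θ - gaussMult P θ‖ ≤ 2 * addOrderOf θ / N := by
  unfold gaussMult
  set q := addOrderOf θ with hq
  have hN0 : (0 : ℝ) < N := by exact_mod_cast hN
  have hNC : (N : ℂ) ≠ 0 := by exact_mod_cast (by omega : N ≠ 0)
  set R := ∑ m ∈ Finset.range (N % q),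
    circleChar (-(P.eval (((q * (N / q) + m : ℕ) : ℤ) + 1)) • θ) with hR
  have hsum : ∑ n ∈ Finset.range N, circleChar (-(P.eval ((n : ℤ) + 1)) • θ) =
      (N / q : ℕ) * (q * polyMult P q θ) + R := by
    conv_lhs => rw [← Nat.div_add_mod N q]
    rw [Finset.sum_range_add, sum_polyMult_mul P (addOrderOf_nsmul_eq_zero θ) hθ]
  have hNq : (N : ℂ) = q * (N / q : ℕ) + (N % q : ℕ) := by
    exact_mod_cast (Nat.div_add_mod N q).symm
  have e : polyMult P N θ - polyMult P q θ =
      (1 / (N : ℂ)) * (R - (N % q : ℕ) * polyMult P q θ) := by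
    rw [polyMult, hsum]
    field_simp
    rw [hNq]
    ring
  have hR1 : ‖R‖ ≤ (N % q : ℕ) := norm_sum_circleChar_le
    (fun m : ℕ => -(P.eval (((q * (N / q) + m : ℕ) : ℤ) + 1)) • θ) (N % q)
  have hmod : ((N % q : ℕ) : ℝ) ≤ q := by exact_mod_cast (Nat.mod_lt N hθ).le
  rw [e, norm_mul, norm_div, norm_one, Complex.norm_natCast]
  have h2 : ‖R - (N % q : ℕ) * polyMult P q θ‖ ≤ 2 * q := by
    refine (norm_sub_le _ _).trans ?_
    rw [norm_mul, Complex.norm_natCast]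
    have := mul_le_mul_of_nonneg_left (norm_polyMult_le_one P q θ)
      (Nat.cast_nonneg (α := ℝ) (N % q))
    linarith
  calc 1 / (N : ℝ) * ‖R - (N % q : ℕ) * polyMult P q θ‖ ≤ 1 / N * (2 * q) := by gcongr
    _ = _ := by ring

/-- Decay of the multipliers away from, and of the complete sums at, the torsion points. -/
theorem exists_polyMult_decay (P : Polynomial ℤ) (hP : 0 < P.leadingCoeff)
    (hd : 1 ≤ P.natDegree) :
    ∃ D : ℕ, 1 ≤ D ∧
      (∀ (N : ℕ) (α : UnitAddCircle), 1 ≤ N → ∃ θ : UnitAddCircle, 0 < addOrderOf θ ∧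
        ‖polyMult P N α‖ ≤
          D * (max (addOrderOf θ : ℝ) (N ^ P.natDegree * ‖α - θ‖)) ^ (-(1 / (D : ℝ)))) ∧
      (∀ θ : UnitAddCircle, 0 < addOrderOf θ →
        ‖gaussMult P θ‖ ≤ D * (addOrderOf θ : ℝ) ^ (-(1 / (D : ℝ)))) := by
  obtain ⟨D, hD, hw⟩ := exists_weyl_polyMult P hP hd
  refine ⟨D, hD, ?_, ?_⟩
  · intro N α hN
    rcases (norm_nonneg (polyMult P N α)).eq_or_lt' with h0 | hτ
    · refine ⟨0, by simp, ?_⟩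
      rw [h0]; positivity
    set τ := ‖polyMult P N α‖ with hτdef
    have hτ1 : τ ≤ 1 := norm_polyMult_le_one P N α
    obtain ⟨q, hq1, hq2, hq3⟩ := hw N α (1 / τ) hN ((one_le_div hτ).2 hτ1) (by
      rw [one_div, inv_mul_cancel₀ hτ.ne'])
    obtain ⟨θ, hθ, hθ2⟩ := UnitAddCircle.exists_torsion_near α hq1
    have hfin : IsOfFinAddOrder θ := isOfFinAddOrder_iff_nsmul_eq_zero.2 ⟨q, hq1, hθ⟩
    have hpos := hfin.addOrderOf_pos
    have hle : addOrderOf θ ≤ q := Nat.le_of_dvd hq1 (addOrderOf_dvd_of_nsmul_eq_zero hθ)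
    have hleR : (addOrderOf θ : ℝ) ≤ q := by exact_mod_cast hle
    have hqR : (1 : ℝ) ≤ q := by exact_mod_cast hq1
    refine ⟨θ, hpos, le_mul_rpow_neg_of_le_pow hD hτ ?_ ?_⟩
    · exact lt_max_of_lt_left (by exact_mod_cast hpos)
    · refine max_le (hleR.trans hq2) (le_trans ?_ hq3)
      rw [mul_comm]
      gcongr
      nlinarith [norm_nonneg (α - θ)]
  · intro θ hθ
    rcases (norm_nonneg (gaussMult P θ)).eq_or_lt' with h0 | hτ
    · rw [h0]; positivity
    set τ := ‖gaussMult P θ‖ with hτdef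
    have hτ1 : τ ≤ 1 := norm_polyMult_le_one P _ θ
    set q := addOrderOf θ with hq
    have hqR : (1 : ℝ) ≤ q := by exact_mod_cast hθ
    -- The mean over `q` periods is the complete sum, but the greater length sharpens Weyl's
    -- conclusion: if `p • θ ≠ 0` then `‖p • θ‖ ≥ 1 / q`, whence `‖p • θ‖ * (q * q) ^ d ≥ q`.
    have hsq : polyMult P (q * q) θ = gaussMult P θ := by
      rw [polyMult, sum_polyMult_mul P (addOrderOf_nsmul_eq_zero θ) hθ, gaussMult]
      have : (q : ℂ) ≠ 0 := by exact_mod_cast (by omega : q ≠ 0)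
      push_cast
      field_simp
      rw [← hq]
    obtain ⟨p, hp1, hp2, hp3⟩ := hw (q * q) θ (1 / τ) (Nat.mul_pos hθ hθ)
      ((one_le_div hτ).2 hτ1) (by rw [hsq, one_div, inv_mul_cancel₀ hτ.ne'])
    refine le_mul_rpow_neg_of_le_pow hD hτ (by linarith) ?_
    by_cases hpθ : p • θ = 0
    · have hle : q ≤ p := Nat.le_of_dvd hp1 (addOrderOf_dvd_of_nsmul_eq_zero hpθ)
      exact le_trans (by exact_mod_cast hle) hp2
    · have h1 := UnitAddCircle.one_le_mul_norm (q := q) hθ (x := p • θ) (by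
        rw [smul_comm, addOrderOf_nsmul_eq_zero, smul_zero]) hpθ
      refine le_trans ?_ hp3
      push_cast
      have h2 : (q : ℝ) * q ≤ (q * q) ^ P.natDegree := le_self_pow₀ (by nlinarith) (by omega)
      calc (q : ℝ) = 1 * q := by ring
        _ ≤ (q * ‖p • θ‖) * q := by gcongr
        _ = ‖p • θ‖ * (q * q) := by ring
        _ ≤ _ := by gcongr

theorem exists_polyMult_lipschitz (P : Polynomial ℤ) :
    ∃ A : ℝ, 0 ≤ A ∧ ∀ (N : ℕ) (α θ : UnitAddCircle), 1 ≤ N →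
      ‖polyMult P N α - polyMult P N θ‖ ≤ A * (N ^ P.natDegree * ‖α - θ‖) := by
  set c : ℝ := ∑ i ∈ Finset.range (P.natDegree + 1), |(P.coeff i : ℝ)| with hc
  have hc0 : 0 ≤ c := by positivity
  refine ⟨2 * Real.pi * c, by positivity, fun N α θ hN => ?_⟩
  have hN0 : (1 : ℝ) ≤ N := by exact_mod_cast hN
  have hev : ∀ n ∈ Finset.range N, |((P.eval ((n : ℤ) + 1) : ℤ) : ℝ)| ≤ c * N ^ P.natDegree := by
    intro n hn
    rw [Polynomial.eval_eq_sum_range]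
    push_cast
    refine (Finset.abs_sum_le_sum_abs _ _).trans ?_
    rw [hc, Finset.sum_mul]
    refine Finset.sum_le_sum fun i hi => ?_
    rw [abs_mul, abs_pow]
    have hn1 : |(n : ℝ) + 1| ≤ N := by
      rw [abs_of_nonneg (by positivity)]
      exact_mod_cast Finset.mem_range.1 hn
    have h2 : |(n : ℝ) + 1| ^ i ≤ N ^ P.natDegree := by
      calc |(n : ℝ) + 1| ^ i ≤ (N : ℝ) ^ i := by gcongr
        _ ≤ _ := pow_le_pow_right₀ hN0 (by have := Finset.mem_range.1 hi; omega)
    gcongr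
  have hterm : ∀ n ∈ Finset.range N, ‖circleChar (-(P.eval ((n : ℤ) + 1)) • α) -
      circleChar (-(P.eval ((n : ℤ) + 1)) • θ)‖ ≤ 2 * Real.pi * (c * N ^ P.natDegree * ‖α - θ‖) := by
    intro n hn
    refine (norm_circleChar_sub_le _ _).trans ?_
    rw [← smul_sub, neg_smul, norm_neg]
    have h1 := norm_zsmul_le (P.eval ((n : ℤ) + 1)) (α - θ)
    rw [Int.norm_eq_abs] at h1
    have h2 := hev n hn
    have hpi := Real.pi_pos
    have h3 : ‖P.eval ((n : ℤ) + 1) • (α - θ)‖ ≤ c * N ^ P.natDegree * ‖α - θ‖ :=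
      h1.trans (by gcongr)
    gcongr
  rw [polyMult, polyMult, ← mul_sub, ← Finset.sum_sub_distrib, norm_mul, norm_div, norm_one,
    Complex.norm_natCast]
  have hs := (norm_sum_le _ _).trans (Finset.sum_le_sum hterm)
  rw [Finset.sum_const, Finset.card_range, nsmul_eq_mul] at hs
  calc 1 / (N : ℝ) * _ ≤ 1 / N * (N * (2 * Real.pi * (c * N ^ P.natDegree * ‖α - θ‖))) := by gcongr
    _ = _ := by field_simp

/-! ### Major arcs -/

/-- The torsion points whose order lies in `[2 ^ s, 2 ^ (s + 1))`. -/
theorem finite_torsion_dyadic (s : ℕ) :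
    {θ : UnitAddCircle | 2 ^ s ≤ addOrderOf θ ∧ addOrderOf θ < 2 ^ (s + 1)}.Finite := by
  have h : {θ : UnitAddCircle | 2 ^ s ≤ addOrderOf θ ∧ addOrderOf θ < 2 ^ (s + 1)} ⊆
      ⋃ n ∈ Finset.Ico (2 ^ s) (2 ^ (s + 1)), {θ : UnitAddCircle | addOrderOf θ = n} := by
    intro θ hθ
    simp only [Set.mem_iUnion]
    exact ⟨addOrderOf θ, Finset.mem_Ico.2 hθ, rfl⟩
  refine Set.Finite.subset (Set.Finite.biUnion (Finset.finite_toSet _) fun n hn => ?_) h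
  have hn' : 0 < n := lt_of_lt_of_le (by positivity) (Finset.mem_Ico.1 hn).1
  exact AddCircle.finite_setOfPred_addOrderOf_eq (1 : ℝ) hn'

/-- The torsion points whose order lies in `[2 ^ s, 2 ^ (s + 1))`. -/
noncomputable def arcCenters (s : ℕ) : Finset UnitAddCircle := (finite_torsion_dyadic s).toFinset

/-- A radius at which the arcs around `arcCenters s` are disjoint. -/
noncomputable def arcRadius (s : ℕ) : ℝ := (1 / 2) ^ (2 * s + 3)

theorem mem_arcCenters {s : ℕ} {θ : UnitAddCircle} :
    θ ∈ arcCenters s ↔ 2 ^ s ≤ addOrderOf θ ∧ addOrderOf θ < 2 ^ (s + 1) := by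
  simp [arcCenters]

theorem addOrderOf_pos_of_mem_arcCenters {s : ℕ} {θ : UnitAddCircle} (hθ : θ ∈ arcCenters s) :
    0 < addOrderOf θ :=
  lt_of_lt_of_le (by positivity) (mem_arcCenters.1 hθ).1

theorem mem_arcCenters_log {θ : UnitAddCircle} (hθ : 0 < addOrderOf θ) :
    θ ∈ arcCenters (Nat.log 2 (addOrderOf θ)) :=
  mem_arcCenters.2 ⟨Nat.pow_log_le_self 2 hθ.ne', Nat.lt_pow_succ_log_self (by norm_num) _⟩

theorem eq_log_of_mem_arcCenters {s : ℕ} {θ : UnitAddCircle} (hθ : θ ∈ arcCenters s) :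
    s = Nat.log 2 (addOrderOf θ) :=
  (Nat.log_eq_of_pow_le_of_lt_pow (mem_arcCenters.1 hθ).1 (mem_arcCenters.1 hθ).2).symm

/-- Distinct centres of generation `s` are more than `4^(-(s+1))` apart, which is twice the radius.
-/
theorem arcCenters_unique {s : ℕ} {α θ θ' : UnitAddCircle} (hθ : θ ∈ arcCenters s)
    (hθ' : θ' ∈ arcCenters s) (h : ‖α - θ‖ ≤ arcRadius s) (h' : ‖α - θ'‖ ≤ arcRadius s) :
    θ = θ' := by
  by_contra hne
  have h1 := UnitAddCircle.one_le_mul_norm_sub (addOrderOf_pos_of_mem_arcCenters hθ)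
    (addOrderOf_pos_of_mem_arcCenters hθ') hne
  have h2 : ‖θ - θ'‖ ≤ 2 * arcRadius s := by
    have : θ - θ' = (α - θ') - (α - θ) := by abel
    rw [this]
    exact (norm_sub_le _ _).trans (by linarith)
  have h3 : (addOrderOf θ : ℝ) < 2 ^ (s + 1) := by exact_mod_cast (mem_arcCenters.1 hθ).2
  have h4 : (addOrderOf θ' : ℝ) < 2 ^ (s + 1) := by exact_mod_cast (mem_arcCenters.1 hθ').2
  have h5 : (0 : ℝ) < addOrderOf θ := by exact_mod_cast addOrderOf_pos_of_mem_arcCenters hθ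
  have h6 : (0 : ℝ) < addOrderOf θ' := by exact_mod_cast addOrderOf_pos_of_mem_arcCenters hθ'
  have h7 : (addOrderOf θ : ℝ) * addOrderOf θ' < 2 ^ (s + 1) * 2 ^ (s + 1) :=
    mul_lt_mul'' h3 h4 h5.le h6.le
  have h8 : (2 : ℝ) ^ (s + 1) * 2 ^ (s + 1) * (2 * arcRadius s) = 1 := by
    rw [arcRadius, one_div, inv_pow]
    field_simp
    ring
  have h9 : 0 < 2 * arcRadius s := by unfold arcRadius; positivity
  have h10 : (addOrderOf θ : ℝ) * addOrderOf θ' * ‖θ - θ'‖ ≤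
      addOrderOf θ * addOrderOf θ' * (2 * arcRadius s) := by gcongr
  have h11 := mul_lt_mul_of_pos_right h7 h9
  linarith

/-- At a given frequency, a sum over the arcs of one generation has at most one nonzero term. -/
theorem arc_sum_cases {M : Type*} [AddCommMonoid M] (s : ℕ) (α : UnitAddCircle) :
    (∀ c : UnitAddCircle → M, (∀ θ ∈ arcCenters s, c θ ≠ 0 → ‖α - θ‖ ≤ arcRadius s) →
      ∑ θ ∈ arcCenters s, c θ = 0) ∨
    ∃ θ ∈ arcCenters s, ‖α - θ‖ ≤ arcRadius s ∧
      ∀ c : UnitAddCircle → M, (∀ θ ∈ arcCenters s, c θ ≠ 0 → ‖α - θ‖ ≤ arcRadius s) →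
        ∑ θ ∈ arcCenters s, c θ = c θ := by
  by_cases hex : ∃ θ ∈ arcCenters s, ‖α - θ‖ ≤ arcRadius s
  · obtain ⟨θ, hθ, hα⟩ := hex
    refine Or.inr ⟨θ, hθ, hα, fun c hc => ?_⟩
    refine Finset.sum_eq_single_of_mem θ hθ fun b hb hne => ?_
    by_contra hcb
    exact hne (arcCenters_unique hb hθ (hc b hb hcb) hα)
  · push Not at hex
    refine Or.inl fun c hc => Finset.sum_eq_zero fun θ hθ => ?_
    by_contra hcθ
    exact absurd (hc θ hθ hcθ) (not_le.2 (hex θ hθ))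

open Classical in
/-- The main term at scale `2 ^ n` on the arcs of generation `s`. -/
noncomputable def mainMult (P : Polynomial ℤ) (n s : ℕ) (α : UnitAddCircle) : ℂ :=
  ∑ θ ∈ arcCenters s, if ‖α - θ‖ ≤ (1 / 2) ^ (n * P.natDegree) ∧ ‖α - θ‖ ≤ arcRadius s
    then gaussMult P θ else 0

/-- A function concentrated around `u = 1`. -/
noncomputable def bump (u : ℝ) : ℝ := u / (1 + u) ^ 2

theorem bump_nonneg {u : ℝ} (hu : 0 ≤ u) : 0 ≤ bump u := by unfold bump; positivity

theorem le_four_mul_bump_of_le_one {u : ℝ} (hu : 0 ≤ u) (h : u ≤ 1) : u ≤ 4 * bump u := by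
  unfold bump
  rw [← mul_div_assoc, le_div_iff₀ (by positivity)]
  nlinarith [mul_nonneg hu hu, mul_nonneg hu (mul_nonneg hu (sub_nonneg.2 h)),
    mul_nonneg hu (sub_nonneg.2 h)]

theorem inv_le_four_mul_bump_of_one_le {u : ℝ} (h : 1 ≤ u) : u⁻¹ ≤ 4 * bump u := by
  unfold bump
  rw [← mul_div_assoc, le_div_iff₀ (by positivity), inv_mul_le_iff₀ (by linarith)]
  nlinarith

/-- The sum of `bump` over a geometric progression is bounded uniformly in the starting point. -/
theorem sum_bump_le {x : ℝ} (hx : 1 < x) {u : ℝ} (hu : 0 ≤ u) (M : ℕ) :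
    ∑ n ∈ Finset.range M, bump (x ^ n * u) ≤ x / (x - 1) := by
  -- Up to a constant, `bump v` is at most the increment of `v / (1 + v)` from `v` to `x * v`, and
  -- these increments telescope.
  have hstep : ∀ v : ℝ, 0 ≤ v → bump v ≤ x / (x - 1) * (x * v / (1 + x * v) - v / (1 + v)) := by
    intro v hv
    have hx1 : 0 < x - 1 := by linarith
    have hx0 : 0 < x := by linarith
    have hxv : 0 < 1 + x * v := by positivity
    have hv1 : 0 < 1 + v := by positivity
    have e : x / (x - 1) * (x * v / (1 + x * v) - v / (1 + v)) = x * v / ((1 + x * v) * (1 + v)) := by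
      field_simp
      ring
    rw [e, bump, div_le_div_iff₀ (by positivity) (by positivity)]
    have h1 : 1 + x * v ≤ x * (1 + v) := by nlinarith
    have h2 : 0 ≤ v * (1 + v) := by positivity
    nlinarith [mul_le_mul_of_nonneg_left h1 h2]
  have hx1 : 0 ≤ x / (x - 1) := div_nonneg (by linarith) (by linarith)
  calc ∑ n ∈ Finset.range M, bump (x ^ n * u)
      ≤ ∑ n ∈ Finset.range M, x / (x - 1) *
        (x ^ (n + 1) * u / (1 + x ^ (n + 1) * u) - x ^ n * u / (1 + x ^ n * u)) := by
        refine Finset.sum_le_sum fun n _ => ?_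
        have := hstep (x ^ n * u) (by positivity)
        rw [← mul_assoc, ← pow_succ'] at this
        exact this
    _ = x / (x - 1) * (x ^ M * u / (1 + x ^ M * u) - x ^ 0 * u / (1 + x ^ 0 * u)) := by
        rw [← Finset.mul_sum, Finset.sum_range_sub (fun n => x ^ n * u / (1 + x ^ n * u))]
    _ ≤ x / (x - 1) * 1 := by
        gcongr
        have h1 : x ^ M * u / (1 + x ^ M * u) ≤ 1 := by
          rw [div_le_one (by positivity)]; linarith
        have h2 : 0 ≤ x ^ 0 * u / (1 + x ^ 0 * u) := by positivity
        linarith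
    _ = _ := mul_one _

open Classical in
/-- The weight that dominates the error of the approximation at scale `2 ^ n`. -/
noncomputable def errWeight (η : ℝ) (d S n : ℕ) (α : UnitAddCircle) : ℝ :=
  ((1 / 2 : ℝ) ^ η) ^ n + ∑ s ∈ Finset.range S, ∑ θ ∈ arcCenters s,
    if ‖α - θ‖ ≤ arcRadius s then ((1 / 2 : ℝ) ^ η) ^ s * bump ((2 ^ (n * d) * ‖α - θ‖) ^ η) else 0

theorem errWeight_term_nonneg (η : ℝ) (d n s : ℕ) (α θ : UnitAddCircle) :
    0 ≤ ((1 / 2 : ℝ) ^ η) ^ s * bump ((2 ^ (n * d) * ‖α - θ‖) ^ η) :=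
  mul_nonneg (by positivity) (bump_nonneg (by positivity))

theorem errWeight_nonneg (η : ℝ) (d S n : ℕ) (α : UnitAddCircle) : 0 ≤ errWeight η d S n α := by
  unfold errWeight
  refine add_nonneg (by positivity) (Finset.sum_nonneg fun s _ => Finset.sum_nonneg fun θ _ => ?_)
  split_ifs
  · exact errWeight_term_nonneg η d n s α θ
  · exact le_rfl

theorem pow_le_errWeight (η : ℝ) (d S n : ℕ) (α : UnitAddCircle) :
    ((1 / 2 : ℝ) ^ η) ^ n ≤ errWeight η d S n α := by
  unfold errWeight
  refine le_add_of_nonneg_right (Finset.sum_nonneg fun s _ => Finset.sum_nonneg fun θ _ => ?_)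
  split_ifs
  · exact errWeight_term_nonneg η d n s α θ
  · exact le_rfl

theorem bump_le_errWeight (η : ℝ) (d : ℕ) {S s : ℕ} (hs : s < S) (n : ℕ) {α θ : UnitAddCircle}
    (hθ : θ ∈ arcCenters s) (hα : ‖α - θ‖ ≤ arcRadius s) :
    ((1 / 2 : ℝ) ^ η) ^ s * bump ((2 ^ (n * d) * ‖α - θ‖) ^ η) ≤ errWeight η d S n α := by
  classical
  have hnn : ∀ s θ, 0 ≤ if ‖α - θ‖ ≤ arcRadius s
      then ((1 / 2 : ℝ) ^ η) ^ s * bump ((2 ^ (n * d) * ‖α - θ‖) ^ η) else 0 := by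
    intro s θ
    split_ifs
    · exact errWeight_term_nonneg η d n s α θ
    · exact le_rfl
  have h1 := Finset.single_le_sum (f := fun θ => if ‖α - θ‖ ≤ arcRadius s
      then ((1 / 2 : ℝ) ^ η) ^ s * bump ((2 ^ (n * d) * ‖α - θ‖) ^ η) else 0)
      (fun θ _ => hnn s θ) hθ
  have h2 := Finset.single_le_sum (f := fun s => ∑ θ ∈ arcCenters s, if ‖α - θ‖ ≤ arcRadius s
      then ((1 / 2 : ℝ) ^ η) ^ s * bump ((2 ^ (n * d) * ‖α - θ‖) ^ η) else 0)
      (fun s _ => Finset.sum_nonneg fun θ _ => hnn s θ) (Finset.mem_range.2 hs)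
  simp only [if_pos hα] at h1
  have h3 : (0 : ℝ) ≤ ((1 / 2 : ℝ) ^ η) ^ n := by positivity
  calc _ ≤ _ := h1
    _ ≤ _ := h2
    _ ≤ errWeight η d S n α := by
      unfold errWeight
      convert le_add_of_nonneg_left h3

theorem sum_pow_le_of_lt_one {x : ℝ} (h0 : 0 ≤ x) (h1 : x < 1) (M : ℕ) :
    ∑ n ∈ Finset.range M, x ^ n ≤ (1 - x)⁻¹ := by
  rw [← tsum_geometric_of_lt_one h0 h1]
  exact (summable_geometric_of_lt_one h0 h1).sum_le_tsum _ fun _ _ => by positivity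

theorem half_rpow_lt_one {η : ℝ} (hη : 0 < η) : (1 / 2 : ℝ) ^ η < 1 :=
  Real.rpow_lt_one (by norm_num) (by norm_num) hη

/-- At a fixed `α` each generation contributes at most one arc. On that arc the sum over `n` runs
along a geometric progression of ratio `2 ^ (d * η)`, and the remaining sum over `s` is geometric.
-/
theorem exists_sum_errWeight_le {η : ℝ} (hη : 0 < η) {d : ℕ} (hd : 1 ≤ d) :
    ∃ C : ℝ, 0 ≤ C ∧ ∀ (S M : ℕ) (α : UnitAddCircle),
      ∑ n ∈ Finset.range M, errWeight η d S n α ≤ C := by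
  classical
  set y : ℝ := (1 / 2 : ℝ) ^ η with hy
  have hy0 : 0 ≤ y := by positivity
  have hy1 : y < 1 := half_rpow_lt_one hη
  set x : ℝ := (2 ^ d : ℝ) ^ η with hx
  have hx1 : 1 < x := Real.one_lt_rpow (one_lt_pow₀ (by norm_num) (by omega)) hη
  have hxx : 0 ≤ x / (x - 1) := div_nonneg (by linarith) (by linarith)
  have hyi : 0 ≤ (1 - y)⁻¹ := inv_nonneg.2 (by linarith)
  refine ⟨(1 - y)⁻¹ + (1 - y)⁻¹ * (x / (x - 1)), by positivity, fun S M α => ?_⟩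
  unfold errWeight
  rw [Finset.sum_add_distrib, Finset.sum_comm]
  refine add_le_add (sum_pow_le_of_lt_one hy0 hy1 M) ?_
  have hgen : ∀ s ∈ Finset.range S, ∑ n ∈ Finset.range M, ∑ θ ∈ arcCenters s,
      (if ‖α - θ‖ ≤ arcRadius s then y ^ s * bump ((2 ^ (n * d) * ‖α - θ‖) ^ η) else 0) ≤
      y ^ s * (x / (x - 1)) := by
    intro s _
    rcases arc_sum_cases (M := ℝ) s α with h | ⟨θ, hθ, hα, h⟩
    · rw [Finset.sum_eq_zero fun n _ => h _ fun θ _ hne => by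
        by_contra hcon
        exact hne (if_neg hcon)]
      positivity
    · rw [Finset.sum_congr rfl fun n _ => h _ fun θ _ hne => by
        by_contra hcon
        exact hne (if_neg hcon)]
      simp only [if_pos hα]
      rw [← Finset.mul_sum]
      gcongr
      have e : ∀ n : ℕ, (2 ^ (n * d) * ‖α - θ‖) ^ η = x ^ n * ‖α - θ‖ ^ η := by
        intro n
        rw [Real.mul_rpow (by positivity) (norm_nonneg _), hx, mul_comm n d, pow_mul,
          ← Real.rpow_natCast ((2 ^ d : ℝ) ^ η), ← Real.rpow_mul (by positivity), mul_comm η,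
          Real.rpow_mul (by positivity), Real.rpow_natCast]
      simp_rw [e]
      exact sum_bump_le hx1 (by positivity) M
  refine (Finset.sum_le_sum hgen).trans ?_
  rw [← Finset.sum_mul]
  gcongr
  exact sum_pow_le_of_lt_one hy0 hy1 S

/-! ### Approximation of the multipliers on the major arcs -/

/-- `θ` is the centre of a major arc containing `α` at scale `2 ^ n`, for degree `d`. -/
def IsMajor (d n : ℕ) (α θ : UnitAddCircle) : Prop :=
  0 < addOrderOf θ ∧ addOrderOf θ < 2 ^ (n / 4) ∧ 2 ^ (n * d) * ‖α - θ‖ ≤ 2 ^ (n / 4)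

theorem IsMajor.one_le {d n : ℕ} {α θ : UnitAddCircle} (h : IsMajor d n α θ) : 1 ≤ n / 4 := by
  by_contra hcon
  have h0 : n / 4 = 0 := by omega
  have h1 := h.2.1
  have h2 := h.1
  rw [h0] at h1
  omega

/-- With `m = n / 4`, two centres would be at distance at most `2 * 2^(m - n * d)` but more than
`4^(-m)`, which is impossible since `3 * m + 1 ≤ n * d`. -/
theorem IsMajor.unique {d n : ℕ} (hd : 1 ≤ d) {α θ θ' : UnitAddCircle} (h : IsMajor d n α θ)
    (h' : IsMajor d n α θ') : θ = θ' := by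
  by_contra hne
  have hm := h.one_le
  set m := n / 4
  have h1 := UnitAddCircle.one_le_mul_norm_sub h.1 h'.1 hne
  have hq : (addOrderOf θ : ℝ) ≤ 2 ^ m := by exact_mod_cast h.2.1.le
  have hq' : (addOrderOf θ' : ℝ) < 2 ^ m := by exact_mod_cast h'.2.1
  have hq0 : (0 : ℝ) < addOrderOf θ := by exact_mod_cast h.1
  have hq0' : (0 : ℝ) < addOrderOf θ' := by exact_mod_cast h'.1
  have h2 : 2 ^ (n * d) * ‖θ - θ'‖ ≤ 2 * 2 ^ m := by
    have : θ - θ' = (α - θ') - (α - θ) := by abel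
    rw [this]
    have h3 := norm_sub_le (α - θ') (α - θ)
    have h4 : (0 : ℝ) ≤ 2 ^ (n * d) := by positivity
    nlinarith [h.2.2, h'.2.2]
  have h5 : (2 : ℝ) ^ (3 * m + 1) ≤ 2 ^ (n * d) := by
    apply pow_le_pow_right₀ (by norm_num)
    have : n ≤ n * d := Nat.le_mul_of_pos_right n hd
    omega
  have h6 : (addOrderOf θ : ℝ) * addOrderOf θ' < 2 ^ m * 2 ^ m :=
    mul_lt_mul' hq hq' hq0'.le (by positivity)
  have h7 : (2 : ℝ) ^ (n * d) ≤ addOrderOf θ * addOrderOf θ' * (2 * 2 ^ m) := by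
    calc (2 : ℝ) ^ (n * d) = 2 ^ (n * d) * 1 := by ring
      _ ≤ 2 ^ (n * d) * (addOrderOf θ * addOrderOf θ' * ‖θ - θ'‖) := by gcongr
      _ = addOrderOf θ * addOrderOf θ' * (2 ^ (n * d) * ‖θ - θ'‖) := by ring
      _ ≤ _ := by gcongr
  have h8 : (addOrderOf θ : ℝ) * addOrderOf θ' * (2 * 2 ^ m) < 2 ^ m * 2 ^ m * (2 * 2 ^ m) := by
    gcongr
  have h9 : (2 : ℝ) ^ m * 2 ^ m * (2 * 2 ^ m) = 2 ^ (3 * m + 1) := by ring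
  linarith

theorem isMajor_of_near {d n s : ℕ} (hs : s < n / 4) {α θ : UnitAddCircle} (hθ : θ ∈ arcCenters s)
    (hα : ‖α - θ‖ ≤ (1 / 2) ^ (n * d)) : IsMajor d n α θ := by
  refine ⟨addOrderOf_pos_of_mem_arcCenters hθ, ?_, ?_⟩
  · exact (mem_arcCenters.1 hθ).2.trans_le (Nat.pow_le_pow_right (by norm_num) (by omega))
  · have h1 : (2 : ℝ) ^ (n * d) * ‖α - θ‖ ≤ 2 ^ (n * d) * (1 / 2) ^ (n * d) := by gcongr
    rw [← mul_pow] at h1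
    norm_num at h1
    exact h1.trans (one_le_pow₀ (by norm_num))

theorem IsMajor.log_lt {d n : ℕ} {α θ : UnitAddCircle} (h : IsMajor d n α θ) :
    Nat.log 2 (addOrderOf θ) < n / 4 :=
  Nat.log_lt_of_lt_pow h.1.ne' h.2.1

theorem IsMajor.norm_le_arcRadius {d n : ℕ} (hd : 1 ≤ d) {α θ : UnitAddCircle}
    (h : IsMajor d n α θ) : ‖α - θ‖ ≤ arcRadius (Nat.log 2 (addOrderOf θ)) := by
  have hs := h.log_lt
  have hm := h.one_le
  set s := Nat.log 2 (addOrderOf θ)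
  set m := n / 4 with hmdef
  have h2 := h.2.2
  rw [arcRadius, one_div, inv_pow, ← one_div, le_div_iff₀ (by positivity)]
  have h3 : (2 : ℝ) ^ (m + (2 * s + 3)) ≤ 2 ^ (n * d) := by
    apply pow_le_pow_right₀ (by norm_num)
    have : n ≤ n * d := Nat.le_mul_of_pos_right n hd
    omega
  have h4 : (0 : ℝ) < 2 ^ (n * d) := by positivity
  have h5 : 2 ^ (n * d) * (‖α - θ‖ * 2 ^ (2 * s + 3)) ≤ 2 ^ (n * d) * 1 := by
    calc 2 ^ (n * d) * (‖α - θ‖ * 2 ^ (2 * s + 3)) = 2 ^ (n * d) * ‖α - θ‖ * 2 ^ (2 * s + 3) := by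
          ring
      _ ≤ 2 ^ m * 2 ^ (2 * s + 3) := by gcongr
      _ = 2 ^ (m + (2 * s + 3)) := (pow_add _ _ _).symm
      _ ≤ 2 ^ (n * d) * 1 := by rw [mul_one]; exact h3
  exact le_of_mul_le_mul_left h5 h4

theorem mainMult_eq_zero (P : Polynomial ℤ) {n s : ℕ} (hs : s < n / 4) {α : UnitAddCircle}
    (h : ∀ θ, IsMajor P.natDegree n α θ → s ≠ Nat.log 2 (addOrderOf θ)) :
    mainMult P n s α = 0 := by
  refine Finset.sum_eq_zero fun θ hθ => if_neg fun hα => ?_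
  exact h θ (isMajor_of_near hs hθ hα.1) (eq_log_of_mem_arcCenters hθ)

open Classical in
theorem mainMult_eq_of_isMajor (P : Polynomial ℤ) (hd : 1 ≤ P.natDegree) {n : ℕ}
    {α θ : UnitAddCircle} (h : IsMajor P.natDegree n α θ) :
    mainMult P n (Nat.log 2 (addOrderOf θ)) α =
      if 2 ^ (n * P.natDegree) * ‖α - θ‖ ≤ 1 then gaussMult P θ else 0 := by
  have hα := h.norm_le_arcRadius hd
  have hmem := mem_arcCenters_log h.1
  rw [mainMult, Finset.sum_eq_single_of_mem θ hmem fun b hb hne => if_neg fun hb2 =>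
    hne (arcCenters_unique hb hmem hb2.2 hα)]
  have hiff : (‖α - θ‖ ≤ (1 / 2) ^ (n * P.natDegree) ∧
      ‖α - θ‖ ≤ arcRadius (Nat.log 2 (addOrderOf θ))) ↔
      2 ^ (n * P.natDegree) * ‖α - θ‖ ≤ 1 := by
    rw [and_iff_left hα, one_div, inv_pow, ← one_div, le_div_iff₀ (by positivity), mul_comm]
  simp only [hiff]

theorem rpow_neg_addOrderOf_le {s : ℕ} {θ : UnitAddCircle} (hθ : θ ∈ arcCenters s) {δ : ℝ}
    (hδ : 0 ≤ δ) : (addOrderOf θ : ℝ) ^ (-δ) ≤ ((1 / 2 : ℝ) ^ δ) ^ s := by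
  have h1 : (2 : ℝ) ^ s ≤ addOrderOf θ := by exact_mod_cast (mem_arcCenters.1 hθ).1
  calc (addOrderOf θ : ℝ) ^ (-δ) ≤ ((2 : ℝ) ^ s) ^ (-δ) :=
        Real.rpow_le_rpow_of_nonpos (by positivity) h1 (by linarith)
    _ = ((1 / 2 : ℝ) ^ δ) ^ s := by
        rw [Real.rpow_neg (by positivity), ← Real.inv_rpow (by positivity), ← inv_pow,
          ← Real.rpow_natCast, ← Real.rpow_natCast, ← Real.rpow_mul (by positivity),
          ← Real.rpow_mul (by positivity), mul_comm δ, one_div]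

theorem norm_mainMult_le (P : Polynomial ℤ) {D δ : ℝ} (hD : 0 ≤ D) (hδ : 0 ≤ δ)
    (hS : ∀ θ : UnitAddCircle, 0 < addOrderOf θ →
      ‖gaussMult P θ‖ ≤ D * (addOrderOf θ : ℝ) ^ (-δ)) (n s : ℕ) (α : UnitAddCircle) :
    ‖mainMult P n s α‖ ≤ D * ((1 / 2 : ℝ) ^ δ) ^ s := by
  classical
  have hpos : 0 ≤ D * ((1 / 2 : ℝ) ^ δ) ^ s := by positivity
  unfold mainMult
  rcases arc_sum_cases (M := ℂ) s α with h | ⟨θ, hθ, hα, h⟩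
  · rw [h _ fun θ _ hne => by
      by_contra hcon
      exact hne (if_neg fun hh => hcon hh.2)]
    simpa using hpos
  · rw [h _ fun θ _ hne => by
      by_contra hcon
      exact hne (if_neg fun hh => hcon hh.2)]
    split_ifs
    · refine (hS θ (addOrderOf_pos_of_mem_arcCenters hθ)).trans ?_
      gcongr
      exact rpow_neg_addOrderOf_le hθ hδ
    · simpa using hpos

/-- Generations `s ≥ n / 4` are not separated at scale `2 ^ n`, but the decay of the Gauss sums
makes their total contribution a geometric tail. -/
theorem norm_sum_sub_le_of_tail {L : ℕ → ℂ} {v : ℂ} {m S : ℕ} (hmS : m ≤ S) {D y : ℝ}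
    (hD : 0 ≤ D) (hy0 : 0 ≤ y) (hy1 : y < 1) (hv : ∑ s ∈ Finset.range m, L s = v)
    (hL : ∀ s, ‖L s‖ ≤ D * y ^ s) :
    ‖∑ s ∈ Finset.range S, L s - v‖ ≤ D * (1 - y)⁻¹ * y ^ m := by
  rw [← Finset.sum_range_add_sum_Ico L hmS, hv, add_sub_cancel_left]
  refine (norm_sum_le _ _).trans ((Finset.sum_le_sum fun s _ => hL s).trans ?_)
  rw [Finset.sum_Ico_eq_sum_range]
  simp_rw [pow_add]
  have e : ∀ k, D * (y ^ m * y ^ k) = D * y ^ m * y ^ k := fun k => by ring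
  simp_rw [e]
  rw [← Finset.mul_sum]
  calc D * y ^ m * ∑ k ∈ Finset.range (S - m), y ^ k ≤ D * y ^ m * (1 - y)⁻¹ := by
        gcongr
        exact sum_pow_le_of_lt_one hy0 hy1 _
    _ = _ := by ring

theorem sqrt_half_rpow_pow_le {δ : ℝ} (hδ0 : 0 ≤ δ) (hδ1 : δ ≤ 1) (n : ℕ) :
    √(((1 / 2 : ℝ) ^ δ) ^ (n / 4)) ≤ 2 * ((1 / 2 : ℝ) ^ (δ / 8)) ^ n := by
  have h4 : n ≤ 4 * (n / 4) + 3 := by omega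
  have h4R : (n : ℝ) ≤ 4 * (n / 4 : ℕ) + 3 := by exact_mod_cast h4
  have e1 : √(((1 / 2 : ℝ) ^ δ) ^ (n / 4)) = (1 / 2 : ℝ) ^ (δ * (n / 4 : ℕ) * (1 / 2)) := by
    rw [Real.sqrt_eq_rpow, ← Real.rpow_natCast, ← Real.rpow_mul (by positivity),
      ← Real.rpow_mul (by norm_num), mul_assoc]
  have e2 : 2 * ((1 / 2 : ℝ) ^ (δ / 8)) ^ n = (1 / 2 : ℝ) ^ (-1 + δ / 8 * n) := by
    rw [Real.rpow_add (by norm_num), ← Real.rpow_natCast, ← Real.rpow_mul (by norm_num),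
      Real.rpow_neg_one]
    norm_num
  rw [e1, e2]
  apply Real.rpow_le_rpow_of_exponent_ge (by norm_num) (by norm_num)
  nlinarith

theorem sqrt_le_of_le_sq_add {E K z y : ℝ} (hK : 0 ≤ K) (hz : 0 ≤ z) (hy : 0 ≤ y)
    (h : E ≤ K * (z ^ 2 + y)) : √E ≤ √K * (z + √y) := by
  rw [← Real.sqrt_sq (add_nonneg hz (Real.sqrt_nonneg y)), ← Real.sqrt_mul hK]
  apply Real.sqrt_le_sqrt
  refine h.trans ?_
  gcongr
  have := Real.sq_sqrt hy
  nlinarith [mul_nonneg hz (Real.sqrt_nonneg y)]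

/-- Interpolation between decay in `q` and in `t`, for `t ≥ 1`. -/
theorem max_rpow_neg_le_sq {δ q t : ℝ} (hδ : 0 ≤ δ) (hq : 1 ≤ q) (ht : 1 ≤ t) :
    max q t ^ (-δ) ≤ (q ^ (-(δ / 8)) * (t ^ (δ / 8))⁻¹) ^ 2 := by
  have hq0 : 0 < q := by linarith
  have ht0 : 0 < t := by linarith
  have hm0 : 0 < max q t := lt_max_of_lt_left hq0
  rw [← Real.rpow_neg ht0.le, ← Real.mul_rpow hq0.le ht0.le, ← Real.rpow_natCast,
    ← Real.rpow_mul (by positivity)]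
  have h1 : max q t ^ (-δ) = (max q t ^ (2 : ℝ)) ^ (-(δ / 2)) := by
    rw [← Real.rpow_mul hm0.le]; congr 1; ring
  have h2 : q * t ≤ max q t ^ (2 : ℝ) := by
    rw [Real.rpow_two, sq]
    exact mul_le_mul (le_max_left _ _) (le_max_right _ _) ht0.le hm0.le
  rw [h1]
  calc (max q t ^ (2 : ℝ)) ^ (-(δ / 2)) ≤ (q * t) ^ (-(δ / 2)) :=
        Real.rpow_le_rpow_of_nonpos (by positivity) h2 (by linarith)
    _ ≤ (q * t) ^ (-(δ / 8) * ((2 : ℕ) : ℝ)) := by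
        apply Real.rpow_le_rpow_of_exponent_le (by nlinarith)
        push_cast
        linarith

/-- Interpolation between decay in `q` and in `t`, for `t ≤ 1`. -/
theorem sqrt_mul_rpow_neg_le_sq {δ q t : ℝ} (hδ : 0 < δ) (hδ1 : δ ≤ 1) (hq : 1 ≤ q) (ht0 : 0 ≤ t)
    (ht : t ≤ 1) : √(t * q ^ (-δ)) ≤ (q ^ (-(δ / 8)) * t ^ (δ / 8)) ^ 2 := by
  have hq0 : 0 < q := by linarith
  rcases ht0.eq_or_lt' with h0 | htp
  · rw [h0]
    simp
    positivity
  have e : (q ^ (-(δ / 8)) * t ^ (δ / 8)) ^ 2 = t ^ (δ / 4) * q ^ (-(δ / 4)) := by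
    rw [mul_pow, ← Real.rpow_natCast, ← Real.rpow_natCast, ← Real.rpow_mul hq0.le,
      ← Real.rpow_mul ht0, mul_comm]
    congr 2 <;> (push_cast; ring)
  rw [e, Real.sqrt_mul ht0, Real.sqrt_eq_rpow, Real.sqrt_eq_rpow, ← Real.rpow_mul hq0.le]
  have h1 : t ^ (1 / 2 : ℝ) ≤ t ^ (δ / 4) :=
    Real.rpow_le_rpow_of_exponent_ge htp ht (by linarith)
  have h2 : q ^ (-δ * (1 / 2)) ≤ q ^ (-(δ / 4)) :=
    Real.rpow_le_rpow_of_exponent_le hq (by linarith)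
  gcongr

theorem le_sqrt_mul_add {E a b c e : ℝ} (ha : 0 ≤ a) (hc : 0 ≤ c) (hb : 0 ≤ b) (he : 0 ≤ e)
    (h1 : E ≤ a + b) (h2 : E ≤ c + e) : E ≤ √(a * c) + b + e := by
  rcases le_total a c with h | h
  · have : a ≤ √(a * c) := Real.le_sqrt_of_sq_le (by nlinarith)
    linarith
  · have : c ≤ √(a * c) := Real.le_sqrt_of_sq_le (by nlinarith)
    linarith

/-- On the block `[2 ^ n, 2 ^ (n + 1)]` the multipliers agree with the sum of the main terms up to
an error dominated by the summable weight `errWeight`. -/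
theorem exists_sqrt_norm_polyMult_sub_le (P : Polynomial ℤ) (hd : 1 ≤ P.natDegree) {D δ : ℝ}
    (hD : 0 ≤ D) (hδ0 : 0 < δ) (hδ1 : δ ≤ 1)
    (hm : ∀ (N : ℕ) (α : UnitAddCircle), 1 ≤ N → ∃ θ : UnitAddCircle, 0 < addOrderOf θ ∧
      ‖polyMult P N α‖ ≤ D * (max (addOrderOf θ : ℝ) (N ^ P.natDegree * ‖α - θ‖)) ^ (-δ))
    (hS : ∀ θ : UnitAddCircle, 0 < addOrderOf θ →
      ‖gaussMult P θ‖ ≤ D * (addOrderOf θ : ℝ) ^ (-δ)) :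
    ∃ C : ℝ, 0 ≤ C ∧ ∀ (n S N : ℕ) (α : UnitAddCircle), n ≤ S → 2 ^ n ≤ N → N ≤ 2 ^ (n + 1) →
      √‖polyMult P N α - ∑ s ∈ Finset.range S, mainMult P n s α‖ ≤
        C * errWeight (δ / 8) P.natDegree S n α := by
  classical
  obtain ⟨A, hA, hlip⟩ := exists_polyMult_lipschitz P
  set d := P.natDegree with hddef
  set y : ℝ := (1 / 2 : ℝ) ^ δ with hy
  have hy0 : 0 ≤ y := by positivity
  have hy1 : y < 1 := half_rpow_lt_one hδ0
  have hyi : 0 ≤ (1 - y)⁻¹ := inv_nonneg.2 (by linarith)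
  set A' : ℝ := √(A * 2 ^ d * (2 * D)) with hA'
  set K : ℝ := D + D + D * (1 - y)⁻¹ + A' + 2 with hK
  have hA'0 : 0 ≤ A' := Real.sqrt_nonneg _
  have hDy : 0 ≤ D * (1 - y)⁻¹ := by positivity
  have hK0 : 0 ≤ K := by positivity
  -- The factor `6 = 4 + 2` comes from `z ≤ 4 * errWeight` for the arc term and `√(y ^ m) ≤ 2 *
  -- errWeight` for the minor terms.
  refine ⟨√K * 6, by positivity, fun n S N α hnS hN1 hN2 => ?_⟩
  set m := n / 4 with hmdef
  have hN : 1 ≤ N := le_trans Nat.one_le_two_pow hN1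
  have hN1R : (2 : ℝ) ^ n ≤ N := by exact_mod_cast hN1
  have hN2R : (N : ℝ) ≤ 2 ^ (n + 1) := by exact_mod_cast hN2
  have hNd1 : (2 : ℝ) ^ (n * d) ≤ (N : ℝ) ^ d := by
    rw [pow_mul]; gcongr
  have hNd2 : (N : ℝ) ^ d ≤ 2 ^ d * 2 ^ (n * d) := by
    calc (N : ℝ) ^ d ≤ (2 ^ (n + 1)) ^ d := by gcongr
      _ = _ := by ring
  have hym : 0 ≤ y ^ m := by positivity
  have hLb := fun s => norm_mainMult_le P hD hδ0.le hS n s α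
  have hW0 := errWeight_nonneg (δ / 8) d S n α
  have hWn := pow_le_errWeight (δ / 8) d S n α
  have hsq := sqrt_half_rpow_pow_le hδ0.le hδ1 n
  -- at a torsion point that is not major, the multiplier is small
  have hminor : ∀ θ, 0 < addOrderOf θ → ¬ IsMajor d n α θ →
      (max (addOrderOf θ : ℝ) (N ^ d * ‖α - θ‖)) ^ (-δ) ≤ y ^ m := by
    intro θ hθ hnot
    have hbig : (2 : ℝ) ^ m ≤ max (addOrderOf θ : ℝ) (N ^ d * ‖α - θ‖) := by
      by_contra hcon
      push Not at hcon
      obtain ⟨h1, h2⟩ := max_lt_iff.1 hcon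
      refine hnot ⟨hθ, by exact_mod_cast h1, le_trans ?_ h2.le⟩
      gcongr
    calc (max (addOrderOf θ : ℝ) (N ^ d * ‖α - θ‖)) ^ (-δ) ≤ ((2 : ℝ) ^ m) ^ (-δ) :=
          Real.rpow_le_rpow_of_nonpos (by positivity) hbig (by linarith)
      _ = y ^ m := by
          rw [Real.rpow_neg (by positivity), ← Real.inv_rpow (by positivity), ← inv_pow, hy,
            ← Real.rpow_natCast, ← Real.rpow_natCast, ← Real.rpow_mul (by positivity),
            ← Real.rpow_mul (by positivity), mul_comm δ, one_div]
  by_cases hex : ∃ θ, IsMajor d n α θ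
  · obtain ⟨θ, hθ⟩ := hex
    set s := Nat.log 2 (addOrderOf θ) with hs
    have hsm : s < m := hθ.log_lt
    have hm1 : 1 ≤ m := hθ.one_le
    have hθs : θ ∈ arcCenters s := mem_arcCenters_log hθ.1
    have hαr := hθ.norm_le_arcRadius hd
    set q : ℝ := (addOrderOf θ : ℝ) with hq
    have hq1 : 1 ≤ q := by rw [hq]; exact_mod_cast hθ.1
    set t : ℝ := 2 ^ (n * d) * ‖α - θ‖ with ht
    have ht0 : 0 ≤ t := by positivity
    have hNt : t ≤ (N : ℝ) ^ d * ‖α - θ‖ := by rw [ht]; gcongr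
    -- the bound for the multiplier itself
    have hmN : ‖polyMult P N α‖ ≤ D * max q t ^ (-δ) + D * y ^ m := by
      obtain ⟨θ', hθ', hb⟩ := hm N α hN
      by_cases hmaj : IsMajor d n α θ'
      · have : θ' = θ := hmaj.unique hd hθ
        rw [this] at hb
        have h1 : (max q (N ^ d * ‖α - θ‖)) ^ (-δ) ≤ max q t ^ (-δ) :=
          Real.rpow_le_rpow_of_nonpos (lt_max_of_lt_left (by linarith))
            (max_le_max le_rfl hNt) (by linarith)
        have h2 := mul_le_mul_of_nonneg_left h1 hD
        have h3 : 0 ≤ D * y ^ m := by positivity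
        linarith
      · have h1 := mul_le_mul_of_nonneg_left (hminor θ' hθ' hmaj) hD
        have h3 : 0 ≤ D * max q t ^ (-δ) := by positivity
        linarith
    set v : ℂ := if t ≤ 1 then gaussMult P θ else 0 with hv
    have hsum : ∑ s' ∈ Finset.range m, mainMult P n s' α = v := by
      rw [Finset.sum_eq_single_of_mem s (Finset.mem_range.2 hsm)]
      · exact mainMult_eq_of_isMajor P hd hθ
      · intro b hb hne
        refine mainMult_eq_zero P (Finset.mem_range.1 hb) fun θ' hθ' => ?_
        rw [hθ'.unique hd hθ]
        exact hne
    have htail := norm_sum_sub_le_of_tail (by omega : m ≤ S) hD hy0 hy1 hsum hLb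
    set z : ℝ := ((1 / 2 : ℝ) ^ (δ / 8)) ^ s * (4 * bump (t ^ (δ / 8))) with hz
    have hz0 : 0 ≤ z := mul_nonneg (by positivity)
      (mul_nonneg (by norm_num) (bump_nonneg (by positivity)))
    have hqs : q ^ (-(δ / 8)) ≤ ((1 / 2 : ℝ) ^ (δ / 8)) ^ s :=
      rpow_neg_addOrderOf_le hθs (by linarith)
    -- For `t ≤ 1` the error has a bound linear in `t` and one decaying in `q`, and their geometric
    -- mean decays in both. For `t > 1` the Weyl bound decays in `max q t`. Either way the bound
    -- carries a power of `q` and of `min t t⁻¹`, as `z ^ 2` requires.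
    have hmain : ‖polyMult P N α - v‖ ≤ (D + A') * z ^ 2 + (D + 2) * y ^ m := by
      rcases le_or_gt t 1 with ht1 | ht1
      · rw [hv, if_pos ht1]
        have hz2 : √(t * q ^ (-δ)) ≤ z ^ 2 := by
          refine (sqrt_mul_rpow_neg_le_sq hδ0 hδ1 hq1 ht0 ht1).trans ?_
          rw [hz]
          gcongr
          exact le_four_mul_bump_of_le_one (by positivity)
            (Real.rpow_le_one ht0 ht1 (by linarith))
        have h1 : ‖polyMult P N α - gaussMult P θ‖ ≤ A * 2 ^ d * t + 2 * y ^ m := by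
          have a1 := hlip N α θ hN
          have a2 := norm_polyMult_sub_gaussMult_le P hθ.1 hN
          have a3 : ‖polyMult P N α - gaussMult P θ‖ ≤ ‖polyMult P N α - polyMult P N θ‖ +
              ‖polyMult P N θ - gaussMult P θ‖ := norm_sub_le_norm_sub_add_norm_sub _ _ _
          have a4 : A * ((N : ℝ) ^ d * ‖α - θ‖) ≤ A * 2 ^ d * t := by
            rw [ht]
            calc A * ((N : ℝ) ^ d * ‖α - θ‖) ≤ A * (2 ^ d * 2 ^ (n * d) * ‖α - θ‖) := by gcongr
              _ = _ := by ring
          have a5 : 2 * (addOrderOf θ : ℝ) / N ≤ 2 * y ^ m := by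
            have b1 : (addOrderOf θ : ℝ) ≤ 2 ^ m := by exact_mod_cast hθ.2.1.le
            have b2 : (1 / 2 : ℝ) ≤ y := by
              rw [hy]
              calc (1 / 2 : ℝ) = (1 / 2 : ℝ) ^ (1 : ℝ) := by simp
                _ ≤ _ := Real.rpow_le_rpow_of_exponent_ge (by norm_num) (by norm_num) hδ1
            have b3 : (1 / 2 : ℝ) ^ m ≤ y ^ m := by gcongr
            have b4 : (addOrderOf θ : ℝ) / N ≤ (1 / 2 : ℝ) ^ m := by
              rw [div_le_iff₀ (by positivity)]
              calc (addOrderOf θ : ℝ) ≤ 2 ^ m := b1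
                _ = (1 / 2 : ℝ) ^ m * 2 ^ (2 * m) := by
                    rw [pow_mul, ← mul_pow]; norm_num
                _ ≤ (1 / 2 : ℝ) ^ m * 2 ^ n := by
                    gcongr
                    · norm_num
                    · omega
                _ ≤ _ := by gcongr
            calc 2 * (addOrderOf θ : ℝ) / N = 2 * (addOrderOf θ / N) := by ring
              _ ≤ _ := by linarith
          linarith
        have h2 : ‖polyMult P N α - gaussMult P θ‖ ≤ 2 * D * q ^ (-δ) + D * y ^ m := by
          have a1 := norm_sub_le (polyMult P N α) (gaussMult P θ)
          have a2 := hS θ hθ.1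
          have a3 : max q t ^ (-δ) ≤ q ^ (-δ) :=
            Real.rpow_le_rpow_of_nonpos (by linarith) (le_max_left _ _) (by linarith)
          have a4 := mul_le_mul_of_nonneg_left a3 hD
          linarith
        have h3 := le_sqrt_mul_add (by positivity) (by positivity) (by positivity) (by positivity)
          h1 h2
        have h4 : √(A * 2 ^ d * t * (2 * D * q ^ (-δ))) ≤ A' * z ^ 2 := by
          rw [show A * 2 ^ d * t * (2 * D * q ^ (-δ)) = A * 2 ^ d * (2 * D) * (t * q ^ (-δ)) by ring,
            Real.sqrt_mul (by positivity)]
          gcongr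
        have h5 : 0 ≤ D * z ^ 2 := by positivity
        linarith
      · rw [hv, if_neg (not_le.2 ht1), sub_zero]
        have hz2 : max q t ^ (-δ) ≤ z ^ 2 := by
          refine (max_rpow_neg_le_sq hδ0.le hq1 ht1.le).trans ?_
          rw [hz]
          gcongr
          exact inv_le_four_mul_bump_of_one_le (Real.one_le_rpow ht1.le (by linarith))
        have h1 := mul_le_mul_of_nonneg_left hz2 hD
        have h2 : 0 ≤ A' * z ^ 2 := by positivity
        linarith
    have hE : ‖polyMult P N α - ∑ s ∈ Finset.range S, mainMult P n s α‖ ≤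
        K * (z ^ 2 + y ^ m) := by
      have h1 : ‖polyMult P N α - ∑ s ∈ Finset.range S, mainMult P n s α‖ ≤
          ‖polyMult P N α - v‖ + ‖∑ s ∈ Finset.range S, mainMult P n s α - v‖ := by
        rw [norm_sub_rev (∑ s ∈ Finset.range S, mainMult P n s α) v]
        exact norm_sub_le_norm_sub_add_norm_sub _ _ _
      have h2 : K * (z ^ 2 + y ^ m) = (D + A') * z ^ 2 + (D + 2) * y ^ m +
          D * (1 - y)⁻¹ * y ^ m + ((D + D * (1 - y)⁻¹ + 2) * z ^ 2 + (D + A') * y ^ m) := by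
        rw [hK]; ring
      have h3 : 0 ≤ (D + D * (1 - y)⁻¹ + 2) * z ^ 2 + (D + A') * y ^ m := by positivity
      linarith
    have hfin := sqrt_le_of_le_sq_add hK0 hz0 hym hE
    have hzW : z ≤ 4 * errWeight (δ / 8) d S n α := by
      have := bump_le_errWeight (δ / 8) d (by omega : s < S) n hθs hαr
      rw [hz, ht]
      linarith
    calc _ ≤ _ := hfin
      _ ≤ √K * (4 * errWeight (δ / 8) d S n α + 2 * errWeight (δ / 8) d S n α) := by
          gcongr
          linarith
      _ = _ := by ring
  · push Not at hex
    have hsum : ∑ s' ∈ Finset.range m, mainMult P n s' α = 0 :=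
      Finset.sum_eq_zero fun s' hs' =>
        mainMult_eq_zero P (Finset.mem_range.1 hs') fun θ hθ => absurd hθ (hex θ)
    have htail := norm_sum_sub_le_of_tail (by omega : m ≤ S) hD hy0 hy1 hsum hLb
    rw [sub_zero] at htail
    obtain ⟨θ', hθ', hb⟩ := hm N α hN
    have h1 := mul_le_mul_of_nonneg_left (hminor θ' hθ' (hex θ')) hD
    have hE : ‖polyMult P N α - ∑ s ∈ Finset.range S, mainMult P n s α‖ ≤
        K * ((0 : ℝ) ^ 2 + y ^ m) := by
      have h2 := norm_sub_le (polyMult P N α) (∑ s ∈ Finset.range S, mainMult P n s α)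
      have h3 : K * ((0 : ℝ) ^ 2 + y ^ m) = D * y ^ m + D * (1 - y)⁻¹ * y ^ m +
          (D + A' + 2) * y ^ m := by rw [hK]; ring
      have h4 : 0 ≤ (D + A' + 2) * y ^ m := by positivity
      linarith
    have hfin := sqrt_le_of_le_sq_add hK0 le_rfl hym hE
    calc _ ≤ _ := hfin
      _ ≤ √K * (4 * errWeight (δ / 8) d S n α + 2 * errWeight (δ / 8) d S n α) := by
          gcongr
          · linarith
          · linarith
      _ = _ := by ring

/-! ### Fourier multipliers on `ℓ²(ℤ)` -/

open MeasureTheory AddCircle in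
-- Parseval's identity for a function rather than its class in `L²`: Fourier coefficients and
-- integrals do not see null sets.
theorem tsum_enorm_fourierCoeff_sq {H : UnitAddCircle → ℂ} (hH : MemLp H 2 haarAddCircle) :
    ∑' x, ‖fourierCoeff H x‖ₑ ^ (2 : ℝ) = ∫⁻ α, ‖H α‖ₑ ^ (2 : ℝ) ∂haarAddCircle := by
  have hae : hH.toLp H =ᵐ[haarAddCircle] H := hH.coeFn_toLp
  have hco : ∀ x, fourierCoeff (hH.toLp H) x = fourierCoeff H x := fun x => by
    unfold fourierCoeff
    refine integral_congr_ae ?_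
    filter_upwards [hae] with α hα
    rw [hα]
  have h1 := tsum_sq_fourierCoeff (hH.toLp H)
  simp_rw [hco] at h1
  have h2 : ∫ t, ‖hH.toLp H t‖ ^ 2 ∂haarAddCircle = ∫ t, ‖H t‖ ^ 2 ∂haarAddCircle := by
    refine integral_congr_ae ?_
    filter_upwards [hae] with α hα
    rw [hα]
  rw [h2] at h1
  have hsum : Summable fun x => ‖fourierCoeff H x‖ ^ 2 := by
    have := (lp.memℓp (fourierBasis.repr (hH.toLp H))).summable (by norm_num)
    simp_rw [fourierBasis_repr, hco] at this
    simpa using this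
  have hsq_int : Integrable (fun t => ‖H t‖ ^ 2) haarAddCircle := by
    have := hH.integrable_norm_rpow (by norm_num) (by norm_num)
    simpa using this
  have e : ∀ z : ℂ, ‖z‖ₑ ^ (2 : ℝ) = ENNReal.ofReal (‖z‖ ^ 2) := fun z => by
    rw [enorm_rpow_eq_ofReal _ (by norm_num), Real.rpow_two]
  simp_rw [e]
  rw [← ENNReal.ofReal_tsum_of_nonneg (fun _ => by positivity) hsum, h1,
    ofReal_integral_eq_lintegral_ofReal hsq_int (Filter.Eventually.of_forall fun _ => by positivity)]

/-- Bounded measurable functions on the circle. -/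
def IsMultiplier (m : UnitAddCircle → ℂ) : Prop := Measurable m ∧ ∃ B : ℝ, ∀ α, ‖m α‖ ≤ B

/-- The operator with Fourier multiplier `m`, applied to the sequence of Fourier coefficients
of `F`. -/
noncomputable def multOp (m F : UnitAddCircle → ℂ) (x : ℤ) : ℂ := fourierCoeff (fun α => m α * F α) x

theorem IsMultiplier.memLp {m F : UnitAddCircle → ℂ} (hm : IsMultiplier m)
    (hF : MeasureTheory.MemLp F 2 AddCircle.haarAddCircle) :
    MeasureTheory.MemLp (fun α => m α * F α) 2 AddCircle.haarAddCircle := by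
  obtain ⟨hm1, B, hB⟩ := hm
  refine MeasureTheory.MemLp.of_le_mul (c := B) hF
    (hm1.aestronglyMeasurable.mul hF.aestronglyMeasurable) ?_
  refine Filter.Eventually.of_forall fun α => ?_
  rw [norm_mul]
  exact mul_le_mul_of_nonneg_right (hB α) (norm_nonneg _)

theorem IsMultiplier.integrable {m F : UnitAddCircle → ℂ} (hm : IsMultiplier m)
    (hF : MeasureTheory.MemLp F 2 AddCircle.haarAddCircle) :
    MeasureTheory.Integrable (fun α => m α * F α) AddCircle.haarAddCircle :=
  (hm.memLp hF).integrable (by norm_num)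

theorem isMultiplier_const (c : ℂ) : IsMultiplier fun _ => c :=
  ⟨measurable_const, ‖c‖, fun _ => le_rfl⟩

theorem IsMultiplier.mul {m m' : UnitAddCircle → ℂ} (hm : IsMultiplier m) (hm' : IsMultiplier m') :
    IsMultiplier fun α => m α * m' α := by
  obtain ⟨h1, B, hB⟩ := hm
  obtain ⟨h1', B', hB'⟩ := hm'
  refine ⟨h1.mul h1', B * B', fun α => ?_⟩
  rw [norm_mul]
  exact mul_le_mul (hB α) (hB' α) (norm_nonneg _) ((norm_nonneg _).trans (hB α))

theorem IsMultiplier.sub {m m' : UnitAddCircle → ℂ} (hm : IsMultiplier m) (hm' : IsMultiplier m') :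
    IsMultiplier fun α => m α - m' α := by
  obtain ⟨h1, B, hB⟩ := hm
  obtain ⟨h1', B', hB'⟩ := hm'
  exact ⟨h1.sub h1', B + B', fun α => (norm_sub_le _ _).trans (add_le_add (hB α) (hB' α))⟩

theorem IsMultiplier.sum {ι : Type*} (s : Finset ι) {m : ι → UnitAddCircle → ℂ}
    (hm : ∀ i ∈ s, IsMultiplier (m i)) : IsMultiplier fun α => ∑ i ∈ s, m i α := by
  choose! h1 B hB using hm
  exact ⟨Finset.measurable_sum s h1, ∑ i ∈ s, B i, fun α =>
    (norm_sum_le _ _).trans (Finset.sum_le_sum fun i hi => hB i hi α)⟩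

theorem circleChar_zsmul_eq_fourier (k : ℤ) (α : UnitAddCircle) :
    circleChar (k • α) = fourier k α := by
  rw [fourier_apply]; rfl

theorem isMultiplier_circleChar (k : ℤ) : IsMultiplier fun α => circleChar (k • α) := by
  refine ⟨?_, 1, fun α => (norm_circleChar _).le⟩
  simp_rw [circleChar_zsmul_eq_fourier]
  exact (fourier k).continuous.measurable

open Classical in
theorem isMultiplier_ite_norm (θ : UnitAddCircle) (r : ℝ) (c : ℂ) :
    IsMultiplier fun α => if ‖α - θ‖ ≤ r then c else 0 := by
  refine ⟨Measurable.ite ?_ measurable_const measurable_const, ‖c‖, fun α => ?_⟩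
  · have : Continuous fun α : UnitAddCircle => ‖α - θ‖ := by fun_prop
    exact measurableSet_le this.measurable measurable_const
  · dsimp only
    split_ifs
    · exact le_rfl
    · simp

theorem multOp_const_mul (c : ℂ) (m F : UnitAddCircle → ℂ) (x : ℤ) :
    multOp (fun α => c * m α) F x = c * multOp m F x := by
  unfold multOp
  rw [← fourierCoeff.const_mul]
  congr 1
  funext α
  ring

theorem multOp_sub {m m' F : UnitAddCircle → ℂ} (hm : IsMultiplier m) (hm' : IsMultiplier m')
    (hF : MeasureTheory.MemLp F 2 AddCircle.haarAddCircle) (x : ℤ) :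
    multOp (fun α => m α - m' α) F x = multOp m F x - multOp m' F x := by
  have h := congrFun (fourierCoeff.add (hm.integrable hF)
    (((isMultiplier_const (-1)).mul hm').integrable hF)) x
  have h2 := multOp_const_mul (-1) m' F x
  unfold multOp at h2 ⊢
  rw [Pi.add_apply, h2] at h
  rw [sub_eq_add_neg, ← neg_one_mul (fourierCoeff _ x), ← h]
  congr 1
  funext α
  rw [Pi.add_apply]
  ring

theorem multOp_sum {ι : Type*} (s : Finset ι) {m : ι → UnitAddCircle → ℂ} {F : UnitAddCircle → ℂ}
    (hm : ∀ i ∈ s, IsMultiplier (m i))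
    (hF : MeasureTheory.MemLp F 2 AddCircle.haarAddCircle) (x : ℤ) :
    multOp (fun α => ∑ i ∈ s, m i α) F x = ∑ i ∈ s, multOp (m i) F x := by
  have h := congrFun (fourierCoeff.sum s (fun i α => m i α * F α)
    fun i hi => (hm i hi).integrable hF) x
  unfold multOp
  simp only [Finset.sum_apply] at h
  rw [← h]
  congr 1
  funext α
  rw [Finset.sum_mul]
  simp

theorem multOp_mul (m m' F : UnitAddCircle → ℂ) (x : ℤ) :
    multOp (fun α => m α * m' α) F x = multOp m (fun α => m' α * F α) x := by
  unfold multOp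
  congr 1
  funext α
  ring

theorem multOp_circleChar (k : ℤ) (F : UnitAddCircle → ℂ) (x : ℤ) :
    multOp (fun α => circleChar (-k • α)) F x = fourierCoeff F (x + k) := by
  unfold multOp fourierCoeff
  congr 1
  funext α
  dsimp only
  rw [circleChar_zsmul_eq_fourier, smul_eq_mul, smul_eq_mul, neg_add, fourier_add]
  ring

/-- The square function estimate given by Plancherel's theorem. -/
theorem tsum_sum_multOp_sq_le {ι : Type*} (A : Finset ι) {m : ι → UnitAddCircle → ℂ}
    {F : UnitAddCircle → ℂ} (hm : ∀ i ∈ A, IsMultiplier (m i))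
    (hF : MeasureTheory.MemLp F 2 AddCircle.haarAddCircle) {B : ℝ}
    (hB : ∀ α, ∑ i ∈ A, ‖m i α‖ ^ 2 ≤ B) :
    ∑' x, ∑ i ∈ A, ‖multOp (m i) F x‖ₑ ^ (2 : ℝ) ≤
      ENNReal.ofReal B * l2Norm (fun x => ‖fourierCoeff F x‖ₑ) ^ (2 : ℝ) := by
  rw [Summable.tsum_finsetSum fun _ _ => ENNReal.summable, l2Norm_sq, tsum_enorm_fourierCoeff_sq hF]
  have h1 : ∀ i ∈ A, ∑' x, ‖multOp (m i) F x‖ₑ ^ (2 : ℝ) =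
      ∫⁻ α, ‖m i α * F α‖ₑ ^ (2 : ℝ) ∂AddCircle.haarAddCircle := fun i hi =>
    tsum_enorm_fourierCoeff_sq ((hm i hi).memLp hF)
  rw [Finset.sum_congr rfl h1, ← MeasureTheory.lintegral_finsetSum' A fun i hi =>
    (((hm i hi).memLp hF).aestronglyMeasurable.enorm.pow_const _),
    ← MeasureTheory.lintegral_const_mul' _ _ ENNReal.ofReal_ne_top]
  refine MeasureTheory.lintegral_mono fun α => ?_
  calc ∑ i ∈ A, ‖m i α * F α‖ₑ ^ (2 : ℝ)
      = (∑ i ∈ A, ENNReal.ofReal (‖m i α‖ ^ 2)) * ‖F α‖ₑ ^ (2 : ℝ) := by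
        rw [Finset.sum_mul]
        refine Finset.sum_congr rfl fun i _ => ?_
        rw [enorm_mul, ENNReal.mul_rpow_of_nonneg _ _ (by norm_num),
          enorm_rpow_eq_ofReal (m i α) (by norm_num), Real.rpow_two]
    _ ≤ _ := by
        rw [← ENNReal.ofReal_sum_of_nonneg fun _ _ => by positivity]
        gcongr
        exact hB α

theorem exists_fourierCoeff_eq (f : lp (fun _ : ℤ => ℂ) 2) :
    ∃ F : UnitAddCircle → ℂ, MeasureTheory.MemLp F 2 AddCircle.haarAddCircle ∧
      ∀ x, fourierCoeff F x = f x := by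
  refine ⟨fourierBasis.repr.symm f, MeasureTheory.Lp.memLp _, fun x => ?_⟩
  rw [← fourierBasis_repr, LinearIsometryEquiv.apply_symm_apply]

theorem l2Norm_enorm_eq (f : lp (fun _ : ℤ => ℂ) 2) : l2Norm (fun x => ‖f x‖ₑ) = ‖f‖ₑ := by
  have h := lp.norm_eq_tsum_rpow (p := 2) (by norm_num) f
  have hsum := (lp.memℓp f).summable (by norm_num)
  simp only [ENNReal.toReal_ofNat] at h hsum
  unfold l2Norm
  simp_rw [enorm_rpow_eq_ofReal _ (by norm_num : (0 : ℝ) ≤ 2)]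
  rw [← ENNReal.ofReal_tsum_of_nonneg (fun _ => by positivity) hsum,
    ENNReal.ofReal_rpow_of_nonneg (tsum_nonneg fun _ => by positivity) (by norm_num), ← h,
    ofReal_norm]

theorem isMultiplier_polyMult (P : Polynomial ℤ) (N : ℕ) : IsMultiplier (polyMult P N) :=
  (isMultiplier_const _).mul (IsMultiplier.sum _ fun _ _ => isMultiplier_circleChar _)

theorem multOp_polyMult (P : Polynomial ℤ) (N : ℕ) {F : UnitAddCircle → ℂ}
    (hF : MeasureTheory.MemLp F 2 AddCircle.haarAddCircle) (x : ℤ) :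
    multOp (polyMult P N) F x =
      (1 / (N : ℂ)) * ∑ n ∈ Finset.Icc 1 N, fourierCoeff F (x + P.eval (n : ℤ)) := by
  unfold polyMult
  rw [multOp_const_mul, multOp_sum _ (fun _ _ => isMultiplier_circleChar _) hF]
  congr 1
  have hIcc : Finset.Icc 1 N = Finset.Ico 1 (N + 1) := by
    ext n; simp
  rw [hIcc, Finset.sum_Ico_eq_sum_range, Nat.add_sub_cancel]
  refine Finset.sum_congr rfl fun n _ => ?_
  rw [multOp_circleChar]
  push_cast
  rw [add_comm 1]

theorem isMultiplier_mainMult (P : Polynomial ℤ) (n s : ℕ) : IsMultiplier (mainMult P n s) := by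
  classical
  refine IsMultiplier.sum _ fun θ _ => ?_
  have h := isMultiplier_ite_norm θ (min ((1 / 2) ^ (n * P.natDegree)) (arcRadius s)) (gaussMult P θ)
  simp only [le_min_iff] at h
  convert h

/-- The multiplier of the Fejér average. -/
noncomputable def fejerMult (Q k : ℕ) (α : UnitAddCircle) : ℂ :=
  (1 / (2 ^ k * 2 ^ k : ℂ)) * ∑ l ∈ Finset.range (2 ^ k), ∑ m ∈ Finset.range (2 ^ k),
    circleChar (-((Q : ℤ) * ((m : ℤ) - l)) • α)

theorem isMultiplier_fejerMult (Q k : ℕ) : IsMultiplier (fejerMult Q k) :=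
  (isMultiplier_const _).mul (IsMultiplier.sum _ fun _ _ => IsMultiplier.sum _ fun _ _ =>
    isMultiplier_circleChar _)

theorem multOp_fejerMult (Q k : ℕ) {F : UnitAddCircle → ℂ}
    (hF : MeasureTheory.MemLp F 2 AddCircle.haarAddCircle) (x : ℤ) :
    multOp (fejerMult Q k) F x = fejerAvg Q k (fourierCoeff F) x := by
  unfold fejerMult fejerAvg
  rw [multOp_const_mul, multOp_sum _ (fun _ _ => IsMultiplier.sum _ fun _ _ =>
    isMultiplier_circleChar _) hF, one_div_mul_eq_div]
  congr 1
  refine Finset.sum_congr rfl fun l _ => ?_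
  rw [multOp_sum _ (fun _ _ => isMultiplier_circleChar _) hF]
  refine Finset.sum_congr rfl fun m _ => ?_
  rw [multOp_circleChar]

/-- The normalised Dirichlet kernel. -/
noncomputable def dirichletMean (M : ℕ) (β : UnitAddCircle) : ℂ :=
  (1 / (M : ℂ)) * ∑ l ∈ Finset.range M, circleChar β ^ l

theorem fejerMult_eq (Q k : ℕ) (α : UnitAddCircle) :
    fejerMult Q k α = ((‖dirichletMean (2 ^ k) (Q • α)‖ ^ 2 : ℝ) : ℂ) := by
  have h1 : ∀ l m : ℕ, circleChar (-((Q : ℤ) * ((m : ℤ) - l)) • α) =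
      circleChar (Q • α) ^ l * (starRingEnd ℂ) (circleChar (Q • α) ^ m) := by
    intro l m
    rw [← circleChar_nsmul, ← circleChar_nsmul, ← circleChar_neg, ← circleChar_add]
    congr 1
    have e1 : l • Q • α = ((l : ℤ) * Q) • α := by
      rw [mul_smul, natCast_zsmul, natCast_zsmul]
    have e2 : m • Q • α = ((m : ℤ) * Q) • α := by
      rw [mul_smul, natCast_zsmul, natCast_zsmul]
    rw [e1, e2, ← neg_smul, ← add_smul]
    congr 1
    ring
  rw [Complex.ofReal_pow, ← Complex.mul_conj', dirichletMean, fejerMult]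
  simp_rw [h1]
  rw [map_mul, map_sum, mul_mul_mul_comm, Finset.sum_mul_sum]
  congr 1
  push_cast
  rw [map_div₀, map_one, map_pow, Complex.conj_ofNat, div_mul_div_comm, one_mul]

theorem norm_dirichletMean_le_one (M : ℕ) (β : UnitAddCircle) : ‖dirichletMean M β‖ ≤ 1 := by
  rcases Nat.eq_zero_or_pos M with h | h
  · simp [dirichletMean, h]
  rw [dirichletMean, norm_mul, norm_div, norm_one, Complex.norm_natCast]
  have h1 : ‖∑ l ∈ Finset.range M, circleChar β ^ l‖ ≤ M := by
    refine (norm_sum_le _ _).trans ?_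
    simp [norm_circleChar]
  have h0 : (0 : ℝ) < M := by exact_mod_cast h
  rw [one_div, inv_mul_le_iff₀ h0, mul_one]
  exact h1

theorem norm_dirichletMean_sub_one_le {M : ℕ} (hM : 1 ≤ M) (β : UnitAddCircle) :
    ‖dirichletMean M β - 1‖ ≤ 2 * Real.pi * (M * ‖β‖) := by
  have h0 : (0 : ℝ) < M := by exact_mod_cast hM
  have hC : (M : ℂ) ≠ 0 := by exact_mod_cast (by omega : M ≠ 0)
  have e : dirichletMean M β - 1 = (1 / (M : ℂ)) * ∑ l ∈ Finset.range M, (circleChar β ^ l - 1) := by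
    rw [Finset.sum_sub_distrib, mul_sub, dirichletMean]
    congr 1
    simp [hC]
  rw [e, norm_mul, norm_div, norm_one, Complex.norm_natCast]
  have h1 : ‖∑ l ∈ Finset.range M, (circleChar β ^ l - 1)‖ ≤ M * (2 * Real.pi * (M * ‖β‖)) := by
    refine (norm_sum_le _ _).trans ?_
    have : ∀ l ∈ Finset.range M, ‖circleChar β ^ l - 1‖ ≤ 2 * Real.pi * (M * ‖β‖) := by
      intro l hl
      rw [← circleChar_nsmul]
      refine (norm_circleChar_sub_one_le _).trans ?_
      have hl' : (l : ℝ) ≤ M := by exact_mod_cast (Finset.mem_range.1 hl).le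
      have := norm_nsmul_le (n := l) (a := β)
      have hpi := Real.pi_pos
      gcongr
      exact this.trans (by gcongr)
    refine (Finset.sum_le_sum this).trans ?_
    simp
  calc 1 / (M : ℝ) * _ ≤ 1 / M * (M * (2 * Real.pi * (M * ‖β‖))) := by gcongr
    _ = _ := by field_simp

theorem norm_dirichletMean_mul_le {M : ℕ} (hM : 1 ≤ M) (β : UnitAddCircle) :
    ‖dirichletMean M β‖ * (2 * (M * ‖β‖)) ≤ 1 := by
  have h0 : (0 : ℝ) < M := by exact_mod_cast hM
  have h1 := norm_geom_sum_circleChar_mul_le β M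
  rw [dirichletMean, norm_mul, norm_div, norm_one, Complex.norm_natCast]
  calc 1 / (M : ℝ) * ‖∑ l ∈ Finset.range M, circleChar β ^ l‖ * (2 * (M * ‖β‖))
      = ‖∑ l ∈ Finset.range M, circleChar β ^ l‖ * (2 * ‖β‖) := by field_simp
    _ ≤ 1 := h1

/-! ### Variation of the main terms of one generation -/

/-- Plancherel bounds the square function of the whole family, and the square function bounds the
variation. Only the finitely many indices visited by `φ` matter. -/
theorem l2Norm_seqVar_multOp_le {r : ℝ} (hr : 2 ≤ r) {m : ℕ → UnitAddCircle → ℂ}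
    (hm : ∀ n, IsMultiplier (m n)) {F : UnitAddCircle → ℂ}
    (hF : MeasureTheory.MemLp F 2 AddCircle.haarAddCircle) {φ : ℕ → ℕ} (hφ : Monotone φ)
    {A : Finset ℕ} (hA : ∀ n, φ n ∈ A) {B : ℝ} (hB0 : 0 ≤ B)
    (hB : ∀ α, ∑ n ∈ A, ‖m n α‖ ^ 2 ≤ B ^ 2) :
    l2Norm (fun x => seqVar r (fun n => multOp (m (φ n)) F x)) ≤
      ENNReal.ofReal (2 * B) * l2Norm (fun x => ‖fourierCoeff F x‖ₑ) := by
  rw [ENNReal.ofReal_mul (by norm_num), ENNReal.ofReal_ofNat, mul_assoc]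
  refine l2Norm_seqVar_comp_le hr (fun x n => multOp (m n) F x) hφ hA ?_
  refine (tsum_sum_multOp_sq_le A (fun n _ => hm n) hF hB).trans ?_
  rw [ENNReal.mul_rpow_of_nonneg _ _ (by norm_num), ENNReal.ofReal_rpow_of_nonneg hB0 (by norm_num),
    Real.rpow_two]

theorem l2Norm_multOp_le {m : UnitAddCircle → ℂ} (hm : IsMultiplier m) {F : UnitAddCircle → ℂ}
    (hF : MeasureTheory.MemLp F 2 AddCircle.haarAddCircle) {B : ℝ} (hB0 : 0 ≤ B)
    (hB : ∀ α, ‖m α‖ ≤ B) :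
    l2Norm (fun x => ‖multOp m F x‖ₑ) ≤
      ENNReal.ofReal B * l2Norm (fun x => ‖fourierCoeff F x‖ₑ) := by
  refine l2Norm_le_of_tsum_le ?_
  have h := tsum_sum_multOp_sq_le {()} (m := fun _ => m) (fun _ _ => hm) hF (B := B ^ 2)
    (fun α => by
      rw [Finset.sum_singleton]
      exact pow_le_pow_left₀ (norm_nonneg _) (hB α) 2)
  simp only [Finset.sum_singleton] at h
  refine h.trans ?_
  rw [ENNReal.mul_rpow_of_nonneg _ _ (by norm_num), ENNReal.ofReal_rpow_of_nonneg hB0 (by norm_num),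
    Real.rpow_two]

open Classical in
theorem mainMult_cases (P : Polynomial ℤ) (s : ℕ) (α : UnitAddCircle) :
    (∀ n, mainMult P n s α = 0) ∨ ∃ θ ∈ arcCenters s, ∀ n, mainMult P n s α =
      if ‖α - θ‖ ≤ (1 / 2) ^ (n * P.natDegree) then gaussMult P θ else 0 := by
  rcases arc_sum_cases (M := ℂ) s α with h | ⟨θ, hθ, hα, h⟩
  · refine Or.inl fun n => h _ fun θ _ hne => ?_
    by_contra hcon
    exact hne (if_neg fun hh => hcon hh.2)
  · refine Or.inr ⟨θ, hθ, fun n => ?_⟩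
    have := h (fun θ => if ‖α - θ‖ ≤ (1 / 2) ^ (n * P.natDegree) ∧ ‖α - θ‖ ≤ arcRadius s
      then gaussMult P θ else 0) fun θ _ hne => by
        by_contra hcon
        exact hne (if_neg fun hh => hcon hh.2)
    rw [mainMult, this]
    simp only [and_iff_left hα]

/-- Since `0 ≤ g ≤ 1`, each square is at most the drop `g (m - 1) - g m`, and the drops telescope.
At `m = 0` truncated subtraction makes the drop zero. -/
theorem sum_sq_sub_even_le_one {g : ℕ → ℝ} (hg : Antitone g) (h0 : ∀ n, 0 ≤ g n)
    (h1 : ∀ n, g n ≤ 1) (M : ℕ) :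
    ∑ m ∈ Finset.range M, (g m - g (2 * (m / 2))) ^ 2 ≤ 1 := by
  have hterm : ∀ m, (g m - g (2 * (m / 2))) ^ 2 ≤ g (m - 1) - g m := by
    intro m
    have a1 : g m ≤ g (2 * (m / 2)) := hg (by omega)
    have a2 : g (2 * (m / 2)) ≤ g (m - 1) := hg (by omega)
    nlinarith [h0 m, h1 (2 * (m / 2))]
  have htel : ∀ M, ∑ m ∈ Finset.range (M + 1), (g (m - 1) - g m) = g 0 - g M := by
    intro M
    induction M with
    | zero => simp
    | succ M ih => rw [Finset.sum_range_succ, ih, Nat.add_sub_cancel]; ring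
  cases M with
  | zero => simp
  | succ M =>
    refine (Finset.sum_le_sum fun m _ => hterm m).trans ?_
    rw [htel]
    linarith [h0 M, h1 0]

/-- At a fixed frequency only one arc is active, so the main term is a Gauss sum times an indicator
decreasing in the scale. Rounding off one binary digit then changes it at only one of the indices
summed here. -/
theorem sum_norm_mainMult_sub_sq_le (P : Polynomial ℤ) {s : ℕ} {B : ℝ}
    (hS : ∀ θ ∈ arcCenters s, ‖gaussMult P θ‖ ≤ B) (i M : ℕ) (α : UnitAddCircle) :
    ∑ ν ∈ (Finset.range M).image (fun m => 2 ^ i * m),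
      ‖mainMult P ν s α - mainMult P (2 ^ (i + 1) * (ν / 2 ^ (i + 1))) s α‖ ^ 2 ≤ B ^ 2 := by
  classical
  rw [Finset.sum_image fun a _ b _ hab => Nat.eq_of_mul_eq_mul_left (by positivity) hab]
  have hidx : ∀ m, 2 ^ (i + 1) * (2 ^ i * m / 2 ^ (i + 1)) = 2 ^ i * (2 * (m / 2)) := by
    intro m
    rw [pow_succ, Nat.mul_div_mul_left _ _ (by positivity), mul_assoc]
  simp_rw [hidx]
  rcases mainMult_cases P s α with h | ⟨θ, hθ, h⟩
  · simp only [h, sub_zero, norm_zero]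
    simp
    positivity
  · set g : ℕ → ℝ := fun m => if ‖α - θ‖ ≤ (1 / 2) ^ (2 ^ i * m * P.natDegree) then 1 else 0 with hg
    have e : ∀ m, mainMult P (2 ^ i * m) s α = (g m : ℂ) * gaussMult P θ := by
      intro m
      rw [h, hg]
      dsimp only
      split_ifs <;> simp
    have hanti : Antitone g := by
      intro a b hab
      simp only [hg]
      have hle : (1 / 2 : ℝ) ^ (2 ^ i * b * P.natDegree) ≤ (1 / 2) ^ (2 ^ i * a * P.natDegree) :=
        pow_le_pow_of_le_one (by norm_num) (by norm_num) (by gcongr)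
      split_ifs with h1 h2
      · exact le_rfl
      · exact absurd (h1.trans hle) h2
      · norm_num
      · exact le_rfl
    have hg0 : ∀ n, 0 ≤ g n := fun n => by simp only [hg]; split_ifs <;> norm_num
    have hg1 : ∀ n, g n ≤ 1 := fun n => by simp only [hg]; split_ifs <;> norm_num
    calc ∑ m ∈ Finset.range M,
          ‖mainMult P (2 ^ i * m) s α - mainMult P (2 ^ i * (2 * (m / 2))) s α‖ ^ 2
        = ∑ m ∈ Finset.range M, (g m - g (2 * (m / 2))) ^ 2 * ‖gaussMult P θ‖ ^ 2 := by
          refine Finset.sum_congr rfl fun m _ => ?_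
          rw [e, e, ← sub_mul, norm_mul, mul_pow, ← Complex.ofReal_sub, Complex.norm_real,
            Real.norm_eq_abs, sq_abs]
      _ ≤ 1 * B ^ 2 := by
          rw [← Finset.sum_mul]
          gcongr
          · exact sum_sq_sub_even_le_one hanti hg0 hg1 M
          · exact hS θ hθ
      _ = _ := one_mul _

/-- Rademacher–Menshov: the variation of the main terms over the scales below `2 ^ (J + 1)`. -/
theorem l2Norm_seqVar_mainMult_small_le {r : ℝ} (hr : 2 ≤ r) (P : Polynomial ℤ) {s : ℕ} {B : ℝ}
    (hB0 : 0 ≤ B) (hS : ∀ θ ∈ arcCenters s, ‖gaussMult P θ‖ ≤ B) {F : UnitAddCircle → ℂ}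
    (hF : MeasureTheory.MemLp F 2 AddCircle.haarAddCircle) {J T : ℕ} (hT : T < 2 ^ (J + 1)) :
    l2Norm (fun x => seqVar r (fun n => multOp (mainMult P (min n T) s) F x)) ≤
      (J + 1 : ℕ) * (ENNReal.ofReal (2 * B) * l2Norm (fun x => ‖fourierCoeff F x‖ₑ)) := by
  let m : ℕ → ℕ → UnitAddCircle → ℂ := fun i ν α =>
    mainMult P ν s α - mainMult P (2 ^ (i + 1) * (ν / 2 ^ (i + 1))) s α
  -- `φ i n` clears the last `i` binary digits of `min n T`. The increments from `φ (i + 1) n` to `φ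
  -- i n` telescope from `0` to `min n T` in `J + 1` stages.
  let φ : ℕ → ℕ → ℕ := fun i n => 2 ^ i * (min n T / 2 ^ i)
  have hmono : ∀ i, Monotone (φ i) := fun i a b hab =>
    Nat.mul_le_mul_left _ (Nat.div_le_div_right (min_le_min hab le_rfl))
  have hmem : ∀ i n, φ i n ∈ (Finset.range (T + 1)).image (fun m => 2 ^ i * m) := fun i n =>
    Finset.mem_image.2 ⟨min n T / 2 ^ i, Finset.mem_range.2 (Nat.lt_succ_of_le
      ((Nat.div_le_self _ _).trans (min_le_right _ _))), rfl⟩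
  have hdec : ∀ x n, multOp (mainMult P (min n T) s) F x =
      multOp (mainMult P 0 s) F x + ∑ i ∈ Finset.range (J + 1), multOp (m i (φ i n)) F x := by
    intro x n
    have e : ∀ i, multOp (m i (φ i n)) F x =
        multOp (mainMult P (φ i n) s) F x - multOp (mainMult P (φ (i + 1) n) s) F x := by
      intro i
      rw [multOp_sub (isMultiplier_mainMult P _ s) (isMultiplier_mainMult P _ s) hF]
      have hidx : 2 ^ (i + 1) * (φ i n / 2 ^ (i + 1)) = φ (i + 1) n := by
        dsimp only [φ]
        rw [pow_succ, Nat.mul_div_mul_left _ _ (by positivity), Nat.div_div_eq_div_mul]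
      rw [hidx]
    simp_rw [e]
    rw [Finset.sum_range_sub' (fun i => multOp (mainMult P (φ i n) s) F x)]
    have e0 : φ 0 n = min n T := by simp [φ]
    have e1 : φ (J + 1) n = 0 := by
      dsimp only [φ]
      rw [Nat.div_eq_of_lt, mul_zero]
      exact (min_le_right _ _).trans_lt hT
    rw [e0, e1]
    ring
  have hpt : ∀ x, seqVar r (fun n => multOp (mainMult P (min n T) s) F x) ≤
      ∑ i ∈ Finset.range (J + 1), seqVar r (fun n => multOp (m i (φ i n)) F x) := by
    intro x
    rw [funext (hdec x)]
    refine (seqVar_add_le (by linarith) _ _).trans ?_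
    rw [seqVar_const (by linarith), zero_add]
    exact seqVar_sum_le (by linarith) _ _
  refine (l2Norm_mono hpt).trans ((l2Norm_sum_le _ _).trans ?_)
  have hmult : ∀ i ν, IsMultiplier (m i ν) := fun i ν =>
    (isMultiplier_mainMult P _ s).sub (isMultiplier_mainMult P _ s)
  have hsum : ∀ i α, ∑ ν ∈ (Finset.range (T + 1)).image (fun m => 2 ^ i * m), ‖m i ν α‖ ^ 2 ≤
      B ^ 2 := fun i => sum_norm_mainMult_sub_sq_le P hS i (T + 1)
  have hi : ∀ i ∈ Finset.range (J + 1),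
      l2Norm (fun x => seqVar r (fun n => multOp (m i (φ i n)) F x)) ≤
        ENNReal.ofReal (2 * B) * l2Norm (fun x => ‖fourierCoeff F x‖ₑ) := fun i _ =>
    l2Norm_seqVar_multOp_le hr (hmult i) hF (hmono i) (hmem i) hB0 (hsum i)
  calc _ ≤ ∑ i ∈ Finset.range (J + 1),
        ENNReal.ofReal (2 * B) * l2Norm (fun x => ‖fourierCoeff F x‖ₑ) := Finset.sum_le_sum hi
    _ = _ := by rw [Finset.sum_const, Finset.card_range, nsmul_eq_mul]

/-- Beyond scale `2 ^ (2 * s + 3)` the arcs are narrow compared with `1 / Q`, where `Q = (2 ^ (s +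
1))!`. The logarithm of this threshold is linear in `s`, so Rademacher–Menshov is cheap below it. -/
theorem clog_factorial_add_two_le (s : ℕ) :
    Nat.clog 2 (2 ^ (s + 1)).factorial + 2 ≤ 2 ^ (2 * s + 3) := by
  have h1 : (2 ^ (s + 1)).factorial ≤ 2 ^ (2 ^ (2 * s + 1)) := by
    calc (2 ^ (s + 1)).factorial ≤ (2 ^ (s + 1)) ^ (2 ^ (s + 1)) := Nat.factorial_le_pow _
      _ = 2 ^ ((s + 1) * 2 ^ (s + 1)) := by rw [← pow_mul]
      _ ≤ 2 ^ (2 ^ (2 * s + 1)) := by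
          apply Nat.pow_le_pow_right (by norm_num)
          calc (s + 1) * 2 ^ (s + 1) ≤ 2 ^ s * 2 ^ (s + 1) :=
                Nat.mul_le_mul_right _ Nat.lt_two_pow_self
            _ = 2 ^ (2 * s + 1) := by rw [← pow_add]; congr 1; ring
  have h2 := Nat.clog_le_of_le_pow h1
  have h3 : 2 ^ (2 * s + 3) = 4 * 2 ^ (2 * s + 1) := by rw [pow_add, pow_add]; ring
  have h4 : 1 ≤ 2 ^ (2 * s + 1) := Nat.one_le_two_pow
  omega

/-- Comparison of a sharp cut-off with the Fejér kernel near a torsion point of order dividing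
`Q`. -/
theorem norm_cutoff_sub_fejerMult_le {Q κ e : ℕ} (hQ1 : 2 ^ κ ≤ 2 * Q) (hQ2 : Q ≤ 2 ^ κ)
    (he : κ ≤ e) {α θ : UnitAddCircle} (hθ : Q • θ = 0) (hα : Q * ‖α - θ‖ ≤ 1 / 2)
    {v : ℂ} (hv : v = if 2 ^ e * ‖α - θ‖ ≤ 1 then 1 else 0) :
    ‖v - fejerMult Q (e - κ) α‖ ≤ 16 * Real.pi * bump (2 ^ e * ‖α - θ‖) := by
  set b := ‖α - θ‖ with hb
  have hb0 : 0 ≤ b := norm_nonneg _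
  set t := 2 ^ e * b with ht
  have ht0 : 0 ≤ t := by positivity
  have hβ : ‖Q • α‖ = Q * b := by
    have : Q • α = Q • (α - θ) := by rw [smul_sub, hθ, sub_zero]
    rw [this, UnitAddCircle.norm_nsmul_of_le hα]
  -- Chosen so that `M * Q` agrees with `2 ^ e` up to a factor `2`: the Fejér kernel then lives at
  -- the scale of the cut-off.
  set M := 2 ^ (e - κ) with hM
  have hM1 : 1 ≤ M := Nat.one_le_two_pow
  have hsplit : (2 : ℝ) ^ e = (M : ℝ) * 2 ^ κ := by
    rw [hM]; push_cast; rw [← pow_add, Nat.sub_add_cancel he]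
  have hQ1R : (2 : ℝ) ^ κ ≤ 2 * Q := by exact_mod_cast hQ1
  have hQ2R : (Q : ℝ) ≤ 2 ^ κ := by exact_mod_cast hQ2
  have hMt : M * ‖Q • α‖ ≤ t := by
    rw [hβ, ht, hsplit]
    calc (M : ℝ) * (Q * b) ≤ M * (2 ^ κ * b) := by gcongr
      _ = _ := by ring
  have htM : t ≤ 2 * (M * ‖Q • α‖) := by
    rw [hβ, ht, hsplit]
    calc (M : ℝ) * 2 ^ κ * b ≤ M * (2 * Q) * b := by gcongr
      _ = _ := by ring
  set D := dirichletMean M (Q • α) with hD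
  have hD1 : ‖D‖ ≤ 1 := norm_dirichletMean_le_one _ _
  have hD2 := norm_dirichletMean_sub_one_le hM1 (Q • α)
  have hD3 := norm_dirichletMean_mul_le hM1 (Q • α)
  rw [← hD] at hD2 hD3
  have hpi := Real.pi_gt_three
  rw [fejerMult_eq, ← hM, ← hD]
  rcases le_or_gt t 1 with h1 | h1
  · rw [hv, if_pos h1]
    have e1 : ‖(1 : ℂ) - ((‖D‖ ^ 2 : ℝ) : ℂ)‖ = |1 - ‖D‖ ^ 2| := by
      rw [← Complex.ofReal_one, ← Complex.ofReal_sub, Complex.norm_real, Real.norm_eq_abs]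
    rw [e1, abs_of_nonneg (by nlinarith [norm_nonneg D])]
    have e2 : 1 - ‖D‖ ≤ ‖D - 1‖ := by
      have := norm_sub_norm_le (1 : ℂ) D
      rwa [norm_one, norm_sub_rev] at this
    have e3 : 1 - ‖D‖ ^ 2 ≤ 2 * ‖D - 1‖ := by nlinarith [norm_nonneg D]
    have e4 := le_four_mul_bump_of_le_one ht0 h1
    have e5 : ‖D - 1‖ ≤ 2 * Real.pi * t := hD2.trans (by gcongr)
    have e6 : Real.pi * t ≤ Real.pi * (4 * bump t) := by gcongr
    linarith
  · rw [hv, if_neg (not_le.2 h1), zero_sub, norm_neg, Complex.norm_real, Real.norm_eq_abs,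
      abs_of_nonneg (by positivity)]
    have e1 : ‖D‖ * t ≤ 1 := le_trans (by gcongr) hD3
    have e2 : ‖D‖ ≤ t⁻¹ := by
      rw [← one_div, le_div_iff₀ (by linarith)]; exact e1
    have e3 := inv_le_four_mul_bump_of_one_le h1.le
    have e4 := bump_nonneg ht0
    nlinarith [norm_nonneg D]

theorem bump_sq_le {u : ℝ} (hu : 0 ≤ u) : bump u ^ 2 ≤ bump u := by
  have h0 := bump_nonneg hu
  have h1 : bump u ≤ 1 := by
    unfold bump
    rw [div_le_one (by positivity)]
    nlinarith
  nlinarith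

/-- The difference between the main terms and their Fejér models is square summable. -/
theorem sum_norm_mainMult_sub_fejer_sq_le (P : Polynomial ℤ) (hd : 1 ≤ P.natDegree) {s : ℕ} {B : ℝ}
    (hS : ∀ θ ∈ arcCenters s, ‖gaussMult P θ‖ ≤ B) (U : ℕ) (α : UnitAddCircle) :
    ∑ n ∈ Finset.Icc (2 ^ (2 * s + 3)) U, ‖mainMult P n s α -
      fejerMult (2 ^ (s + 1)).factorial
        (n * P.natDegree - Nat.clog 2 (2 ^ (s + 1)).factorial) α *
        mainMult P (2 ^ (2 * s + 3)) s α‖ ^ 2 ≤ (32 * Real.pi * B) ^ 2 := by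
  classical
  have hκ2 := clog_factorial_add_two_le s
  set Q := (2 ^ (s + 1)).factorial with hQ
  set κ := Nat.clog 2 Q with hκ
  set T := 2 ^ (2 * s + 3) with hT
  set d := P.natDegree with hddef
  have hpow2 : 2 ≤ 2 ^ (s + 1) := by
    calc 2 = 2 ^ 1 := by norm_num
      _ ≤ _ := Nat.pow_le_pow_right (by norm_num) (by omega)
  have hQ2 : 1 < Q := lt_of_lt_of_le (by omega) (Nat.self_le_factorial (2 ^ (s + 1)))
  have hQle : Q ≤ 2 ^ κ := Nat.le_pow_clog (by norm_num) Q
  have hκ1 : 1 ≤ κ := Nat.clog_pos (by norm_num) hQ2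
  have hQge : 2 ^ κ ≤ 2 * Q := by
    have h1 : 2 ^ (κ - 1) < Q := Nat.pow_pred_clog_lt_self (by norm_num) hQ2
    have h2 : 2 ^ κ = 2 * 2 ^ (κ - 1) := by
      rw [← pow_succ']; congr 1; omega
    omega
  have hTd : ∀ n, T ≤ n → κ + 2 ≤ n * d := fun n hn =>
    hκ2.trans (hn.trans (Nat.le_mul_of_pos_right n hd))
  rcases mainMult_cases P s α with h | ⟨θ, hθ, h⟩
  · simp only [h, mul_zero, sub_zero, norm_zero]
    simp
    positivity
  have hB0 : 0 ≤ B := (norm_nonneg _).trans (hS θ hθ)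
  have hQθ : Q • θ = 0 := by
    apply addOrderOf_dvd_iff_nsmul_eq_zero.1
    exact Nat.dvd_factorial (addOrderOf_pos_of_mem_arcCenters hθ) (mem_arcCenters.1 hθ).2.le
  -- Away from the widest arc all the main terms with `n ≥ T` vanish, and the factor `mainMult P T
  -- s` removes the Fejér term as well.
  by_cases hαT : ‖α - θ‖ ≤ (1 / 2) ^ (T * d)
  · have hα : (Q : ℝ) * ‖α - θ‖ ≤ 1 / 2 := by
      have h1 : (1 / 2 : ℝ) ^ (T * d) ≤ (1 / 2) ^ (κ + 2) :=
        pow_le_pow_of_le_one (by norm_num) (by norm_num) (hTd T le_rfl)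
      have hQR : (Q : ℝ) ≤ 2 ^ κ := by exact_mod_cast hQle
      calc (Q : ℝ) * ‖α - θ‖ ≤ 2 ^ κ * (1 / 2) ^ (κ + 2) := by
            gcongr
            exact hαT.trans h1
        _ = (2 * (1 / 2)) ^ κ * (1 / 2) ^ 2 := by rw [pow_add, mul_pow, mul_assoc]
        _ ≤ 1 / 2 := by norm_num
    have hterm : ∀ n ∈ Finset.Icc T U, ‖mainMult P n s α - fejerMult Q (n * d - κ) α *
        mainMult P T s α‖ ^ 2 ≤ (16 * Real.pi * B) ^ 2 * bump (((2 : ℝ) ^ d) ^ n * ‖α - θ‖) := by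
      intro n hn
      have hn1 := (Finset.mem_Icc.1 hn).1
      set v : ℂ := if 2 ^ (n * d) * ‖α - θ‖ ≤ 1 then 1 else 0 with hv
      have hmain : mainMult P n s α = v * gaussMult P θ := by
        rw [h, hv]
        have hiff : ‖α - θ‖ ≤ (1 / 2) ^ (n * d) ↔ 2 ^ (n * d) * ‖α - θ‖ ≤ 1 := by
          rw [one_div, inv_pow, ← one_div, le_div_iff₀ (by positivity), mul_comm]
        simp only [← hddef, hiff]
        split_ifs <;> simp
      have hcmp := norm_cutoff_sub_fejerMult_le hQge hQle (by have := hTd n hn1; omega) hQθ hα hv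
      rw [hmain, h T, if_pos hαT, ← sub_mul, norm_mul, mul_pow]
      have hpw : ((2 : ℝ) ^ d) ^ n = 2 ^ (n * d) := by rw [← pow_mul, mul_comm]
      rw [hpw]
      calc ‖v - fejerMult Q (n * d - κ) α‖ ^ 2 * ‖gaussMult P θ‖ ^ 2
          ≤ (16 * Real.pi * bump (2 ^ (n * d) * ‖α - θ‖)) ^ 2 * B ^ 2 := by
            gcongr
            exact hS θ hθ
        _ = (16 * Real.pi * B) ^ 2 * bump (2 ^ (n * d) * ‖α - θ‖) ^ 2 := by ring
        _ ≤ _ := by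
            gcongr
            exact bump_sq_le (by positivity)
    refine (Finset.sum_le_sum hterm).trans ?_
    rw [← Finset.mul_sum]
    have h2d : (2 : ℝ) ≤ 2 ^ d := le_self_pow₀ (by norm_num) (by omega)
    have hsum : ∑ n ∈ Finset.Icc T U, bump (((2 : ℝ) ^ d) ^ n * ‖α - θ‖) ≤ 2 := by
      calc ∑ n ∈ Finset.Icc T U, bump (((2 : ℝ) ^ d) ^ n * ‖α - θ‖)
          ≤ ∑ n ∈ Finset.range (U + 1), bump (((2 : ℝ) ^ d) ^ n * ‖α - θ‖) := by
            refine Finset.sum_le_sum_of_subset_of_nonneg (fun n hn => ?_) fun n _ _ =>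
              bump_nonneg (by positivity)
            exact Finset.mem_range.2 (Nat.lt_succ_of_le (Finset.mem_Icc.1 hn).2)
        _ ≤ 2 ^ d / (2 ^ d - 1) := sum_bump_le (by linarith) (norm_nonneg _) _
        _ ≤ 2 := by
            rw [div_le_iff₀ (by linarith)]; linarith
    calc (16 * Real.pi * B) ^ 2 * _ ≤ (16 * Real.pi * B) ^ 2 * 2 := by gcongr
      _ ≤ (32 * Real.pi * B) ^ 2 := by nlinarith [sq_nonneg (Real.pi * B)]
  · rw [Finset.sum_eq_zero]
    · positivity
    intro n hn
    have hle : (1 / 2 : ℝ) ^ (n * d) ≤ (1 / 2) ^ (T * d) :=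
      pow_le_pow_of_le_one (by norm_num) (by norm_num)
        (Nat.mul_le_mul_right d (Finset.mem_Icc.1 hn).1)
    rw [h n, h T, if_neg hαT, if_neg fun hh => hαT (hh.trans hle)]
    simp

/-- The variation of the main terms over the large scales, where they are modelled by Fejér
averages along a progression. -/
theorem exists_l2Norm_seqVar_mainMult_large_le {r : ℝ} (hr : 2 < r) :
    ∃ C : ℝ≥0, ∀ (P : Polynomial ℤ) (_ : 1 ≤ P.natDegree) (s : ℕ) (B : ℝ) (_ : 0 ≤ B)
      (_ : ∀ θ ∈ arcCenters s, ‖gaussMult P θ‖ ≤ B) (_ : ∀ n α, ‖mainMult P n s α‖ ≤ B)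
      (F : UnitAddCircle → ℂ) (_ : MeasureTheory.MemLp F 2 AddCircle.haarAddCircle) (S : ℕ),
      l2Norm (fun x => seqVar r (fun n =>
        multOp (mainMult P (max (min n S) (2 ^ (2 * s + 3))) s) F x)) ≤
      (ENNReal.ofReal (2 * (32 * Real.pi * B)) + C * ENNReal.ofReal B) *
        l2Norm (fun x => ‖fourierCoeff F x‖ₑ) := by
  obtain ⟨C, hC⟩ := exists_l2Norm_seqVar_fejerAvg_le hr
  refine ⟨C, fun P hd s B hB0 hS hL F hF S => ?_⟩
  set Q := (2 ^ (s + 1)).factorial with hQ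
  set κ := Nat.clog 2 Q with hκ
  set T := 2 ^ (2 * s + 3) with hT
  set d := P.natDegree with hddef
  -- The Fejér multiplier is near `1` at every point killed by `Q`, not only in generation `s`.
  -- Multiplying `F` first by the main term at scale `T` keeps the right arcs and supplies the Gauss
  -- sums.
  set G : UnitAddCircle → ℂ := fun α => mainMult P T s α * F α with hG
  have hGm : MeasureTheory.MemLp G 2 AddCircle.haarAddCircle := (isMultiplier_mainMult P T s).memLp hF
  set φ : ℕ → ℕ := fun n => max (min n S) T with hφ
  have hφm : Monotone φ := fun a b hab => max_le_max (min_le_min hab le_rfl) le_rfl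
  set U := max S T with hU
  have hφU : ∀ n, φ n ≤ U := fun n => max_le_max (min_le_right _ _) le_rfl
  have hφA : ∀ n, φ n ∈ Finset.Icc T U := fun n => Finset.mem_Icc.2 ⟨le_max_right _ _, hφU n⟩
  set E : ℕ → UnitAddCircle → ℂ := fun n α =>
    mainMult P n s α - fejerMult Q (n * d - κ) α * mainMult P T s α with hE
  have hEm : ∀ n, IsMultiplier (E n) := fun n => (isMultiplier_mainMult P n s).sub
    ((isMultiplier_fejerMult Q _).mul (isMultiplier_mainMult P T s))
  set K := U * d with hK
  have hdec : ∀ x n, multOp (mainMult P (φ n) s) F x =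
      multOp (E (φ n)) F x + fejerAvg Q (K - (K - (φ n * d - κ))) (fourierCoeff G) x := by
    intro x n
    have hk : φ n * d - κ ≤ K := (Nat.sub_le _ _).trans (Nat.mul_le_mul_right d (hφU n))
    rw [Nat.sub_sub_self hk, ← multOp_fejerMult Q _ hGm, hG, ← multOp_mul, hE]
    dsimp only
    rw [multOp_sub (isMultiplier_mainMult P _ s)
      ((isMultiplier_fejerMult Q _).mul (isMultiplier_mainMult P T s)) hF]
    ring
  have hpt : ∀ x, seqVar r (fun n => multOp (mainMult P (φ n) s) F x) ≤
      seqVar r (fun n => multOp (E (φ n)) F x) +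
      seqVar r (fun k => fejerAvg Q (K - (K - k)) (fourierCoeff G) x) := by
    intro x
    rw [funext (hdec x)]
    refine (seqVar_add_le (by linarith) _ _).trans (add_le_add le_rfl ?_)
    exact seqVar_comp_le r (fun k => fejerAvg Q (K - (K - k)) (fourierCoeff G) x)
      (φ := fun n => φ n * d - κ)
      fun a b hab => Nat.sub_le_sub_right (Nat.mul_le_mul_right d (hφm hab)) κ
  refine (l2Norm_mono hpt).trans ((l2Norm_add_le _ _).trans ?_)
  rw [add_mul]
  refine add_le_add ?_ ?_
  · exact l2Norm_seqVar_multOp_le hr.le hEm hF hφm hφA (by positivity)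
      (sum_norm_mainMult_sub_fejer_sq_le P hd hS U)
  · refine (hC Q (Nat.factorial_pos _) (fourierCoeff G) K).trans ?_
    rw [mul_assoc]
    gcongr
    exact l2Norm_multOp_le (isMultiplier_mainMult P T s) hF hB0 (hL T)

/-- Split at `T` by `a n = a (min n T) + a (max n T) - a T`. The small scales cost `2 * s + 4`
stages, the large ones a constant. -/
theorem exists_l2Norm_seqVar_mainMult_le {r : ℝ} (hr : 2 < r) :
    ∃ C : ℝ, 0 ≤ C ∧ ∀ (P : Polynomial ℤ) (_ : 1 ≤ P.natDegree) (s : ℕ) (B : ℝ) (_ : 0 ≤ B)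
      (_ : ∀ θ ∈ arcCenters s, ‖gaussMult P θ‖ ≤ B) (_ : ∀ n α, ‖mainMult P n s α‖ ≤ B)
      (F : UnitAddCircle → ℂ) (_ : MeasureTheory.MemLp F 2 AddCircle.haarAddCircle) (S : ℕ),
      l2Norm (fun x => seqVar r (fun n => multOp (mainMult P (min n S) s) F x)) ≤
      ENNReal.ofReal (C * ((s + 1) * B)) * l2Norm (fun x => ‖fourierCoeff F x‖ₑ) := by
  obtain ⟨C, hC⟩ := exists_l2Norm_seqVar_mainMult_large_le hr
  refine ⟨8 + 64 * Real.pi + C, by positivity, fun P hd s B hB0 hS hL F hF S => ?_⟩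
  set T := 2 ^ (2 * s + 3) with hT
  have hdec : ∀ x n, multOp (mainMult P (min n S) s) F x =
      multOp (mainMult P (min (min n S) T) s) F x +
      (multOp (mainMult P (max (min n S) T) s) F x + -multOp (mainMult P T s) F x) := by
    intro x n
    rcases le_total (min n S) T with h | h
    · rw [min_eq_left h, max_eq_right h]; ring
    · rw [min_eq_right h, max_eq_left h]; ring
  simp_rw [hdec]
  have hpt : ∀ x, seqVar r (fun n => multOp (mainMult P (min (min n S) T) s) F x +
      (multOp (mainMult P (max (min n S) T) s) F x + -multOp (mainMult P T s) F x)) ≤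
      seqVar r (fun n => multOp (mainMult P (min n T) s) F x) +
      seqVar r (fun n => multOp (mainMult P (max (min n S) T) s) F x) := by
    intro x
    refine (seqVar_add_le (by linarith) _ _).trans (add_le_add ?_ ?_)
    · exact seqVar_comp_le r (fun n => multOp (mainMult P (min n T) s) F x)
        (φ := fun n => min n S) fun a b hab => min_le_min hab le_rfl
    · refine (seqVar_add_le (by linarith) _ _).trans ?_
      rw [seqVar_const (by linarith), add_zero]
  refine (l2Norm_mono hpt).trans ((l2Norm_add_le _ _).trans ?_)
  have h1 := l2Norm_seqVar_mainMult_small_le hr.le P hB0 hS hF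
    (Nat.pow_lt_pow_right (by norm_num) (Nat.lt_succ_self (2 * s + 3)))
  have h2 := hC P hd s B hB0 hS hL F hF S
  refine (add_le_add h1 h2).trans ?_
  rw [← mul_assoc, ← add_mul]
  gcongr
  rw [← ENNReal.ofReal_natCast, ← ENNReal.ofReal_mul (by positivity), ← ENNReal.ofReal_coe_nnreal,
    ← ENNReal.ofReal_mul (by positivity), ← ENNReal.ofReal_add (by positivity) (by positivity),
    ← ENNReal.ofReal_add (by positivity) (by positivity)]
  apply ENNReal.ofReal_le_ofReal
  have hs : (0 : ℝ) ≤ s := by positivity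
  have hp : 0 ≤ s * (64 * Real.pi * B + C * B) := by positivity
  have hsB : 0 ≤ s * B := by positivity
  push_cast
  nlinarith

/-! ### The variation along powers of two -/

theorem exists_polyMult_approx (P : Polynomial ℤ) (hP : 0 < P.leadingCoeff)
    (hd : 1 ≤ P.natDegree) :
    ∃ (D y K : ℝ) (w : ℕ → ℕ → UnitAddCircle → ℝ), 0 ≤ D ∧ 0 ≤ y ∧ y < 1 ∧ 0 ≤ K ∧
      (∀ s, ∀ θ ∈ arcCenters s, ‖gaussMult P θ‖ ≤ D * y ^ s) ∧
      (∀ n s α, ‖mainMult P n s α‖ ≤ D * y ^ s) ∧ (∀ S n α, 0 ≤ w S n α) ∧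
      (∀ S M α, ∑ n ∈ Finset.range M, w S n α ≤ K) ∧
      ∀ n S N α, n ≤ S → 2 ^ n ≤ N → N ≤ 2 ^ (n + 1) →
        √‖polyMult P N α - ∑ s ∈ Finset.range S, mainMult P n s α‖ ≤ w S n α := by
  obtain ⟨D, hD, hm, hS⟩ := exists_polyMult_decay P hP hd
  have hD' : (1 : ℝ) ≤ D := by exact_mod_cast hD
  have hδ0 : 0 < 1 / (D : ℝ) := by positivity
  have hδ1 : 1 / (D : ℝ) ≤ 1 := by rw [div_le_one (by linarith)]; exact hD'
  obtain ⟨C, hC0, hC⟩ := exists_sqrt_norm_polyMult_sub_le P hd (by positivity) hδ0 hδ1 hm hS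
  obtain ⟨G, hG0, hG⟩ := exists_sum_errWeight_le (η := 1 / (D : ℝ) / 8) (by positivity) hd
  refine ⟨D, (1 / 2) ^ (1 / (D : ℝ)), C * G,
    fun S n α => C * errWeight (1 / (D : ℝ) / 8) P.natDegree S n α, by positivity, by positivity,
    half_rpow_lt_one hδ0, by positivity, fun s θ hθ => ?_,
    norm_mainMult_le P (by positivity) hδ0.le hS, fun S n α => mul_nonneg hC0 (errWeight_nonneg _ _ _ _ _),
    fun S M α => ?_, hC⟩
  · refine (hS θ (addOrderOf_pos_of_mem_arcCenters hθ)).trans ?_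
    gcongr
    exact rpow_neg_addOrderOf_le hθ hδ0.le
  · rw [← Finset.mul_sum]
    gcongr
    exact hG S M α

/-- The errors are square summable in `n`, and the main terms of generation `s` cost a multiple of
`(s + 1) * y ^ s`, which is summable. Using as many generations as scales keeps all sums finite,
with bounds independent of `S`. -/
theorem exists_l2Norm_seqVar_polyMult_two_pow_le {r : ℝ} (hr : 2 < r) (P : Polynomial ℤ)
    (hP : 0 < P.leadingCoeff) (hd : 1 ≤ P.natDegree) :
    ∃ C : ℝ, 0 ≤ C ∧ ∀ (F : UnitAddCircle → ℂ)
      (_ : MeasureTheory.MemLp F 2 AddCircle.haarAddCircle) (S : ℕ),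
      l2Norm (fun x => seqVar r (fun n => multOp (polyMult P (2 ^ min n S)) F x)) ≤
        ENNReal.ofReal C * l2Norm (fun x => ‖fourierCoeff F x‖ₑ) := by
  obtain ⟨D, y, K, w, hD, hy0, hy1, hK, hgauss, hmain, hw0, hwK, hw⟩ :=
    exists_polyMult_approx P hP hd
  obtain ⟨C, hC0, hC⟩ := exists_l2Norm_seqVar_mainMult_le hr
  have hsummable : Summable fun s : ℕ => C * ((s + 1) * (D * y ^ s)) := by
    have h1 := summable_pow_mul_geometric_of_norm_lt_one 1
      (show ‖y‖ < 1 by rwa [Real.norm_of_nonneg hy0])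
    have h2 := summable_geometric_of_lt_one hy0 hy1
    refine ((h1.add h2).mul_left (C * D)).congr fun s => ?_
    ring
  have hterm0 : ∀ s : ℕ, 0 ≤ C * ((s + 1) * (D * y ^ s)) := fun s => by positivity
  refine ⟨2 * K ^ 2 + ∑' s : ℕ, C * ((s + 1) * (D * y ^ s)),
    add_nonneg (by positivity) (tsum_nonneg hterm0), fun F hF S => ?_⟩
  let φ : ℕ → ℕ := fun n => min n S
  have hφ : Monotone φ := fun a b hab => min_le_min hab le_rfl
  let E : ℕ → UnitAddCircle → ℂ := fun n α =>
    polyMult P (2 ^ n) α - ∑ s ∈ Finset.range S, mainMult P n s α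
  have hEm : ∀ n, IsMultiplier (E n) := fun n => (isMultiplier_polyMult P _).sub
    (IsMultiplier.sum _ fun s _ => isMultiplier_mainMult P n s)
  have hEsum : ∀ α, ∑ n ∈ Finset.range (S + 1), ‖E n α‖ ^ 2 ≤ (K ^ 2) ^ 2 := by
    intro α
    have hE : ∀ n ∈ Finset.range (S + 1), ‖E n α‖ ^ 2 ≤ K ^ 3 * w S n α := by
      intro n hn
      have h1 : √‖E n α‖ ≤ w S n α := hw n S (2 ^ n) α (Nat.lt_succ_iff.1 (Finset.mem_range.1 hn))
        le_rfl (Nat.pow_le_pow_right (by norm_num) (Nat.le_succ n))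
      have h2 : w S n α ≤ K := (Finset.single_le_sum (fun i _ => hw0 S i α) hn).trans
        (hwK S (S + 1) α)
      have h3 : ‖E n α‖ = √‖E n α‖ ^ 2 := (Real.sq_sqrt (norm_nonneg _)).symm
      -- Each weight is at most its sum `K`, so three of the four square roots are bounded and the
      -- last is left to be summed.
      calc ‖E n α‖ ^ 2 = √‖E n α‖ ^ 3 * √‖E n α‖ := by rw [h3, Real.sqrt_sq (by positivity)]; ring
        _ ≤ K ^ 3 * w S n α := by
            gcongr
            exact h1.trans h2
    refine (Finset.sum_le_sum hE).trans ?_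
    rw [← Finset.mul_sum]
    calc K ^ 3 * _ ≤ K ^ 3 * K := by gcongr; exact hwK S (S + 1) α
      _ = (K ^ 2) ^ 2 := by ring
  have hdec : ∀ x n, multOp (polyMult P (2 ^ φ n)) F x = multOp (E (φ n)) F x +
      ∑ s ∈ Finset.range S, multOp (mainMult P (φ n) s) F x := by
    intro x n
    rw [multOp_sub (isMultiplier_polyMult P _)
      (IsMultiplier.sum _ fun s _ => isMultiplier_mainMult P _ s) hF,
      multOp_sum _ (fun s _ => isMultiplier_mainMult P _ s) hF]
    ring
  have hpt : ∀ x, seqVar r (fun n => multOp (polyMult P (2 ^ φ n)) F x) ≤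
      seqVar r (fun n => multOp (E (φ n)) F x) +
      ∑ s ∈ Finset.range S, seqVar r (fun n => multOp (mainMult P (φ n) s) F x) := by
    intro x
    rw [funext (hdec x)]
    refine (seqVar_add_le (by linarith) _ _).trans (add_le_add le_rfl ?_)
    exact seqVar_sum_le (by linarith) _ _
  have herr := l2Norm_seqVar_multOp_le hr.le hEm hF hφ (A := Finset.range (S + 1))
    (fun n => Finset.mem_range.2 (Nat.lt_succ_of_le (min_le_right n S))) (by positivity) hEsum
  refine (l2Norm_mono hpt).trans ((l2Norm_add_le _ _).trans ?_)
  rw [ENNReal.ofReal_add (by positivity) (tsum_nonneg hterm0), add_mul]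
  refine add_le_add herr ((l2Norm_sum_le _ _).trans ?_)
  refine (Finset.sum_le_sum fun s _ =>
    hC P hd s (D * y ^ s) (by positivity) (hgauss s) (fun n => hmain n s) F hF S).trans ?_
  rw [← Finset.sum_mul, ← ENNReal.ofReal_sum_of_nonneg fun s _ => hterm0 s]
  gcongr
  exact hsummable.sum_le_tsum _ fun s _ => hterm0 s

/-! ### Leading binary digits -/

/-- The number obtained from `N` by keeping the leading binary digit and the `j` digits after
it, and setting the remaining ones to zero. -/
def topDigits (j N : ℕ) : ℕ := 2 ^ (Nat.log 2 N - j) * (N / 2 ^ (Nat.log 2 N - j))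

theorem topDigits_le (j N : ℕ) : topDigits j N ≤ N := Nat.mul_div_le _ _

theorem two_pow_log_le_topDigits (j : ℕ) {N : ℕ} (hN : N ≠ 0) :
    2 ^ Nat.log 2 N ≤ topDigits j N := by
  have h : 2 ^ (Nat.log 2 N - (Nat.log 2 N - j)) ≤ N / 2 ^ (Nat.log 2 N - j) := by
    rw [Nat.le_div_iff_mul_le (by positivity), ← pow_add, Nat.sub_add_cancel (Nat.sub_le _ _)]
    exact Nat.pow_log_le_self 2 hN
  calc 2 ^ Nat.log 2 N
      = 2 ^ (Nat.log 2 N - j) * 2 ^ (Nat.log 2 N - (Nat.log 2 N - j)) := by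
        rw [← pow_add, Nat.add_sub_cancel' (Nat.sub_le _ _)]
    _ ≤ topDigits j N := Nat.mul_le_mul_left _ h

theorem log_topDigits (j : ℕ) {N : ℕ} (hN : N ≠ 0) :
    Nat.log 2 (topDigits j N) = Nat.log 2 N :=
  Nat.log_eq_of_pow_le_of_lt_pow (two_pow_log_le_topDigits j hN)
    ((topDigits_le j N).trans_lt (Nat.lt_pow_succ_log_self (by norm_num) N))

theorem topDigits_ne_zero (j : ℕ) {N : ℕ} (hN : N ≠ 0) : topDigits j N ≠ 0 :=
  (lt_of_lt_of_le (by positivity) (two_pow_log_le_topDigits j hN)).ne'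

theorem monotone_topDigits (j : ℕ) : Monotone (topDigits j) := by
  intro a b hab
  rcases Nat.eq_zero_or_pos a with rfl | ha
  · simp [topDigits]
  rcases (Nat.log_mono_right (b := 2) hab).eq_or_lt with h | h
  · rw [topDigits, topDigits, h]
    exact Nat.mul_le_mul_left _ (Nat.div_le_div_right hab)
  · calc topDigits j a ≤ a := topDigits_le j a
      _ ≤ 2 ^ (Nat.log 2 a + 1) := (Nat.lt_pow_succ_log_self (by norm_num) a).le
      _ ≤ 2 ^ Nat.log 2 b := Nat.pow_le_pow_right (by norm_num) h
      _ ≤ topDigits j b := two_pow_log_le_topDigits j (by omega)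

theorem topDigits_topDigits {j k : ℕ} (hjk : j ≤ k) (N : ℕ) :
    topDigits j (topDigits k N) = topDigits j N := by
  rcases eq_or_ne N 0 with rfl | hN
  · simp [topDigits]
  rw [topDigits, log_topDigits k hN, topDigits, topDigits]
  have he : 2 ^ (Nat.log 2 N - j) = 2 ^ (Nat.log 2 N - k) *
      2 ^ ((Nat.log 2 N - j) - (Nat.log 2 N - k)) := by
    rw [← pow_add, Nat.add_sub_cancel' (Nat.sub_le_sub_left hjk _)]
  rw [he, Nat.mul_div_mul_left _ _ (by positivity), Nat.div_div_eq_div_mul]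

theorem topDigits_zero {N : ℕ} (hN : N ≠ 0) : topDigits 0 N = 2 ^ Nat.log 2 N := by
  refine le_antisymm ?_ (two_pow_log_le_topDigits 0 hN)
  have h : N / 2 ^ Nat.log 2 N < 2 := by
    rw [Nat.div_lt_iff_lt_mul (by positivity), mul_comm, ← pow_succ]
    exact Nat.lt_pow_succ_log_self (by norm_num) N
  rw [topDigits, Nat.sub_zero]
  calc _ ≤ 2 ^ Nat.log 2 N * 1 := Nat.mul_le_mul_left _ (Nat.lt_succ_iff.1 h)
    _ = _ := mul_one _

theorem topDigits_of_log_le {j N : ℕ} (h : Nat.log 2 N ≤ j) : topDigits j N = N := by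
  rw [topDigits, Nat.sub_eq_zero_of_le h, pow_zero, one_mul, Nat.div_one]

theorem sub_topDigits_mul_le (j N : ℕ) : (N - topDigits j N) * 2 ^ j ≤ N := by
  rcases eq_or_ne N 0 with rfl | hN
  · simp
  rcases le_total (Nat.log 2 N) j with h | h
  · rw [topDigits_of_log_le h]; simp
  have h1 : N - topDigits j N ≤ 2 ^ (Nat.log 2 N - j) := by
    have h2 := Nat.div_add_mod N (2 ^ (Nat.log 2 N - j))
    have h3 := Nat.mod_lt N (show 0 < 2 ^ (Nat.log 2 N - j) by positivity)
    rw [topDigits]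
    omega
  calc (N - topDigits j N) * 2 ^ j ≤ 2 ^ (Nat.log 2 N - j) * 2 ^ j := Nat.mul_le_mul_right _ h1
    _ = 2 ^ Nat.log 2 N := by rw [← pow_add, Nat.sub_add_cancel h]
    _ ≤ N := Nat.pow_log_le_self 2 hN

/-- The positive numbers up to `2 ^ S` with at most `j` binary digits after the leading one. -/
def topDigitsRange (j S : ℕ) : Finset ℕ :=
  (Finset.Icc 1 (2 ^ S)).filter fun ν => topDigits j ν = ν

/-- Within a dyadic block such a number is determined by its quotient by `2 ^ (n - j)`, which is
less than `2 ^ (j + 1)`. -/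
theorem card_topDigitsRange_filter_le (j S n : ℕ) :
    ((topDigitsRange j S).filter fun ν => Nat.log 2 ν = n).card ≤ 2 ^ (j + 1) := by
  rw [← Finset.card_range (2 ^ (j + 1))]
  refine Finset.card_le_card_of_injOn (fun ν => ν / 2 ^ (n - j)) (fun ν hν => ?_) ?_
  · have hlog := (Finset.mem_filter.1 hν).2
    refine Finset.mem_coe.2 (Finset.mem_range.2 ?_)
    rw [Nat.div_lt_iff_lt_mul (by positivity), ← pow_add]
    calc ν < 2 ^ (Nat.log 2 ν + 1) := Nat.lt_pow_succ_log_self (by norm_num) ν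
      _ ≤ 2 ^ (j + 1 + (n - j)) := Nat.pow_le_pow_right (by norm_num) (by omega)
  · intro a ha b hb hab
    have ha1 := Finset.mem_filter.1 (Finset.mem_coe.1 ha)
    have hb1 := Finset.mem_filter.1 (Finset.mem_coe.1 hb)
    have ha2 := (Finset.mem_filter.1 ha1.1).2
    have hb2 := (Finset.mem_filter.1 hb1.1).2
    rw [topDigits, ha1.2] at ha2
    rw [topDigits, hb1.2] at hb2
    dsimp only at hab
    rw [← ha2, ← hb2, hab]

/-! ### The variation inside dyadic blocks -/

/-- `N` times the difference of the means is the sum of the `N - M` new terms minus `N - M` copies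
of the old mean. -/
theorem norm_polyMult_sub_polyMult_le (P : Polynomial ℤ) {M N : ℕ} (hM : 1 ≤ M) (hMN : M ≤ N)
    (α : UnitAddCircle) :
    N * ‖polyMult P N α - polyMult P M α‖ ≤ 2 * (N - M : ℕ) := by
  obtain ⟨k, rfl⟩ := Nat.exists_eq_add_of_le hMN
  have hM0 : (M : ℂ) ≠ 0 := by exact_mod_cast (by omega : M ≠ 0)
  have hN0 : ((M + k : ℕ) : ℂ) ≠ 0 := by exact_mod_cast (by omega : M + k ≠ 0)
  have e : ((M + k : ℕ) : ℂ) * (polyMult P (M + k) α - polyMult P M α) =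
      ∑ n ∈ Finset.range k, circleChar (-P.eval (((M + n : ℕ) : ℤ) + 1) • α) -
        k * polyMult P M α := by
    have h1 : ((M + k : ℕ) : ℂ) * polyMult P (M + k) α =
        ∑ n ∈ Finset.range (M + k), circleChar (-P.eval ((n : ℤ) + 1) • α) := by
      rw [polyMult, ← mul_assoc, mul_one_div_cancel hN0, one_mul]
    have h2 : (M : ℂ) * polyMult P M α =
        ∑ n ∈ Finset.range M, circleChar (-P.eval ((n : ℤ) + 1) • α) := by
      rw [polyMult, ← mul_assoc, mul_one_div_cancel hM0, one_mul]
    rw [mul_sub, h1, Finset.sum_range_add, ← h2]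
    push_cast
    ring
  have h := congrArg norm e
  rw [norm_mul, Complex.norm_natCast] at h
  rw [h, Nat.add_sub_cancel_left]
  refine (norm_sub_le _ _).trans ?_
  have h3 := norm_sum_circleChar_le (fun n => -P.eval (((M + n : ℕ) : ℤ) + 1) • α) k
  have h4 : ‖(k : ℂ) * polyMult P M α‖ ≤ k * 1 := by
    rw [norm_mul, Complex.norm_natCast]
    gcongr
    exact norm_polyMult_le_one P M α
  linarith

theorem norm_polyMult_sub_topDigits_le (P : Polynomial ℤ) (j : ℕ) {N : ℕ} (hN : N ≠ 0)
    (α : UnitAddCircle) :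
    ‖polyMult P N α - polyMult P (topDigits j N) α‖ ≤ 2 * (1 / 2) ^ j := by
  have h1 := norm_polyMult_sub_polyMult_le P (Nat.one_le_iff_ne_zero.2 (topDigits_ne_zero j hN))
    (topDigits_le j N) α
  have h2 : ((N - topDigits j N : ℕ) : ℝ) * 2 ^ j ≤ N := by
    exact_mod_cast sub_topDigits_mul_le j N
  have hN0 : (0 : ℝ) < N := by exact_mod_cast Nat.pos_of_ne_zero hN
  have h3 : ((N - topDigits j N : ℕ) : ℝ) ≤ N * (1 / 2) ^ j := by
    rw [one_div, inv_pow, ← div_eq_mul_inv, le_div_iff₀ (by positivity)]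
    exact h2
  refine le_of_mul_le_mul_left (h1.trans ?_) hN0
  linarith

/-- Truncating digits stays within the dyadic block, so both multipliers are compared with the same
main term and their difference is controlled by the weight of the block. The trivial estimate gives
a second bound `2 * 2^(-j)`. -/
theorem sum_norm_polyMult_sub_topDigits_sq_le {P : Polynomial ℤ} {K : ℝ}
    {w : ℕ → ℕ → UnitAddCircle → ℝ} (hw0 : ∀ S n α, 0 ≤ w S n α)
    (hwK : ∀ S M α, ∑ n ∈ Finset.range M, w S n α ≤ K)
    (hw : ∀ n S N α, n ≤ S → 2 ^ n ≤ N → N ≤ 2 ^ (n + 1) →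
      √‖polyMult P N α - ∑ s ∈ Finset.range S, mainMult P n s α‖ ≤ w S n α)
    (j S : ℕ) (α : UnitAddCircle) :
    ∑ ν ∈ topDigitsRange (j + 1) S, ‖polyMult P ν α - polyMult P (topDigits j ν) α‖ ^ 2 ≤
      64 * √(1 / 2) ^ j * K := by
  set ρ := √(1 / 2 : ℝ) with hρdef
  have hρ : ρ ^ 2 = 1 / 2 := Real.sq_sqrt (by norm_num)
  have hρ0 : 0 ≤ ρ := Real.sqrt_nonneg _
  have hlog : ∀ ν ∈ topDigitsRange (j + 1) S, Nat.log 2 ν ∈ Finset.range (S + 1) := by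
    intro ν hν
    have h := (Finset.mem_Icc.1 (Finset.mem_filter.1 hν).1).2
    refine Finset.mem_range.2 (Nat.lt_succ_of_le ?_)
    calc Nat.log 2 ν ≤ Nat.log 2 (2 ^ S) := Nat.log_mono_right h
      _ = S := Nat.log_pow (by norm_num) S
  have hterm : ∀ ν ∈ topDigitsRange (j + 1) S,
      ‖polyMult P ν α - polyMult P (topDigits j ν) α‖ ^ 2 ≤
        16 * ρ ^ (3 * j) * w S (Nat.log 2 ν) α := by
    intro ν hν
    have hν0 : ν ≠ 0 := by
      have := (Finset.mem_Icc.1 (Finset.mem_filter.1 hν).1).1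
      omega
    set M := ∑ s ∈ Finset.range S, mainMult P (Nat.log 2 ν) s α with hM
    have hS := Nat.lt_succ_iff.1 (Finset.mem_range.1 (hlog ν hν))
    have hlt := Nat.lt_pow_succ_log_self (b := 2) (by norm_num) ν
    have h1 := hw _ S ν α hS (Nat.pow_log_le_self 2 hν0) hlt.le
    have h2 := hw _ S (topDigits j ν) α hS (two_pow_log_le_topDigits j hν0)
      ((topDigits_le j ν).trans hlt.le)
    rw [← hM] at h1 h2
    have h3 := norm_polyMult_sub_topDigits_le P j hν0 α
    have hW := hw0 S (Nat.log 2 ν) α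
    set W := w S (Nat.log 2 ν) α
    have e1 : ‖polyMult P ν α - M‖ ≤ W ^ 2 := (Real.sqrt_le_left hW).1 h1
    have e2 : ‖polyMult P (topDigits j ν) α - M‖ ≤ W ^ 2 := (Real.sqrt_le_left hW).1 h2
    have e3 : ‖polyMult P ν α - polyMult P (topDigits j ν) α‖ ≤ 2 * W ^ 2 := by
      have := norm_sub_le (polyMult P ν α - M) (polyMult P (topDigits j ν) α - M)
      rw [sub_sub_sub_cancel_right] at this
      linarith
    set u := ‖polyMult P ν α - polyMult P (topDigits j ν) α‖
    have t1 : √u ≤ 2 * W := (Real.sqrt_le_left (by positivity)).2 (by nlinarith)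
    have t2 : √u ≤ 2 * ρ ^ j := by
      refine (Real.sqrt_le_left (by positivity)).2 (h3.trans ?_)
      rw [mul_pow, ← pow_mul, mul_comm j 2, pow_mul, hρ]
      nlinarith [show (0 : ℝ) ≤ (1 / 2) ^ j by positivity]
    have hu : u = √u ^ 2 := (Real.sq_sqrt (norm_nonneg _)).symm
    -- Three square roots use the trivial bound and one the weight. The gain `ρ ^ (3 * j)` beats the
    -- `2 ^ (j + 2)` numbers per block, since `2 * ρ ^ 2 = 1`, leaving `ρ ^ j`.
    calc u ^ 2 = √u ^ 3 * √u := by rw [hu, Real.sqrt_sq (by positivity)]; ring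
      _ ≤ (2 * ρ ^ j) ^ 3 * (2 * W) := by gcongr
      _ = 16 * ρ ^ (3 * j) * W := by rw [mul_pow, ← pow_mul, mul_comm j 3]; ring
  rw [← Finset.sum_fiberwise_of_maps_to hlog]
  have hblock : ∀ n ∈ Finset.range (S + 1),
      ∑ ν ∈ (topDigitsRange (j + 1) S).filter (fun ν => Nat.log 2 ν = n),
        ‖polyMult P ν α - polyMult P (topDigits j ν) α‖ ^ 2 ≤ 64 * ρ ^ j * w S n α := by
    intro n _
    have hW := hw0 S n α
    have hb := Finset.sum_le_card_nsmul
      ((topDigitsRange (j + 1) S).filter (fun ν => Nat.log 2 ν = n))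
      (fun ν => ‖polyMult P ν α - polyMult P (topDigits j ν) α‖ ^ 2)
      (16 * ρ ^ (3 * j) * w S n α) fun ν hν => by
        have h := Finset.mem_filter.1 hν
        have := hterm ν h.1
        rwa [h.2] at this
    rw [nsmul_eq_mul] at hb
    refine hb.trans ?_
    have hcard : (((topDigitsRange (j + 1) S).filter (fun ν => Nat.log 2 ν = n)).card : ℝ) ≤
        2 ^ (j + 2) := by exact_mod_cast card_topDigitsRange_filter_le (j + 1) S n
    have hcancel : (2 : ℝ) ^ j * ρ ^ (2 * j) = 1 := by
      rw [pow_mul, hρ, ← mul_pow]; norm_num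
    calc _ ≤ (2 : ℝ) ^ (j + 2) * (16 * ρ ^ (3 * j) * w S n α) := by gcongr
      _ = 64 * (2 ^ j * ρ ^ (2 * j)) * ρ ^ j * w S n α := by ring
      _ = 64 * ρ ^ j * w S n α := by rw [hcancel, mul_one]
  refine (Finset.sum_le_sum hblock).trans ?_
  rw [← Finset.mul_sum]
  gcongr
  exact hwK S (S + 1) α

/-- The `ℓ²` bound for the variation of the averages up to `2 ^ S`, uniformly in `S`. -/
theorem exists_l2Norm_seqVar_polyMult_le {r : ℝ} (hr : 2 < r) (P : Polynomial ℤ)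
    (hP : 0 < P.leadingCoeff) (hd : 1 ≤ P.natDegree) :
    ∃ C : ℝ, 0 ≤ C ∧ ∀ (F : UnitAddCircle → ℂ)
      (_ : MeasureTheory.MemLp F 2 AddCircle.haarAddCircle) (S : ℕ),
      l2Norm (fun x => seqVar r (fun N => multOp (polyMult P (max 1 (min N (2 ^ S)))) F x)) ≤
        ENNReal.ofReal C * l2Norm (fun x => ‖fourierCoeff F x‖ₑ) := by
  obtain ⟨-, -, K, w, -, -, -, hK, -, -, hw0, hwK, hw⟩ := exists_polyMult_approx P hP hd
  obtain ⟨C, hC0, hC⟩ := exists_l2Norm_seqVar_polyMult_two_pow_le hr P hP hd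
  set ρ := √(1 / 2 : ℝ) with hρdef
  have hρ0 : 0 ≤ ρ := Real.sqrt_nonneg _
  set τ := √ρ with hτdef
  have hτ0 : 0 ≤ τ := Real.sqrt_nonneg _
  have hτ : τ ^ 2 = ρ := Real.sq_sqrt hρ0
  have hτ1 : τ < 1 := by
    rw [hτdef, Real.sqrt_lt' one_pos, one_pow, hρdef, Real.sqrt_lt' one_pos]
    norm_num
  have hc0 : 0 ≤ (1 - τ)⁻¹ := inv_nonneg.2 (by linarith)
  refine ⟨C + 2 * (8 * √K) * (1 - τ)⁻¹, by positivity, fun F hF S => ?_⟩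
  let ψ : ℕ → ℕ := fun N => max 1 (min N (2 ^ S))
  have hψ : Monotone ψ := fun a b hab => max_le_max le_rfl (min_le_min hab le_rfl)
  have hψ1 : ∀ N, 1 ≤ ψ N := fun N => le_max_left _ _
  have hψ0 : ∀ N, ψ N ≠ 0 := fun N => Nat.one_le_iff_ne_zero.1 (hψ1 N)
  have hψS : ∀ N, ψ N ≤ 2 ^ S := fun N => max_le Nat.one_le_two_pow (min_le_right _ _)
  have hlogS : ∀ N, Nat.log 2 (ψ N) ≤ S := fun N =>
    (Nat.log_mono_right (hψS N)).trans_eq (Nat.log_pow (by norm_num) S)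
  let m : ℕ → ℕ → UnitAddCircle → ℂ := fun j ν α =>
    polyMult P ν α - polyMult P (topDigits j ν) α
  have hm : ∀ j ν, IsMultiplier (m j ν) := fun j ν =>
    (isMultiplier_polyMult P _).sub (isMultiplier_polyMult P _)
  -- Chaining through the leading digits: stage `0` is a power of two, and after `S` stages no digit
  -- of `ψ N ≤ 2 ^ S` is missing.
  have hdec : ∀ x N, multOp (polyMult P (ψ N)) F x =
      multOp (polyMult P (2 ^ min (Nat.log 2 (ψ N)) S)) F x +
        ∑ j ∈ Finset.range S, multOp (m j (topDigits (j + 1) (ψ N))) F x := by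
    intro x N
    have e : ∀ j, multOp (m j (topDigits (j + 1) (ψ N))) F x =
        multOp (polyMult P (topDigits (j + 1) (ψ N))) F x -
          multOp (polyMult P (topDigits j (ψ N))) F x := by
      intro j
      rw [multOp_sub (isMultiplier_polyMult P _) (isMultiplier_polyMult P _) hF,
        topDigits_topDigits (Nat.le_succ j)]
    simp_rw [e]
    rw [Finset.sum_range_sub (fun j => multOp (polyMult P (topDigits j (ψ N))) F x),
      topDigits_zero (hψ0 N), topDigits_of_log_le (hlogS N), min_eq_left (hlogS N)]
    ring
  have hpt : ∀ x, seqVar r (fun N => multOp (polyMult P (ψ N)) F x) ≤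
      seqVar r (fun n => multOp (polyMult P (2 ^ min n S)) F x) +
      ∑ j ∈ Finset.range S,
        seqVar r (fun N => multOp (m j (topDigits (j + 1) (ψ N))) F x) := by
    intro x
    rw [funext (hdec x)]
    refine (seqVar_add_le (by linarith) _ _).trans
      (add_le_add ?_ (seqVar_sum_le (by linarith) _ _))
    exact seqVar_comp_le r (fun n => multOp (polyMult P (2 ^ min n S)) F x)
      (φ := fun N => Nat.log 2 (ψ N)) fun a b hab => Nat.log_mono_right (hψ hab)
  have hmem : ∀ j N, topDigits (j + 1) (ψ N) ∈ topDigitsRange (j + 1) S := fun j N =>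
    Finset.mem_filter.2 ⟨Finset.mem_Icc.2
      ⟨Nat.one_le_iff_ne_zero.2 (topDigits_ne_zero _ (hψ0 N)), (topDigits_le _ _).trans (hψS N)⟩,
      topDigits_topDigits le_rfl _⟩
  have hsum : ∀ j α, ∑ ν ∈ topDigitsRange (j + 1) S, ‖m j ν α‖ ^ 2 ≤
      (8 * √K * τ ^ j) ^ 2 := by
    intro j α
    refine (sum_norm_polyMult_sub_topDigits_sq_le hw0 hwK hw j S α).trans_eq ?_
    rw [mul_pow, mul_pow, Real.sq_sqrt hK, ← pow_mul, mul_comm j 2, pow_mul, hτ]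
    ring
  have hj : ∀ j ∈ Finset.range S,
      l2Norm (fun x => seqVar r (fun N => multOp (m j (topDigits (j + 1) (ψ N))) F x)) ≤
        ENNReal.ofReal (2 * (8 * √K * τ ^ j)) * l2Norm (fun x => ‖fourierCoeff F x‖ₑ) := fun j _ =>
    l2Norm_seqVar_multOp_le hr.le (hm j) hF ((monotone_topDigits (j + 1)).comp hψ) (hmem j)
      (by positivity) (hsum j)
  refine (l2Norm_mono hpt).trans ((l2Norm_add_le _ _).trans ?_)
  rw [ENNReal.ofReal_add hC0 (by positivity), add_mul]
  refine add_le_add (hC F hF S) ((l2Norm_sum_le _ _).trans ((Finset.sum_le_sum hj).trans ?_))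
  rw [← Finset.sum_mul, ← ENNReal.ofReal_sum_of_nonneg fun j _ => by positivity]
  gcongr
  calc ∑ j ∈ Finset.range S, 2 * (8 * √K * τ ^ j)
      = 2 * (8 * √K) * ∑ j ∈ Finset.range S, τ ^ j := by
        rw [Finset.mul_sum]
        exact Finset.sum_congr rfl fun j _ => by ring
    _ ≤ _ := by
        gcongr
        exact sum_pow_le_of_lt_one hτ0 hτ1 S

/-! ### The variation of the averages -/

/-- A partial sum of the variation involves finitely many indices, which a sufficiently late
truncation leaves unchanged. -/
theorem rVariation_le_iSup_seqVar {r : ℝ} (hr : 0 < r) (a : ℕ+ → ℂ) {b : ℕ → ℂ}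
    (hab : ∀ N : ℕ+, a N = b N) :
    rVariation r a ≤ ⨆ S : ℕ, seqVar r (fun N => b (max 1 (min N (2 ^ S)))) := by
  refine iSup₂_le fun i hi => ?_
  rw [one_div, ENNReal.rpow_inv_le_iff hr, ENNReal.tsum_eq_iSup_nat]
  refine iSup_le fun n => ?_
  rw [← ENNReal.rpow_inv_le_iff hr]
  -- The choice `S = i n` works because `i n ≤ 2 ^ (i n)`.
  refine le_trans ?_ (le_iSup _ (i n : ℕ))
  have hmono : Monotone fun k => (i k : ℕ) := fun k l hkl => hi.monotone hkl
  refine le_trans ?_ (le_iSup₂ (fun k => (i k : ℕ)) hmono)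
  rw [one_div]
  gcongr
  refine le_trans (Finset.sum_le_sum fun k hk => ?_) (ENNReal.sum_le_tsum (Finset.range n))
  have hclamp : ∀ l ≤ n, max 1 (min (i l : ℕ) (2 ^ (i n : ℕ))) = i l := by
    intro l hl
    have hle : (i l : ℕ) ≤ i n := hmono hl
    rw [min_eq_left (hle.trans Nat.lt_two_pow_self.le), max_eq_right (i l).pos]
  have hkn := Finset.mem_range.1 hk
  dsimp only
  rw [hclamp k hkn.le, hclamp (k + 1) hkn, hab, hab]

theorem seqVar_clamp_mono (r : ℝ) (b : ℕ → ℂ) {U V : ℕ} (hUV : U ≤ V) :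
    seqVar r (fun N => b (max 1 (min N U))) ≤ seqVar r (fun N => b (max 1 (min N V))) := by
  have e : (fun N => b (max 1 (min N U))) = fun N => b (max 1 (min (min N U) V)) :=
    funext fun N => by rw [min_assoc, min_eq_left hUV]
  rw [e]
  exact seqVar_comp_le r (fun N => b (max 1 (min N V))) (φ := fun N => min N U)
    fun k l hkl => min_le_min hkl le_rfl

theorem rVariation_const {r : ℝ} (hr : 0 < r) (c : ℂ) : rVariation r (fun _ => c) = 0 := by
  simp [rVariation, hr]

theorem polyAverage_of_natDegree_eq_zero {P : Polynomial ℤ} (hP : P.natDegree = 0) (N : ℕ+)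
    (f : ℤ → ℂ) (x : ℤ) : polyAverage P N f x = f (x + P.coeff 0) := by
  have hN : ((N : ℕ) : ℂ) ≠ 0 := by exact_mod_cast N.ne_zero
  rw [Polynomial.eq_C_of_natDegree_eq_zero hP]
  simp only [polyAverage, Polynomial.eval_C, Polynomial.coeff_C_zero, Finset.sum_const,
    Nat.card_Icc, Nat.add_sub_cancel, nsmul_eq_mul]
  rw [← mul_assoc, one_div_mul_cancel hN, one_mul]

theorem mainTheorem2 (r : ℝ) (hr : 2 < r) (P : Polynomial ℤ) (hP : 0 < P.leadingCoeff) :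
    ∃ C : ℝ≥0, ∀ f : lp (fun _ : ℤ => ℂ) 2,
      l2Norm (fun x => rVariation r (fun N => polyAverage P N f x)) ≤ (C : ℝ≥0∞) * ‖f‖ₑ := by
  have hr0 : 0 < r := by linarith
  -- For constant `P` the averages do not depend on `N` and the variation vanishes; Weyl's
  -- inequality needs positive degree.
  rcases Nat.eq_zero_or_pos P.natDegree with hd | hd
  · refine ⟨0, fun f => ?_⟩
    simp only [polyAverage_of_natDegree_eq_zero hd, rVariation_const hr0]
    simp [l2Norm]
  obtain ⟨C, hC0, hC⟩ := exists_l2Norm_seqVar_polyMult_le hr P hP hd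
  refine ⟨C.toNNReal, fun f => ?_⟩
  obtain ⟨F, hF, hFf⟩ := exists_fourierCoeff_eq f
  have hnorm : l2Norm (fun x => ‖fourierCoeff F x‖ₑ) = ‖f‖ₑ := by
    rw [← l2Norm_enorm_eq f]
    exact congrArg l2Norm (funext fun x => by rw [hFf])
  have havg : ∀ x (N : ℕ+), polyAverage P N f x = multOp (polyMult P N) F x := by
    intro x N
    rw [multOp_polyMult P N hF, polyAverage]
    simp only [hFf]
  have hpt : ∀ x, rVariation r (fun N => polyAverage P N f x) ≤
      ⨆ S : ℕ, seqVar r (fun N => multOp (polyMult P (max 1 (min N (2 ^ S)))) F x) := fun x =>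
    rVariation_le_iSup_seqVar hr0 _ (b := fun N => multOp (polyMult P N) F x) (havg x)
  refine (l2Norm_mono hpt).trans ((l2Norm_iSup_of_monotone fun S T hST x =>
    seqVar_clamp_mono r (fun N => multOp (polyMult P N) F x)
      (Nat.pow_le_pow_right (by norm_num) hST)).trans ?_)
  refine iSup_le fun S => ?_
  rw [← hnorm]
  exact hC F hF S
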